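/- **Definitions.** Let $V$ be a finite-dimensional real inner product space. A *convex cone* in $V$ is the solution set of finitely many inequalities $\langle w,x\rangle\ge 0$; a *cone* is a finite union of convex cones (the empty set is a cone). The *cone group* $\Sigma(V)$ is the abelian group generated by symbols $(P)$, one for each cone $P$ in $V$, with relations $(\emptyset)=0$ and $(P\cup Q)=(P)+(Q)-(P\cap Q)$; equivalently, it is the group of functions $V\to\mathbb Z$ generated by the characteristic functions of cones. For $k\ge 0$ let $\Sigma_k(V)\subset\Sigma(V)$ be the subgroup generated by the cones of dimension at most $k$. Let $L_n$ ($n\ge 0$) be the group of coinvariants of the orthogonal group $O_n$ acting on $\Sigma(\mathbb R^n)$, and write $\langle P\rangle_n\in L_n$ for the class of a cone $P\subset\mathbb R^n$. If $\dim V\ge n$, there is a unique homomorphism $\Sigma_n(V)\to L_n$ that sends $(\varphi(P))$ to $\langle P\rangle_n$ for all isometric linear embeddings $\varphi:\mathbb R^n\to V$ and all cones $P\subset\mathbb R^n$. The graded group $L=\bigoplus_n L_n$ is a commutative graded ring with $\langle P\rangle_i\langle Q\rangle_j=\langle P\times Q\rangle_{i+j}$, with unit $1=\langle\text{point}\rangle_0$.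 Let $d\in L_1$ be the class of a closed half-line in $\mathbb R$ with endpoint $0$. The involution $I$ of $\Sigma(V)$ is the homomorphism that sends the characteristic function of the relative interior of a convex cone $C$ to $(-1)^{\dim C}(C)$; equivalently, $I(P)=\sum_\sigma(-1)^{\dim\sigma}(\sigma)$, summed over the closed conical simplices of a conical triangulation of $P$ (including $\{0\}$ if $P\ne\emptyset$). It induces an involution $I$ of $L_n$. For $n\ge 1$ the operator $\xi\mapsto\xi-(-1)^nI\xi$ maps $\Sigma(\mathbb R^n)$ into $\Sigma_{n-1}(\mathbb R^n)$; composing with $\Sigma_{n-1}(\mathbb R^n)\to L_{n-1}$ and passing to coinvariants gives $\delta_n:L_n\to L_{n-1}$. Put $L_n^+=\ker(\delta_n)\subset L_n$, where $L_{-1}=0$, so that $L_0^+=L_0$, and $L^+=\bigoplus_nL_n^+$. An *(abstract) Euclidean cone* of dimension at most $n$ is a cone with a conical triangulation by conical simplices of dimension at most $n$, together with, for each conical simplex, a linear embedding in $\mathbb R^n$ given up to isometry, compatibly with restriction to faces. It has a class in $L_n$, the sum over its conical simplices of the classes of their relative interiors. An *interior manifold cone* is a nonempty Euclidean cone that is a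 piecewise linear manifold with empty boundary. Let $L_n^{ev}$ (respectively $L_n^{od}$) be the subgroup of $L_n$ generated by the classes of the interior manifold cones of dimension at most $n$ whose dimension is even (respectively odd). **Theorem.** 1. For every $n\ge 0$, $L_n^+=\operatorname{im}(\delta_{n+1}:L_{n+1}\to L_n)$. 2. $L^+$ is a subring of $L$, and $L$ is a free $L^+$-module with basis $\{1,d\}$. 3. $L_n^+=L_n^{ev}$ if $n$ is even, and $L_n^+=L_n^{od}$ if $n$ is odd. 4. For every $n>0$, $L_n^+=\operatorname{im}\bigl(\mathbb I+(-1)^nI:L_n\to L_n\bigr)$, where $\mathbb I$ is the identity of $L_n$. -/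

import Mathlib

open scoped DirectSum

namespace ConeRing

section Cones

variable {V : Type*} [NormedAddCommGroup V] [InnerProductSpace ℝ V]

/-- A convex cone: the solution set of finitely many homogeneous linear inequalities. -/
def IsConvexCone (C : Set V) : Prop :=
  ∃ S : Finset V, C = {x | ∀ w ∈ S, 0 ≤ inner ℝ w x}

/-- A cone: a finite union of convex cones (the empty set is a cone). -/
def IsCone (P : Set V) : Prop :=
  ∃ F : Set (Set V), F.Finite ∧ (∀ C ∈ F, IsConvexCone C) ∧ P = ⋃₀ F

/-- The characteristic function of a set. -/
noncomputable def ind {X : Type*} (P : Set X) : X → ℤ := P.indicator 1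

theorem ind_apply {X : Type*} (P : Set X) (x : X) [Decidable (x ∈ P)] :
    ind P x = if x ∈ P then 1 else 0 := by
  unfold ind; rw [Set.indicator_apply]; simp

theorem ind_inter {X : Type*} (P Q : Set X) : ind (P ∩ Q) = ind P * ind Q := by
  classical
  ext x; by_cases h1 : x ∈ P <;> by_cases h2 : x ∈ Q <;> simp [ind_apply, h1, h2]

variable (V) in
/-- The cone group of `V`: the group generated by the cones in `V`, subject to the valuation
relations, realized as the group of functions generated by the characteristic functions of
cones (see `coneGroup_universal`). -/
def coneGroup : AddSubgroup (V → ℤ) :=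
  AddSubgroup.closure {f | ∃ P : Set V, IsCone P ∧ f = ind P}

theorem IsConvexCone.isCone {C : Set V} (h : IsConvexCone C) : IsCone C :=
  ⟨{C}, Set.finite_singleton C, by simpa using h, by simp⟩

theorem IsConvexCone.inter {C D : Set V} (hC : IsConvexCone C) (hD : IsConvexCone D) :
    IsConvexCone (C ∩ D) := by
  classical
  obtain ⟨S, rfl⟩ := hC
  obtain ⟨T, rfl⟩ := hD
  refine ⟨S ∪ T, ?_⟩
  ext x
  simp only [Set.mem_inter_iff, Set.mem_ofPred_eq, Finset.mem_union]
  exact ⟨fun h w hw => hw.elim (h.1 w) (h.2 w), fun h => ⟨fun w hw => h w (Or.inl hw),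
    fun w hw => h w (Or.inr hw)⟩⟩

theorem isCone_empty : IsCone (∅ : Set V) := ⟨∅, Set.finite_empty, by simp, by simp⟩

theorem isConvexCone_univ : IsConvexCone (Set.univ : Set V) := ⟨∅, by simp⟩

theorem IsCone.union {P Q : Set V} (hP : IsCone P) (hQ : IsCone Q) : IsCone (P ∪ Q) := by
  obtain ⟨F, hF, hF', rfl⟩ := hP
  obtain ⟨G, hG, hG', rfl⟩ := hQ
  exact ⟨F ∪ G, hF.union hG, fun C hC => hC.elim (hF' C) (hG' C), by rw [Set.sUnion_union]⟩

theorem IsCone.inter {P Q : Set V} (hP : IsCone P) (hQ : IsCone Q) : IsCone (P ∩ Q) := by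
  obtain ⟨F, hF, hF', rfl⟩ := hP
  obtain ⟨G, hG, hG', rfl⟩ := hQ
  refine ⟨Set.image2 (fun C D => C ∩ D) F G, hF.image2 _ hG, ?_, ?_⟩
  · rintro _ ⟨C, hC, D, hD, rfl⟩
    exact (hF' C hC).inter (hG' D hD)
  · ext x
    simp only [Set.mem_inter_iff, Set.mem_sUnion, Set.mem_image2]
    constructor
    · rintro ⟨⟨C, hC, hx⟩, D, hD, hx'⟩
      exact ⟨_, ⟨C, hC, D, hD, rfl⟩, hx, hx'⟩
    · rintro ⟨_, ⟨C, hC, D, hD, rfl⟩, hx, hx'⟩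
      exact ⟨⟨C, hC, hx⟩, D, hD, hx'⟩

theorem IsCone.ind_mem {P : Set V} (hP : IsCone P) : ind P ∈ coneGroup V :=
  AddSubgroup.subset_closure ⟨P, hP, rfl⟩

theorem mul_mem_coneGroup {f g : V → ℤ} (hf : f ∈ coneGroup V) (hg : g ∈ coneGroup V) :
    f * g ∈ coneGroup V := by
  induction hf using AddSubgroup.closure_induction with
  | mem f hf =>
    obtain ⟨P, hP, rfl⟩ := hf
    induction hg using AddSubgroup.closure_induction with
    | mem g hg =>
      obtain ⟨Q, hQ, rfl⟩ := hg
      rw [← ind_inter]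
      exact (hP.inter hQ).ind_mem
    | zero => rw [mul_zero]; exact zero_mem _
    | add a b _ _ ha hb => rw [mul_add]; exact add_mem ha hb
    | neg a _ ha => rw [mul_neg]; exact neg_mem ha
  | zero => rw [zero_mul]; exact zero_mem _
  | add a b _ _ ha hb => rw [add_mul]; exact add_mem ha hb
  | neg a _ ha => rw [neg_mul]; exact neg_mem ha

/-- A homomorphism defined on generators, when it respects all linear relations among them. -/
theorem exists_lift {ι G H : Type*} [AddCommGroup G] [AddCommGroup H] (a : ι → G) (b : ι → H)
    (h : ∀ c : ι →₀ ℤ, (c.sum fun i n => n • a i) = 0 → (c.sum fun i n => n • b i) = 0) :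
    ∃ φ : AddSubgroup.closure (Set.range a) →+ H,
      ∀ i, φ ⟨a i, AddSubgroup.subset_closure ⟨i, rfl⟩⟩ = b i := by
  have key : ∀ x : AddSubgroup.closure (Set.range a),
      ∃ c : ι →₀ ℤ, (c.sum fun i n => n • a i) = x := by
    rintro ⟨x, hx⟩
    have hx' : x ∈ Submodule.span ℤ (Set.range a) := by
      rwa [← Submodule.mem_toAddSubgroup, Submodule.span_int_eq_addSubgroupClosure]
    obtain ⟨c, hc⟩ := Finsupp.mem_span_range_iff_exists_finsupp.1 hx'
    exact ⟨c, hc⟩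
  choose r hr using key
  replace h : ∀ c : ι →₀ ℤ, Finsupp.linearCombination ℤ a c = 0 →
      Finsupp.linearCombination ℤ b c = 0 := h
  replace hr : ∀ x, Finsupp.linearCombination ℤ a (r x) = x.1 := hr
  have h2 : ∀ c c' : ι →₀ ℤ, Finsupp.linearCombination ℤ a c = Finsupp.linearCombination ℤ a c' →
      Finsupp.linearCombination ℤ b c = Finsupp.linearCombination ℤ b c' := by
    intro c c' hc
    have := h (c - c') (by rw [map_sub, hc, sub_self])
    rwa [map_sub, sub_eq_zero] at this
  refine ⟨AddMonoidHom.mk' (fun x => Finsupp.linearCombination ℤ b (r x)) ?_, ?_⟩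
  · intro x y
    rw [← map_add]
    refine h2 _ _ ?_
    rw [map_add, hr, hr, hr]; rfl
  · intro i
    have := h2 (r ⟨a i, AddSubgroup.subset_closure ⟨i, rfl⟩⟩) (Finsupp.single i 1)
      (by rw [hr]; simp)
    simpa using this

/-- A valuation of cones kills every linear relation among characteristic functions. -/
theorem valuation_relation {A : Type*} [AddCommGroup A] (F : Set V → A)
    (hF : ∀ P Q, IsCone P → IsCone Q → F (P ∪ Q) = F P + F Q - F (P ∩ Q)) {ι : Type*}
    (s : Finset ι) (P : ι → Set V) (hP : ∀ i ∈ s, IsCone (P i)) (c : ι → ℤ) :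
    ∀ (R Q : Set V) (k : ℤ), IsCone R → IsCone Q →
      (∀ x ∈ R, x ∉ Q → ∑ i ∈ s, c i * ind (P i) x = k) →
      ∑ i ∈ s, c i • (F (P i ∩ R ∪ Q) - F Q) = k • (F (R ∪ Q) - F Q) := by
  classical
  induction s using Finset.induction_on with
  | empty =>
    intro R Q k hR hQ h
    by_cases hRQ : R ⊆ Q
    · simp [Set.union_eq_self_of_subset_left hRQ]
    · obtain ⟨x, hx, hx'⟩ := Set.not_subset.1 hRQ
      have := h x hx hx'
      simp only [Finset.sum_empty] at this
      simp [← this]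
  | insert j s hj ih =>
    intro R Q k hR hQ h
    have hPj : IsCone (P j) := hP j (Finset.mem_insert_self _ _)
    have hPs : ∀ i ∈ s, IsCone (P i) := fun i hi => hP i (Finset.mem_insert_of_mem hi)
    have h1 := ih hPs (R ∩ P j) Q (k - c j) (hR.inter hPj) hQ (by
      intro x hx hxQ
      have := h x hx.1 hxQ
      rw [Finset.sum_insert hj] at this
      simp only [ind_apply, hx.2, if_true] at this ⊢
      linarith)
    have h2 := ih hPs R (Q ∪ P j) k hR (hQ.union hPj) (by
      intro x hx hxQ
      simp only [Set.mem_union, not_or] at hxQ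
      have := h x hx hxQ.1
      rw [Finset.sum_insert hj] at this
      simpa [ind_apply, hxQ.2] using this)
    have split : ∀ X, IsCone X → F (X ∪ Q) - F Q =
        (F (X ∩ P j ∪ Q) - F Q) + (F (X ∪ (Q ∪ P j)) - F (Q ∪ P j)) := by
      intro X hX
      have e := hF (X ∪ Q) (Q ∪ P j) (hX.union hQ) (hQ.union hPj)
      have e1 : X ∪ Q ∪ (Q ∪ P j) = X ∪ (Q ∪ P j) := by
        ext x; simp only [Set.mem_union]; tauto
      have e2 : (X ∪ Q) ∩ (Q ∪ P j) = X ∩ P j ∪ Q := by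
        ext x; simp only [Set.mem_union, Set.mem_inter_iff]; tauto
      rw [e1, e2] at e
      rw [e]; abel
    rw [Finset.sum_insert hj]
    have e3 : ∑ i ∈ s, c i • (F (P i ∩ R ∪ Q) - F Q) =
        ∑ i ∈ s, c i • (F (P i ∩ (R ∩ P j) ∪ Q) - F Q) +
        ∑ i ∈ s, c i • (F (P i ∩ R ∪ (Q ∪ P j)) - F (Q ∪ P j)) := by
      rw [← Finset.sum_add_distrib]
      refine Finset.sum_congr rfl fun i hi => ?_
      rw [← smul_add, split _ ((hPs i hi).inter hR), Set.inter_assoc]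
    rw [e3, h1, h2, split R hR, Set.inter_comm (P j) R, sub_smul, smul_add]
    abel

/-- Universal property of the cone group: a valuation of cones with values in an abelian group
extends uniquely to a homomorphism. -/
theorem coneGroup_universal {A : Type*} [AddCommGroup A] (F : Set V → A) (h0 : F ∅ = 0)
    (hF : ∀ P Q, IsCone P → IsCone Q → F (P ∪ Q) = F P + F Q - F (P ∩ Q)) :
    ∃! φ : coneGroup V →+ A, ∀ P (hP : IsCone P), φ ⟨ind P, hP.ind_mem⟩ = F P := by
  have hset : {f | ∃ P : Set V, IsCone P ∧ f = ind P} =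
      Set.range (fun P : {P : Set V // IsCone P} => ind P.1) := by
    ext f
    constructor
    · rintro ⟨P, hP, rfl⟩; exact ⟨⟨P, hP⟩, rfl⟩
    · rintro ⟨P, rfl⟩; exact ⟨P.1, P.2, rfl⟩
  have hcl : coneGroup V =
      AddSubgroup.closure (Set.range (fun P : {P : Set V // IsCone P} => ind P.1)) := by
    rw [← hset]; rfl
  obtain ⟨φ, hφ⟩ := exists_lift (fun P : {P : Set V // IsCone P} => ind P.1) (fun P => F P.1) (by
    intro c hc
    have := valuation_relation F hF c.support (fun P => P.1) (fun P _ => P.2) c Set.univ ∅ 0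
      isConvexCone_univ.isCone isCone_empty (by
        intro x _ _
        have := congrFun hc x
        simpa [Finsupp.sum, Finset.sum_apply] using this)
    simpa [Finsupp.sum, h0] using this)
  refine ⟨φ.comp (AddSubgroup.inclusion hcl.le), fun P hP => hφ ⟨P, hP⟩, ?_⟩
  intro ψ hψ
  ext ⟨f, hf⟩
  induction hf using AddSubgroup.closure_induction with
  | mem f hf =>
    obtain ⟨P, hP, rfl⟩ := hf
    rw [hψ P hP]; exact (hφ ⟨P, hP⟩).symm
  | zero => exact (map_zero ψ).trans (map_zero _).symm
  | add a b ha hb iha ihb =>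
    have := congrArg₂ (· + ·) iha ihb
    simp only [← map_add] at this
    exact this
  | neg a ha iha =>
    have := congrArg (- ·) iha
    simp only [← map_neg] at this
    exact this

end Cones

section Interior

variable {V : Type*} [NormedAddCommGroup V] [InnerProductSpace ℝ V]

/-- The solution set of finitely many homogeneous equations and strict inequalities. -/
def cell (A B : Finset V) : Set V :=
  {x | (∀ w ∈ A, inner ℝ w x = 0) ∧ ∀ w ∈ B, 0 < inner ℝ w x}

/-- The relatively open convex cones, that is, the relative interiors of convex cones. -/
def IsOpenCell (U : Set V) : Prop := U.Nonempty ∧ ∃ A B : Finset V, U = cell A B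

theorem cell_inter [DecidableEq V] (A B A' B' : Finset V) :
    cell A B ∩ cell A' B' = cell (A ∪ A') (B ∪ B') := by
  ext x
  simp only [cell, Set.mem_inter_iff, Set.mem_ofPred_eq, Finset.mem_union]
  constructor
  · rintro ⟨⟨h1, h2⟩, h3, h4⟩
    exact ⟨fun w hw => hw.elim (h1 w) (h3 w), fun w hw => hw.elim (h2 w) (h4 w)⟩
  · rintro ⟨h1, h2⟩
    exact ⟨⟨fun w hw => h1 w (Or.inl hw), fun w hw => h2 w (Or.inl hw)⟩,
      fun w hw => h1 w (Or.inr hw), fun w hw => h2 w (Or.inr hw)⟩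

theorem isConvexCone_closedCell (A B : Finset V) :
    IsConvexCone {x : V | (∀ w ∈ A, inner ℝ w x = 0) ∧ ∀ w ∈ B, 0 ≤ inner ℝ w x} := by
  classical
  refine ⟨A ∪ A.image (fun w => -w) ∪ B, ?_⟩
  ext x
  simp only [Set.mem_ofPred_eq, Finset.mem_union, Finset.mem_image]
  constructor
  · rintro ⟨h1, h2⟩ w ((hw | ⟨w, hw, rfl⟩) | hw)
    · exact (h1 w hw).ge
    · rw [inner_neg_left, h1 w hw, neg_zero]
    · exact h2 w hw
  · intro h
    refine ⟨fun w hw => le_antisymm ?_ (h w (Or.inl (Or.inl hw))), fun w hw => h w (Or.inr hw)⟩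
    have := h (-w) (Or.inl (Or.inr ⟨w, hw, rfl⟩))
    rw [inner_neg_left] at this
    linarith

theorem ind_pos (w : V) : ind {x : V | 0 < inner ℝ w x} =
    ind Set.univ - ind {x : V | ∀ u ∈ ({-w} : Finset V), 0 ≤ inner ℝ u x} := by
  classical
  ext x
  simp only [ind_apply, Pi.sub_apply, Set.mem_ofPred_eq, Set.mem_univ, if_true,
    Finset.mem_singleton, forall_eq, inner_neg_left]
  by_cases h : 0 < inner ℝ w x
  · rw [if_pos h, if_neg (by linarith)]; rfl
  · rw [if_neg h, if_pos (by linarith)]; rfl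

theorem ind_cell_mem (A B : Finset V) : ind (cell A B) ∈ coneGroup V := by
  classical
  induction B using Finset.induction_on with
  | empty =>
    have := (isConvexCone_closedCell A ∅).isCone.ind_mem
    simpa [cell] using this
  | insert w B hw ih =>
    have : cell A (insert w B) = cell A B ∩ {x | 0 < inner ℝ w x} := by
      ext x
      simp only [cell, Set.mem_inter_iff, Set.mem_ofPred_eq, Finset.forall_mem_insert]
      tauto
    rw [this, ind_inter, ind_pos]
    exact mul_mem_coneGroup ih (sub_mem isConvexCone_univ.isCone.ind_mem
      (IsConvexCone.isCone ⟨_, rfl⟩).ind_mem)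

/-- The cone group is generated by the characteristic functions of convex cones. -/
theorem coneGroup_le {H : AddSubgroup (V → ℤ)} (h : ∀ C : Set V, IsConvexCone C → ind C ∈ H) :
    coneGroup V ≤ H := by
  classical
  refine (AddSubgroup.closure_le _).2 ?_
  rintro _ ⟨P, ⟨F, hF, hF', rfl⟩, rfl⟩
  suffices ∀ D : Set V, IsConvexCone D → ind (⋃₀ F ∩ D) ∈ H by
    simpa using this _ isConvexCone_univ
  induction F, hF using Set.Finite.induction_on with
  | empty =>
    intro D _
    have : ind (⋃₀ (∅ : Set (Set V)) ∩ D) = 0 := by ext x; simp [ind_apply]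
    rw [this]; exact zero_mem H
  | @insert C F hC hfin ih =>
    intro D hD
    have ih' := ih (fun E hE => hF' E (Set.mem_insert_of_mem _ hE))
    have hC' := hF' C (Set.mem_insert _ _)
    have : ind (⋃₀ (insert C F) ∩ D) =
        ind (C ∩ D) + ind (⋃₀ F ∩ D) - ind (⋃₀ F ∩ (C ∩ D)) := by
      ext x
      simp only [ind_apply, Pi.sub_apply, Pi.add_apply, Set.sUnion_insert, Set.mem_inter_iff,
        Set.mem_union]
      by_cases h1 : x ∈ C <;> by_cases h2 : x ∈ D <;> by_cases h3 : x ∈ ⋃₀ F <;>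
        simp [h1, h2, h3]
    rw [this]
    exact sub_mem (add_mem (h _ (hC'.inter hD)) (ih' D hD)) (ih' _ (hC'.inter hD))

/-- The cone group is generated by the characteristic functions of relatively open cones. -/
theorem coneGroup_eq_closure_cells :
    coneGroup V =
      AddSubgroup.closure (Set.range fun U : {U : Set V // IsOpenCell U} => ind U.1) := by
  classical
  apply le_antisymm
  · refine coneGroup_le ?_
    rintro C ⟨S, rfl⟩
    set H := AddSubgroup.closure (Set.range fun U : {U : Set V // IsOpenCell U} => ind U.1)
    suffices ∀ A B : Finset V, ind (cell A B ∩ {x : V | ∀ w ∈ S, 0 ≤ inner ℝ w x}) ∈ H by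
      have := this ∅ ∅
      simpa [cell] using this
    induction S using Finset.induction_on with
    | empty =>
      intro A B
      by_cases hne : (cell A B).Nonempty
      · have : ind (cell A B) ∈ H := AddSubgroup.subset_closure ⟨⟨_, hne, A, B, rfl⟩, rfl⟩
        simpa using this
      · rw [Set.not_nonempty_iff_eq_empty] at hne
        rw [hne, Set.empty_inter]
        have : ind (∅ : Set V) = 0 := by ext x; simp [ind_apply]
        rw [this]; exact zero_mem H
    | insert w S hw ih =>
      intro A B
      have : ind (cell A B ∩ {x : V | ∀ u ∈ insert w S, 0 ≤ inner ℝ u x}) =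
          ind (cell (insert w A) B ∩ {x : V | ∀ u ∈ S, 0 ≤ inner ℝ u x}) +
          ind (cell A (insert w B) ∩ {x : V | ∀ u ∈ S, 0 ≤ inner ℝ u x}) := by
        ext x
        simp only [ind_apply, Pi.add_apply, cell, Set.mem_inter_iff, Set.mem_ofPred_eq,
          Finset.forall_mem_insert]
        rcases lt_trichotomy (inner ℝ w x) 0 with h | h | h
        · simp [h.not_ge, h.ne, h.not_gt]
        · simp [h]
        · simp [h, h.le, h.ne']
      rw [this]
      exact add_mem (ih _ _) (ih _ _)
  · refine (AddSubgroup.closure_le _).2 ?_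
    rintro _ ⟨⟨U, hU, A, B, rfl⟩, rfl⟩
    exact ind_cell_mem A B

theorem exists_add_smul_mem_cell {A B : Finset V} {p x : V} (hp : p ∈ cell A B)
    (hx : ∀ w ∈ A, inner ℝ w x = 0) : ∃ t : ℝ, 0 < t ∧ ∀ s, t ≤ s → x + s • p ∈ cell A B := by
  classical
  suffices ∃ t : ℝ, 0 < t ∧ ∀ s, t ≤ s → ∀ w ∈ B, 0 < inner ℝ w (x + s • p) by
    obtain ⟨t, ht, h⟩ := this
    refine ⟨t, ht, fun s hs => ⟨fun w hw => ?_, h s hs⟩⟩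
    rw [inner_add_right, inner_smul_right, hx w hw, hp.1 w hw]; simp
  have hB := hp.2
  clear hp hx
  induction B using Finset.induction_on with
  | empty => exact ⟨1, one_pos, by simp⟩
  | insert w B hw ih =>
    obtain ⟨t, ht, h⟩ := ih (fun u hu => hB u (Finset.mem_insert_of_mem hu))
    have hw' := hB w (Finset.mem_insert_self _ _)
    refine ⟨max t ((1 - inner ℝ w x) / inner ℝ w p), lt_max_of_lt_left ht, fun s hs => ?_⟩
    rw [Finset.forall_mem_insert]
    refine ⟨?_, h s ((le_max_left _ _).trans hs)⟩
    have := (le_max_right _ _).trans hs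
    rw [div_le_iff₀ hw'] at this
    rw [inner_add_right, inner_smul_right]
    linarith

theorem closure_cell {A B : Finset V} (h : (cell A B).Nonempty) :
    closure (cell A B) = {x | (∀ w ∈ A, inner ℝ w x = 0) ∧ ∀ w ∈ B, 0 ≤ inner ℝ w x} := by
  apply subset_antisymm
  · refine closure_minimal (fun x hx => ⟨hx.1, fun w hw => (hx.2 w hw).le⟩) ?_
    simp only [Set.ofPred_and, Set.ofPred_forall]
    refine IsClosed.inter (isClosed_biInter fun w _ => ?_) (isClosed_biInter fun w _ => ?_)
    · exact isClosed_eq (by fun_prop) continuous_const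
    · exact isClosed_le continuous_const (by fun_prop)
  · rintro x ⟨hA, hB⟩
    obtain ⟨p, hp⟩ := h
    have hlim : Filter.Tendsto (fun t : ℝ => x + t • p) (nhdsWithin 0 (Set.Ioi 0)) (nhds x) := by
      have : Continuous fun t : ℝ => x + t • p := by fun_prop
      have := this.tendsto 0
      simp only [zero_smul, add_zero] at this
      exact this.mono_left nhdsWithin_le_nhds
    refine mem_closure_of_tendsto hlim ?_
    filter_upwards [self_mem_nhdsWithin] with t ht
    refine ⟨fun w hw => ?_, fun w hw => ?_⟩
    · rw [inner_add_right, inner_smul_right, hA w hw, hp.1 w hw]; simp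
    · rw [inner_add_right, inner_smul_right]
      exact add_pos_of_nonneg_of_pos (hB w hw) (mul_pos ht (hp.2 w hw))

theorem mem_span_cell {A B : Finset V} (h : (cell A B).Nonempty) {x : V} :
    x ∈ Submodule.span ℝ (cell A B) ↔ ∀ w ∈ A, inner ℝ w x = 0 := by
  constructor
  · intro hx w hw
    induction hx using Submodule.span_induction with
    | mem x hx => exact hx.1 w hw
    | zero => simp
    | add x y _ _ hx hy => rw [inner_add_right, hx, hy, add_zero]
    | smul a x _ hx => rw [inner_smul_right, hx, mul_zero]
  · intro hx
    obtain ⟨p, hp⟩ := h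
    obtain ⟨t, -, ht⟩ := exists_add_smul_mem_cell hp hx
    have := Submodule.sub_mem _ (Submodule.subset_span (ht t le_rfl))
      (Submodule.smul_mem _ t (Submodule.subset_span hp))
    simpa using this

/-- The signed closure of a relatively open cone. -/
noncomputable def signedClosure (U : Set V) : V → ℤ :=
  (-1 : ℤ) ^ Module.finrank ℝ (Submodule.span ℝ U) • ind (closure U)

theorem signedClosure_empty : signedClosure (∅ : Set V) = 0 := by
  ext x; simp [signedClosure, ind]

theorem signedClosure_mem {U : Set V} (hU : IsOpenCell U) : signedClosure U ∈ coneGroup V := by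
  obtain ⟨hne, A, B, rfl⟩ := hU
  unfold signedClosure
  rw [closure_cell hne]
  exact zsmul_mem (isConvexCone_closedCell A B).isCone.ind_mem _

theorem cell_inter_eq [DecidableEq V] (A B : Finset V) (h : V) :
    cell A B ∩ {x | inner ℝ h x = 0} = cell (insert h A) B := by
  ext x; simp only [cell, Set.mem_inter_iff, Set.mem_ofPred_eq, Finset.forall_mem_insert]; tauto

theorem cell_inter_pos [DecidableEq V] (A B : Finset V) (h : V) :
    cell A B ∩ {x | 0 < inner ℝ h x} = cell A (insert h B) := by
  ext x; simp only [cell, Set.mem_inter_iff, Set.mem_ofPred_eq, Finset.forall_mem_insert]; tauto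

theorem cell_inter_neg [DecidableEq V] (A B : Finset V) (h : V) :
    cell A B ∩ {x | inner ℝ h x < 0} = cell A (insert (-h) B) := by
  ext x
  simp only [cell, Set.mem_inter_iff, Set.mem_ofPred_eq, Finset.forall_mem_insert,
    inner_neg_left, Left.neg_pos_iff]
  tauto

theorem signedClosure_split [FiniteDimensional ℝ V] (A B : Finset V) (h : V) :
    signedClosure (cell A B) = signedClosure (cell A B ∩ {x | inner ℝ h x = 0}) +
      signedClosure (cell A B ∩ {x | 0 < inner ℝ h x}) +
      signedClosure (cell A B ∩ {x | inner ℝ h x < 0}) := by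
  classical
  by_cases hflat : ∀ x ∈ cell A B, inner ℝ h x = 0
  · have e0 : cell A B ∩ {x | inner ℝ h x = 0} = cell A B := by
      ext x; simpa using hflat x
    have e1 : cell A B ∩ {x | 0 < inner ℝ h x} = ∅ := by
      ext x
      simp only [Set.mem_inter_iff, Set.mem_ofPred_eq, Set.mem_empty_iff_false, iff_false, not_and]
      intro hx; rw [hflat x hx]; exact lt_irrefl _
    have e2 : cell A B ∩ {x | inner ℝ h x < 0} = ∅ := by
      ext x
      simp only [Set.mem_inter_iff, Set.mem_ofPred_eq, Set.mem_empty_iff_false, iff_false, not_and]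
      intro hx; rw [hflat x hx]; exact lt_irrefl _
    rw [e0, e1, e2, signedClosure_empty, add_zero, add_zero]
  by_cases hpos : ∀ x ∈ cell A B, 0 < inner ℝ h x
  · have e0 : cell A B ∩ {x | 0 < inner ℝ h x} = cell A B := by
      ext x; simpa using hpos x
    have e1 : cell A B ∩ {x | inner ℝ h x = 0} = ∅ := by
      ext x
      simp only [Set.mem_inter_iff, Set.mem_ofPred_eq, Set.mem_empty_iff_false, iff_false, not_and]
      intro hx; exact (hpos x hx).ne'
    have e2 : cell A B ∩ {x | inner ℝ h x < 0} = ∅ := by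
      ext x
      simp only [Set.mem_inter_iff, Set.mem_ofPred_eq, Set.mem_empty_iff_false, iff_false, not_and]
      intro hx; exact (hpos x hx).not_gt
    rw [e0, e1, e2, signedClosure_empty, add_zero, zero_add]
  by_cases hneg : ∀ x ∈ cell A B, inner ℝ h x < 0
  · have e0 : cell A B ∩ {x | inner ℝ h x < 0} = cell A B := by
      ext x; simpa using hneg x
    have e1 : cell A B ∩ {x | inner ℝ h x = 0} = ∅ := by
      ext x
      simp only [Set.mem_inter_iff, Set.mem_ofPred_eq, Set.mem_empty_iff_false, iff_false, not_and]
      intro hx; exact (hneg x hx).ne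
    have e2 : cell A B ∩ {x | 0 < inner ℝ h x} = ∅ := by
      ext x
      simp only [Set.mem_inter_iff, Set.mem_ofPred_eq, Set.mem_empty_iff_false, iff_false, not_and]
      intro hx; exact (hneg x hx).not_gt
    rw [e0, e1, e2, signedClosure_empty, zero_add, zero_add]
  -- the hyperplane crosses the cell
  have hcross : (∃ x ∈ cell A B, 0 < inner ℝ h x) ∧ (∃ x ∈ cell A B, inner ℝ h x < 0) := by
    push Not at hflat hpos hneg
    -- from a point off the hyperplane and a point on it, reach the other side
    have refl : ∀ x ∈ cell A B, ∀ y ∈ cell A B, inner ℝ h y = 0 →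
        ∃ z ∈ cell A B, inner ℝ h z = - inner ℝ h x := by
      intro x hx y hy hy0
      obtain ⟨t, -, ht⟩ := exists_add_smul_mem_cell hy (x := -x) (fun w hw => by
        rw [inner_neg_right, hx.1 w hw, neg_zero])
      refine ⟨_, ht t le_rfl, ?_⟩
      rw [inner_add_right, inner_smul_right, hy0, inner_neg_right]; simp
    obtain ⟨x, hx, hx0⟩ := hflat
    obtain ⟨y, hy, hy0⟩ := hpos
    obtain ⟨z, hz, hz0⟩ := hneg
    rcases lt_or_gt_of_ne hx0 with hx0 | hx0
    · refine ⟨?_, x, hx, hx0⟩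
      rcases hz0.lt_or_eq with hz0 | hz0
      · exact ⟨z, hz, hz0⟩
      · obtain ⟨u, hu, hu'⟩ := refl x hx z hz hz0.symm
        exact ⟨u, hu, by linarith⟩
    · refine ⟨⟨x, hx, hx0⟩, ?_⟩
      rcases hy0.lt_or_eq with hy0 | hy0
      · exact ⟨y, hy, hy0⟩
      · obtain ⟨u, hu, hu'⟩ := refl x hx y hy hy0
        exact ⟨u, hu, by linarith⟩
  obtain ⟨⟨p, hp, hp0⟩, q, hq, hq0⟩ := hcross
  have n : (cell A B).Nonempty := ⟨p, hp⟩
  rw [cell_inter_eq, cell_inter_pos, cell_inter_neg]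
  have np : (cell A (insert h B)).Nonempty := ⟨p, by rw [← cell_inter_pos]; exact ⟨hp, hp0⟩⟩
  have nq : (cell A (insert (-h) B)).Nonempty := ⟨q, by rw [← cell_inter_neg]; exact ⟨hq, hq0⟩⟩
  have n0 : (cell (insert h A) B).Nonempty := by
    refine ⟨(-inner ℝ h q) • p + (inner ℝ h p) • q, ?_⟩
    rw [← cell_inter_eq]
    refine ⟨⟨fun w hw => ?_, fun w hw => ?_⟩, ?_⟩
    · rw [inner_add_right, inner_smul_right, inner_smul_right, hp.1 w hw, hq.1 w hw]; simp
    · rw [inner_add_right, inner_smul_right, inner_smul_right]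
      exact add_pos (mul_pos (by linarith) (hp.2 w hw)) (mul_pos hp0 (hq.2 w hw))
    · simp only [Set.mem_ofPred_eq]
      rw [inner_add_right, inner_smul_right, inner_smul_right]; ring
  have s1 : Submodule.span ℝ (cell A (insert h B)) = Submodule.span ℝ (cell A B) := by
    ext x; rw [mem_span_cell np, mem_span_cell n]
  have s2 : Submodule.span ℝ (cell A (insert (-h) B)) = Submodule.span ℝ (cell A B) := by
    ext x; rw [mem_span_cell nq, mem_span_cell n]
  have s0 : Module.finrank ℝ (Submodule.span ℝ (cell (insert h A) B)) + 1 =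
      Module.finrank ℝ (Submodule.span ℝ (cell A B)) := by
    set W := Submodule.span ℝ (cell A B) with hW
    let l : Module.Dual ℝ W := (innerₛₗ ℝ h).domRestrict W
    have hl : l ≠ 0 := by
      intro h0
      have := LinearMap.congr_fun h0 ⟨p, Submodule.subset_span hp⟩
      exact hp0.ne' this
    rw [← Module.Dual.finrank_ker_add_one_of_ne_zero hl]
    congr 1
    have : (LinearMap.ker l).map W.subtype = Submodule.span ℝ (cell (insert h A) B) := by
      ext x
      rw [mem_span_cell n0, Finset.forall_mem_insert, ← mem_span_cell n, ← hW]
      constructor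
      · rintro ⟨⟨y, hy⟩, hy', rfl⟩
        exact ⟨hy', hy⟩
      · rintro ⟨h1, h2⟩
        exact ⟨⟨x, h2⟩, h1, rfl⟩
    rw [← this]
    exact Submodule.finrank_map_subtype_eq W _
  unfold signedClosure
  rw [closure_cell n, closure_cell n0, closure_cell np, closure_cell nq, s1, s2, ← s0, pow_succ]
  ext x
  simp only [Pi.add_apply, Pi.smul_apply, smul_eq_mul, ind_apply, Set.mem_ofPred_eq,
    Finset.forall_mem_insert, inner_neg_left, Left.nonneg_neg_iff]
  rcases lt_trichotomy (inner ℝ h x) 0 with hx | hx | hx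
  · simp [hx.not_ge, hx.le, hx.ne]
  · simp only [hx, le_refl, true_and]
    split_ifs <;> ring
  · simp [hx.not_ge, hx.le, hx.ne']

/-- Every linear relation among relatively open cones is satisfied by their signed closures. -/
theorem signedClosure_relation [FiniteDimensional ℝ V] {ι : Type*} (s : Finset ι)
    (A B : ι → Finset V) (c : ι → ℤ) (T : Finset V) :
    ∀ A₀ B₀ : Finset V,
      (∀ i ∈ s, ∀ w, w ∈ A i ∨ w ∈ B i → w ∈ T ∨ w ∈ A₀ ∨ w ∈ B₀ ∨ -w ∈ B₀) →
      (∀ x ∈ cell A₀ B₀, ∑ i ∈ s, c i * ind (cell (A i) (B i)) x = 0) →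
      ∑ i ∈ s, c i • signedClosure (cell A₀ B₀ ∩ cell (A i) (B i)) = 0 := by
  classical
  induction T using Finset.induction_on with
  | empty =>
    intro A₀ B₀ hT hrel
    by_cases hne : (cell A₀ B₀).Nonempty
    · obtain ⟨x, hx⟩ := hne
      have hi : ∀ i ∈ s, signedClosure (cell A₀ B₀ ∩ cell (A i) (B i)) =
          ind (cell (A i) (B i)) x • signedClosure (cell A₀ B₀) := by
        intro i hi
        by_cases hxi : x ∈ cell (A i) (B i)
        · have : cell A₀ B₀ ∩ cell (A i) (B i) = cell A₀ B₀ := by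
            refine Set.inter_eq_left.2 fun y hy => ⟨fun w hw => ?_, fun w hw => ?_⟩
            · have h1 := hxi.1 w hw
              rcases hT i hi w (Or.inl hw) with h | h | h | h
              · simp at h
              · exact hy.1 w h
              · exact absurd h1 (hx.2 w h).ne'
              · have := hx.2 _ h
                rw [inner_neg_left] at this
                linarith
            · have h1 := hxi.2 w hw
              rcases hT i hi w (Or.inr hw) with h | h | h | h
              · simp at h
              · exact absurd (hx.1 w h) h1.ne'
              · exact hy.2 w h
              · have := hx.2 _ h
                rw [inner_neg_left] at this
                linarith
          rw [this, ind_apply, if_pos hxi, one_smul]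
        · have : cell A₀ B₀ ∩ cell (A i) (B i) = ∅ := by
            refine Set.eq_empty_of_forall_notMem fun y hy => hxi ⟨fun w hw => ?_, fun w hw => ?_⟩
            · have h1 := hy.2.1 w hw
              rcases hT i hi w (Or.inl hw) with h | h | h | h
              · simp at h
              · exact hx.1 w h
              · exact absurd h1 (hy.1.2 w h).ne'
              · have := hy.1.2 _ h
                rw [inner_neg_left] at this
                linarith
            · have h1 := hy.2.2 w hw
              rcases hT i hi w (Or.inr hw) with h | h | h | h
              · simp at h
              · exact absurd (hy.1.1 w h) h1.ne'
              · exact hx.2 w h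
              · have := hy.1.2 _ h
                rw [inner_neg_left] at this
                linarith
          rw [this, signedClosure_empty, ind_apply, if_neg hxi, zero_smul]
      rw [Finset.sum_congr rfl fun i h => by rw [hi i h, smul_smul], ← Finset.sum_smul,
        hrel x hx, zero_smul]
    · rw [Set.not_nonempty_iff_eq_empty] at hne
      simp [hne, signedClosure_empty]
  | insert h T hh ih =>
    intro A₀ B₀ hT hrel
    have hsplit : ∀ i ∈ s, c i • signedClosure (cell A₀ B₀ ∩ cell (A i) (B i)) =
        c i • signedClosure (cell (insert h A₀) B₀ ∩ cell (A i) (B i)) +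
        c i • signedClosure (cell A₀ (insert h B₀) ∩ cell (A i) (B i)) +
        c i • signedClosure (cell A₀ (insert (-h) B₀) ∩ cell (A i) (B i)) := by
      intro i _
      rw [cell_inter, signedClosure_split _ _ h, ← cell_inter, smul_add, smul_add,
        ← cell_inter_eq, ← cell_inter_pos, ← cell_inter_neg, Set.inter_right_comm,
        Set.inter_right_comm _ _ {x | 0 < inner ℝ h x},
        Set.inter_right_comm _ _ {x | inner ℝ h x < 0}]
    rw [Finset.sum_congr rfl hsplit, Finset.sum_add_distrib, Finset.sum_add_distrib,
      ih _ _ ?_ ?_, ih _ _ ?_ ?_, ih _ _ ?_ ?_, add_zero, add_zero]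
    · intro i hi w hw
      rcases hT i hi w hw with h1 | h1 | h1 | h1
      · rcases Finset.mem_insert.1 h1 with rfl | h1
        · simp
        · exact Or.inl h1
      all_goals simp [h1]
    · intro x hx
      rw [← cell_inter_neg] at hx
      exact hrel x hx.1
    · intro i hi w hw
      rcases hT i hi w hw with h1 | h1 | h1 | h1
      · rcases Finset.mem_insert.1 h1 with rfl | h1
        · simp
        · exact Or.inl h1
      all_goals simp [h1]
    · intro x hx
      rw [← cell_inter_pos] at hx
      exact hrel x hx.1
    · intro i hi w hw
      rcases hT i hi w hw with h1 | h1 | h1 | h1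
      · rcases Finset.mem_insert.1 h1 with rfl | h1
        · simp
        · exact Or.inl h1
      all_goals simp [h1]
    · intro x hx
      rw [← cell_inter_eq] at hx
      exact hrel x hx.1

theorem IsOpenCell.ind_mem {U : Set V} (hU : IsOpenCell U) : ind U ∈ coneGroup V := by
  obtain ⟨_, A, B, rfl⟩ := hU
  exact ind_cell_mem A B

/-- There is exactly one endomorphism of the cone group sending each relatively open cone `U` to
`(-1) ^ dim U` times its closure. -/
theorem existsUnique_interior (V : Type*) [NormedAddCommGroup V] [InnerProductSpace ℝ V]
    [FiniteDimensional ℝ V] :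
    ∃! I : coneGroup V →+ coneGroup V, ∀ U (hU : IsOpenCell U), (I ⟨ind U, hU.ind_mem⟩).1 =
      (-1 : ℤ) ^ Module.finrank ℝ (Submodule.span ℝ U) • ind (closure U) := by
  classical
  have hcl := coneGroup_eq_closure_cells (V := V)
  obtain ⟨φ, hφ⟩ := exists_lift (fun U : {U : Set V // IsOpenCell U} => ind U.1)
    (fun U => (⟨signedClosure U.1, signedClosure_mem U.2⟩ : coneGroup V)) (by
      intro c hc
      choose hne A B hAB using fun U : {U : Set V // IsOpenCell U} => U.2
      have := signedClosure_relation c.support A B c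
        (c.support.biUnion fun i => A i ∪ B i) ∅ ∅ (by
          intro i hi w hw
          left
          exact Finset.mem_biUnion.2 ⟨i, hi, Finset.mem_union.2 hw⟩) (by
          intro x _
          have := congrFun hc x
          simpa [Finsupp.sum, Finset.sum_apply, ← hAB] using this)
      have huniv : cell (∅ : Finset V) ∅ = Set.univ := by ext; simp [cell]
      apply Subtype.ext
      simpa [Finsupp.sum, huniv, ← hAB] using this)
  refine ⟨φ.comp (AddSubgroup.inclusion hcl.le), fun U hU => congrArg Subtype.val (hφ ⟨U, hU⟩), ?_⟩
  intro ψ hψ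
  ext1 ⟨f, hf⟩
  have hf' := hf
  rw [hcl] at hf'
  induction hf' using AddSubgroup.closure_induction with
  | mem f hf' =>
    obtain ⟨⟨U, hU⟩, rfl⟩ := hf'
    apply Subtype.ext
    rw [hψ U hU]; exact (congrArg Subtype.val (hφ ⟨U, hU⟩)).symm
  | zero => exact (map_zero ψ).trans (map_zero _).symm
  | add a b ha hb iha ihb =>
    rw [← hcl] at ha hb
    have := congrArg₂ (· + ·) (iha ha) (ihb hb)
    simp only [← map_add] at this
    exact this
  | neg a ha iha =>
    rw [← hcl] at ha
    have := congrArg (- ·) (iha ha)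
    simp only [← map_neg] at this
    exact this

/-- The interior involution of the cone group: the homomorphism with
`I (int σ) = (-1) ^ dim σ • (σ)` for each convex cone `σ`. -/
noncomputable def interiorMap (V : Type*) [NormedAddCommGroup V] [InnerProductSpace ℝ V]
    [FiniteDimensional ℝ V] : coneGroup V →+ coneGroup V :=
  (existsUnique_interior V).choose

theorem interior_apply [FiniteDimensional ℝ V] {U : Set V} (hU : IsOpenCell U) :
    (interiorMap V ⟨ind U, hU.ind_mem⟩).1 =
      (-1 : ℤ) ^ Module.finrank ℝ (Submodule.span ℝ U) • ind (closure U) :=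
  (existsUnique_interior V).choose_spec.1 U hU

end Interior

section Functoriality

variable {V W : Type*} [NormedAddCommGroup V] [InnerProductSpace ℝ V] [FiniteDimensional ℝ V]
  [NormedAddCommGroup W] [InnerProductSpace ℝ W] [FiniteDimensional ℝ W]

theorem IsConvexCone.preimage (T : V →ₗ[ℝ] W) {C : Set W} (hC : IsConvexCone C) :
    IsConvexCone (T ⁻¹' C) := by
  classical
  obtain ⟨S, rfl⟩ := hC
  refine ⟨S.image (LinearMap.adjoint T), ?_⟩
  ext x
  simp [LinearMap.adjoint_inner_left]

theorem comp_mem_coneGroup (T : V →ₗ[ℝ] W) {f : W → ℤ} (hf : f ∈ coneGroup W) :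
    f ∘ T ∈ coneGroup V := by
  let c : (W → ℤ) →+ (V → ℤ) := AddMonoidHom.mk' (fun f => f ∘ T) fun _ _ => rfl
  have : coneGroup W ≤ (coneGroup V).comap c :=
    coneGroup_le fun C hC => (hC.preimage T).isCone.ind_mem
  exact this hf

/-- Pull back along a linear map; for a bijective map `T` this sends `(P)` to `(T⁻¹ P)`. -/
noncomputable def comap (T : V →ₗ[ℝ] W) : coneGroup W →+ coneGroup V :=
  AddMonoidHom.mk' (fun f => ⟨f.1 ∘ T, comp_mem_coneGroup T f.2⟩) fun _ _ => rfl

end Functoriality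

/-- Euclidean space of dimension `n`. -/
abbrev E (n : ℕ) : Type := EuclideanSpace ℝ (Fin n)

/-- The relations imposed by orthogonal transformations of `ℝⁿ`. -/
noncomputable def isometryRel (n : ℕ) : AddSubgroup (coneGroup (E n)) :=
  AddSubgroup.closure
    {x | ∃ (g : E n ≃ₗᵢ[ℝ] E n) (f : coneGroup (E n)), x = comap g.toLinearMap f - f}

/-- `L n` is the group of coinvariants of the orthogonal group acting on the cone group of
`ℝⁿ`. -/
noncomputable def L (n : ℕ) : Type := coneGroup (E n) ⧸ isometryRel n

noncomputable instance (n : ℕ) : AddCommGroup (L n) :=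
  inferInstanceAs (AddCommGroup (coneGroup (E n) ⧸ isometryRel n))

/-- The projection from the cone group of `ℝⁿ` to `L n`. -/
noncomputable def cls (n : ℕ) : coneGroup (E n) →+ L n := QuotientAddGroup.mk' (isometryRel n)

theorem cls_surjective (n : ℕ) : Function.Surjective (cls n) :=
  QuotientAddGroup.mk'_surjective (isometryRel n)

theorem cls_comap {n : ℕ} (g : E n ≃ₗᵢ[ℝ] E n) (f : coneGroup (E n)) :
    cls n (comap g.toLinearMap f) = cls n f := by
  rw [← sub_eq_zero, ← map_sub]
  exact (QuotientAddGroup.eq_zero_iff _).2 (AddSubgroup.subset_closure ⟨g, f, rfl⟩)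

/-- A homomorphism on the cone group that is invariant under isometries descends to `L n`. -/
noncomputable def L.lift {n : ℕ} {A : Type*} [AddCommGroup A] (φ : coneGroup (E n) →+ A)
    (h : ∀ (g : E n ≃ₗᵢ[ℝ] E n) f, φ (comap g.toLinearMap f) = φ f) : L n →+ A :=
  QuotientAddGroup.lift (isometryRel n) φ ((AddSubgroup.closure_le _).2 (by
    rintro _ ⟨g, f, rfl⟩
    show φ _ = 0
    rw [map_sub, h, sub_self]))

theorem L.lift_cls {n : ℕ} {A : Type*} [AddCommGroup A] (φ : coneGroup (E n) →+ A)
    (h : ∀ (g : E n ≃ₗᵢ[ℝ] E n) f, φ (comap g.toLinearMap f) = φ f) (f : coneGroup (E n)) :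
    L.lift φ h (cls n f) = φ f := rfl

theorem L.hom_ext {n : ℕ} {A : Type*} [AddCommGroup A] {φ ψ : L n →+ A}
    (h : ∀ f, φ (cls n f) = ψ (cls n f)) : φ = ψ := by
  ext x
  obtain ⟨f, rfl⟩ := cls_surjective n x
  exact h f

section Product

/-- The projection `ℝ^(i+j) → ℝ^i` to the first `i` coordinates. -/
noncomputable def fstE (i j : ℕ) : E (i + j) →ₗ[ℝ] E i where
  toFun x := WithLp.toLp 2 fun k => x (Fin.castAdd j k)
  map_add' _ _ := rfl
  map_smul' _ _ := rfl

/-- The projection `ℝ^(i+j) → ℝ^j` to the last `j` coordinates. -/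
noncomputable def sndE (i j : ℕ) : E (i + j) →ₗ[ℝ] E j where
  toFun x := WithLp.toLp 2 fun k => x (Fin.natAdd i k)
  map_add' _ _ := rfl
  map_smul' _ _ := rfl

theorem fstE_apply {i j : ℕ} (x : E (i + j)) (k : Fin i) : fstE i j x k = x (Fin.castAdd j k) := rfl

theorem sndE_apply {i j : ℕ} (x : E (i + j)) (k : Fin j) : sndE i j x k = x (Fin.natAdd i k) := rfl

theorem norm_sq_split {i j : ℕ} (x : E (i + j)) :
    ‖x‖ ^ 2 = ‖fstE i j x‖ ^ 2 + ‖sndE i j x‖ ^ 2 := by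
  simp only [EuclideanSpace.norm_sq_eq, Fin.sum_univ_add]; rfl

/-- The product of two isometries. -/
noncomputable def prodIsometry {i j : ℕ} (g : E i ≃ₗᵢ[ℝ] E i) (h : E j ≃ₗᵢ[ℝ] E j) :
    E (i + j) ≃ₗᵢ[ℝ] E (i + j) :=
  LinearIsometry.toLinearIsometryEquiv
    { toFun := fun x => WithLp.toLp 2 (Fin.append (g (fstE i j x)) (h (sndE i j x)))
      map_add' := fun x y => by
        ext k
        refine Fin.addCases (fun k => ?_) (fun k => ?_) k <;> simp
      map_smul' := fun a x => by
        ext k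
        refine Fin.addCases (fun k => ?_) (fun k => ?_) k <;> simp
      norm_map' := fun x => by
        rw [← sq_eq_sq₀ (norm_nonneg _) (norm_nonneg _), norm_sq_split, norm_sq_split x,
          ← g.norm_map (fstE i j x), ← h.norm_map (sndE i j x)]
        congr 3
        · ext k; rw [fstE_apply]; simp
        · ext k; rw [sndE_apply]; simp } rfl

theorem fstE_prodIsometry {i j : ℕ} (g : E i ≃ₗᵢ[ℝ] E i) (h : E j ≃ₗᵢ[ℝ] E j) (x : E (i + j)) :
    fstE i j (prodIsometry g h x) = g (fstE i j x) := by
  ext k; rw [fstE_apply]; simp [prodIsometry]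

theorem sndE_prodIsometry {i j : ℕ} (g : E i ≃ₗᵢ[ℝ] E i) (h : E j ≃ₗᵢ[ℝ] E j) (x : E (i + j)) :
    sndE i j (prodIsometry g h x) = h (sndE i j x) := by
  ext k; rw [sndE_apply]; simp [prodIsometry]

/-- The external product `(P) × (Q) = (P × Q)` of cone groups. -/
noncomputable def extProd (i j : ℕ) : coneGroup (E i) →+ coneGroup (E j) →+ coneGroup (E (i + j)) :=
  AddMonoidHom.mk' (fun f => AddMonoidHom.mk'
    (fun g => ⟨fun x => f.1 (fstE i j x) * g.1 (sndE i j x),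
      mul_mem_coneGroup (comp_mem_coneGroup (fstE i j) f.2)
        (comp_mem_coneGroup (sndE i j) g.2)⟩)
    fun _ _ => Subtype.ext (funext fun _ => mul_add _ _ _))
    fun _ _ => AddMonoidHom.ext fun _ => Subtype.ext (funext fun _ => add_mul _ _ _)

theorem extProd_comap_right {i j : ℕ} (f : coneGroup (E i)) (g : E j ≃ₗᵢ[ℝ] E j)
    (f' : coneGroup (E j)) : extProd i j f (comap g.toLinearMap f') =
      comap (prodIsometry (LinearIsometryEquiv.refl ℝ _) g).toLinearMap (extProd i j f f') := by
  apply Subtype.ext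
  funext x
  change f.1 _ * f'.1 _ = f.1 (fstE i j (prodIsometry _ g x)) * f'.1 (sndE i j (prodIsometry _ g x))
  rw [fstE_prodIsometry, sndE_prodIsometry]
  rfl

theorem extProd_comap_left {i j : ℕ} (f : coneGroup (E i)) (g : E i ≃ₗᵢ[ℝ] E i)
    (f' : coneGroup (E j)) : extProd i j (comap g.toLinearMap f) f' =
      comap (prodIsometry g (LinearIsometryEquiv.refl ℝ _)).toLinearMap (extProd i j f f') := by
  apply Subtype.ext
  funext x
  change f.1 _ * f'.1 _ = f.1 (fstE i j (prodIsometry g _ x)) * f'.1 (sndE i j (prodIsometry g _ x))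
  rw [fstE_prodIsometry, sndE_prodIsometry]
  rfl

/-- The multiplication `⟨P⟩ᵢ ⟨Q⟩ⱼ = ⟨P × Q⟩ᵢ₊ⱼ`. -/
noncomputable def mulHom (i j : ℕ) : L i →+ L j →+ L (i + j) :=
  L.lift
    (AddMonoidHom.mk'
      (fun f => L.lift ((cls (i + j)).comp (extProd i j f)) fun g f' => by
        rw [AddMonoidHom.comp_apply, extProd_comap_right, cls_comap]; rfl)
      fun f f' => L.hom_ext fun g => by
        change cls _ (extProd i j (f + f') g) =
          cls _ (extProd i j f g) + cls _ (extProd i j f' g)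
        rw [map_add, AddMonoidHom.add_apply, map_add])
    fun g f => L.hom_ext fun f' => by
      change cls _ (extProd i j (comap g.toLinearMap f) f') = cls _ (extProd i j f f')
      rw [extProd_comap_left, cls_comap]

theorem mulHom_cls {i j : ℕ} (f : coneGroup (E i)) (g : coneGroup (E j)) :
    mulHom i j (cls i f) (cls j g) = cls (i + j) (extProd i j f g) := rfl

theorem mk_cls_comap {n m : ℕ} (e : E n ≃ₗᵢ[ℝ] E m) (f : coneGroup (E m)) :
    GradedMonoid.mk (A := L) n (cls n (comap e.toLinearMap f)) =
      GradedMonoid.mk (A := L) m (cls m f) := by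
  have h : n = m := by simpa using e.toLinearEquiv.finrank_eq
  subst h
  rw [cls_comap]

/-- Reindexing coordinates. -/
noncomputable def reindex {n m : ℕ} (e : Fin n ≃ Fin m) : E n ≃ₗᵢ[ℝ] E m :=
  LinearIsometryEquiv.piLpCongrLeft 2 ℝ ℝ e

theorem reindex_apply {n m : ℕ} (e : Fin n ≃ Fin m) (x : E n) (k : Fin m) :
    reindex e x k = x (e.symm k) := rfl

theorem mk_cls_eq {n m : ℕ} (e : Fin n ≃ Fin m) (f : coneGroup (E n)) (g : coneGroup (E m))
    (h : ∀ x, f.1 x = g.1 (reindex e x)) :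
    GradedMonoid.mk (A := L) n (cls n f) = GradedMonoid.mk (A := L) m (cls m g) := by
  rw [← mk_cls_comap (reindex e) g]
  congr 2
  exact Subtype.ext (funext h)

/-- The class of the point in `L 0`. -/
noncomputable def oneL : L 0 := cls 0 ⟨ind Set.univ, isConvexCone_univ.isCone.ind_mem⟩

noncomputable instance : GradedMonoid.GMul L where
  mul {i j} x y := mulHom i j x y

noncomputable instance : GradedMonoid.GOne L where
  one := oneL

/-- The graded ring structure on the groups `L n`. -/
noncomputable instance : DirectSum.GCommRing L where
  mul_zero x := map_zero _
  zero_mul y := DFunLike.congr_fun (map_zero (mulHom _ _)) y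
  mul_add x y z := map_add _ _ _
  add_mul x y z := DFunLike.congr_fun (map_add (mulHom _ _) x y) z
  one_mul := by
    rintro ⟨i, x⟩
    obtain ⟨f, rfl⟩ := cls_surjective i x
    refine mk_cls_eq (finCongr (zero_add i)) _ _ fun x => ?_
    change ind Set.univ _ * f.1 _ = f.1 _
    rw [ind_apply, if_pos (Set.mem_univ _), one_mul]
    refine congrArg f.1 (PiLp.ext fun l => ?_)
    exact congrArg x (Fin.ext (by simp))
  mul_one := by
    rintro ⟨i, x⟩
    obtain ⟨f, rfl⟩ := cls_surjective i x
    refine mk_cls_eq (finCongr (add_zero i)) _ _ fun x => ?_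
    change f.1 _ * ind Set.univ _ = f.1 _
    rw [ind_apply, if_pos (Set.mem_univ _), mul_one]
    refine congrArg f.1 (PiLp.ext fun l => ?_)
    exact congrArg x (Fin.ext (by simp))
  mul_assoc := by
    rintro ⟨i, x⟩ ⟨j, y⟩ ⟨k, z⟩
    obtain ⟨f, rfl⟩ := cls_surjective i x
    obtain ⟨g, rfl⟩ := cls_surjective j y
    obtain ⟨h, rfl⟩ := cls_surjective k z
    refine mk_cls_eq (finCongr (add_assoc i j k)) _ _ fun x => ?_
    change f.1 _ * g.1 _ * h.1 _ = f.1 _ * (g.1 _ * h.1 _)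
    rw [mul_assoc]
    refine congrArg₂ (· * ·) (congrArg f.1 (PiLp.ext fun l => ?_))
      (congrArg₂ (· * ·) (congrArg g.1 (PiLp.ext fun l => ?_))
        (congrArg h.1 (PiLp.ext fun l => ?_)))
    · exact congrArg x (Fin.ext (by simp))
    · exact congrArg x (Fin.ext (by simp))
    · exact congrArg x (Fin.ext (add_assoc i j l.1))
  mul_comm := by
    rintro ⟨i, x⟩ ⟨j, y⟩
    obtain ⟨f, rfl⟩ := cls_surjective i x
    obtain ⟨g, rfl⟩ := cls_surjective j y
    refine mk_cls_eq (finAddFlip (m := i) (n := j)) _ _ fun x => ?_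
    change f.1 _ * g.1 _ = g.1 _ * f.1 _
    rw [mul_comm]
    refine congrArg₂ (· * ·) (congrArg g.1 (PiLp.ext fun l => ?_))
      (congrArg f.1 (PiLp.ext fun l => ?_))
    · exact congrArg x (finAddFlip.symm_apply_eq.2 (finAddFlip_apply_natAdd l i).symm).symm
    · exact congrArg x (finAddFlip.symm_apply_eq.2 (finAddFlip_apply_castAdd l j).symm).symm
  natCast n := n • oneL
  natCast_zero := zero_nsmul _
  natCast_succ n := succ_nsmul _ n
  intCast n := n • oneL
  intCast_ofNat n := natCast_zsmul _ n
  intCast_negSucc_ofNat n := negSucc_zsmul _ n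

end Product

theorem isConvexCone_halfLine : IsConvexCone {x : E 1 | 0 ≤ x 0} :=
  ⟨{EuclideanSpace.single 0 1}, by ext x; simp [EuclideanSpace.inner_single_left]⟩

/-- The element `d` of `L 1`: the class of a closed half-line. -/
noncomputable def halfLine : L 1 := cls 1 ⟨ind {x : E 1 | 0 ≤ x 0}, isConvexCone_halfLine.isCone.ind_mem⟩

section InteriorL

theorem IsOpenCell.preimage {V W : Type*} [NormedAddCommGroup V] [InnerProductSpace ℝ V]
    [NormedAddCommGroup W] [InnerProductSpace ℝ W] (e : V ≃ₗᵢ[ℝ] W) {U : Set W}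
    (hU : IsOpenCell U) : IsOpenCell (e ⁻¹' U) := by
  classical
  obtain ⟨⟨p, hp⟩, A, B, rfl⟩ := hU
  refine ⟨⟨e.symm p, by simpa using hp⟩, A.image e.symm, B.image e.symm, ?_⟩
  ext x
  have : ∀ w, inner ℝ (e.symm w) x = inner ℝ w (e x) := fun w => by
    rw [← e.inner_map_map, e.apply_symm_apply]
  simp only [cell, Set.mem_preimage, Set.mem_ofPred_eq, Finset.forall_mem_image, this]

theorem coneGroup_hom_ext {V : Type*} [NormedAddCommGroup V] [InnerProductSpace ℝ V]
    {A : Type*} [AddCommGroup A] {φ ψ : coneGroup V →+ A}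
    (h : ∀ U (hU : IsOpenCell U), φ ⟨ind U, hU.ind_mem⟩ = ψ ⟨ind U, hU.ind_mem⟩) : φ = ψ := by
  have hcl := coneGroup_eq_closure_cells (V := V)
  ext ⟨f, hf⟩
  have hf' := hf
  rw [hcl] at hf'
  induction hf' using AddSubgroup.closure_induction with
  | mem f hf' =>
    obtain ⟨⟨U, hU⟩, rfl⟩ := hf'
    exact h U hU
  | zero => exact (map_zero φ).trans (map_zero ψ).symm
  | add a b ha hb iha ihb =>
    rw [← hcl] at ha hb
    have := congrArg₂ (· + ·) (iha ha) (ihb hb)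
    simp only [← map_add] at this
    exact this
  | neg a ha iha =>
    rw [← hcl] at ha
    have := congrArg (- ·) (iha ha)
    simp only [← map_neg] at this
    exact this

theorem interior_comap {V W : Type*} [NormedAddCommGroup V] [InnerProductSpace ℝ V]
    [FiniteDimensional ℝ V] [NormedAddCommGroup W] [InnerProductSpace ℝ W]
    [FiniteDimensional ℝ W] (e : V ≃ₗᵢ[ℝ] W) (f : coneGroup W) :
    interiorMap V (comap e.toLinearMap f) = comap e.toLinearMap (interiorMap W f) := by
  suffices (interiorMap V).comp (comap e.toLinearMap) =
      (comap e.toLinearMap).comp (interiorMap W) from DFunLike.congr_fun this f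
  refine coneGroup_hom_ext fun U hU => Subtype.ext ?_
  refine (interior_apply (hU.preimage e)).trans ?_
  change _ = (interiorMap W _).1 ∘ e
  rw [interior_apply hU]
  have h1 : closure (e ⁻¹' U) = e ⁻¹' closure U := (e.toHomeomorph.preimage_closure U).symm
  have h2 : Module.finrank ℝ (Submodule.span ℝ (e ⁻¹' U)) =
      Module.finrank ℝ (Submodule.span ℝ U) := by
    have : (e ⁻¹' U) = e.symm.toLinearEquiv '' U := (e.toEquiv.symm.image_eq_preimage_symm U).symm
    rw [this, ← LinearEquiv.coe_coe, Submodule.span_image]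
    exact LinearEquiv.finrank_map_eq _ _
  rw [h1, h2]
  rfl

/-- The interior involution on `L n`. -/
noncomputable def interiorL (n : ℕ) : L n →+ L n :=
  L.lift ((cls n).comp (interiorMap (E n))) fun g f => by
    rw [AddMonoidHom.comp_apply, interior_comap, cls_comap]; rfl

end InteriorL

section Boundary

/-- The subgroup of the cone group generated by the convex cones of dimension at most `k`. -/
def coneGroupLE (V : Type*) [NormedAddCommGroup V] [InnerProductSpace ℝ V] (k : ℕ) :
    AddSubgroup (coneGroup V) :=
  AddSubgroup.closure {x | ∃ C : Set V, IsConvexCone C ∧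
    Module.finrank ℝ (Submodule.span ℝ C) ≤ k ∧ x.1 = ind C}

section Filtration

variable {V : Type*} [NormedAddCommGroup V] [InnerProductSpace ℝ V] [FiniteDimensional ℝ V]

theorem isConvexCone_submodule (W : Submodule ℝ V) : IsConvexCone (W : Set V) := by
  classical
  obtain ⟨S, hS⟩ := (IsNoetherian.noetherian Wᗮ)
  have := isConvexCone_closedCell S ∅
  convert this using 1
  ext x
  simp only [SetLike.mem_coe, Set.mem_ofPred_eq, Finset.notMem_empty, IsEmpty.forall_iff,
    implies_true, and_true]
  rw [← W.orthogonal_orthogonal, ← hS, Submodule.mem_orthogonal]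
  constructor
  · intro h w hw
    exact h w (Submodule.subset_span hw)
  · intro h u hu
    induction hu using Submodule.span_induction with
    | mem u hu => exact h u hu
    | zero => simp
    | add a b _ _ ha hb => rw [inner_add_left, ha, hb, add_zero]
    | smul a u _ hu => rw [inner_smul_left, hu, mul_zero]

/-- Restriction of an element of the cone group to a linear subspace. -/
noncomputable def restrict (W : Submodule ℝ V) (f : coneGroup V) : coneGroup V :=
  ⟨f.1 * ind (W : Set V), mul_mem_coneGroup f.2 (isConvexCone_submodule W).isCone.ind_mem⟩

theorem restrict_apply_mem {W : Submodule ℝ V} (f : coneGroup V) {x : V} (hx : x ∈ W) :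
    (restrict W f).1 x = f.1 x := by
  classical
  change f.1 x * ind (W : Set V) x = _
  rw [ind_apply, if_pos (by exact hx), mul_one]

theorem restrict_apply_notMem {W : Submodule ℝ V} (f : coneGroup V) {x : V} (hx : x ∉ W) :
    (restrict W f).1 x = 0 := by
  classical
  change f.1 x * ind (W : Set V) x = _
  rw [ind_apply, if_neg (by exact hx), mul_zero]

theorem exists_decomposition {ι : Type*} (s : Finset ι) (W : ι → Submodule ℝ V) :
    ∀ f : coneGroup V, (∀ x, (∀ i ∈ s, x ∉ W i) → f.1 x = 0) →
      ∃ g : ι → coneGroup V, (∀ i, ∀ x, x ∉ W i → (g i).1 x = 0) ∧ f = ∑ i ∈ s, g i := by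
  classical
  induction s using Finset.induction_on with
  | empty =>
    intro f hf
    refine ⟨fun _ => 0, fun _ _ _ => rfl, Subtype.ext (funext fun x => ?_)⟩
    exact hf x (by simp)
  | insert j s hj ih =>
    intro f hf
    obtain ⟨g, hg, hsum⟩ := ih (f - restrict (W j) f) (by
      intro x hx
      change f.1 x - (restrict (W j) f).1 x = 0
      by_cases hxj : x ∈ W j
      · rw [restrict_apply_mem f hxj, sub_self]
      · rw [restrict_apply_notMem f hxj, sub_zero]
        exact hf x (by simpa [hxj] using hx))
    refine ⟨Function.update g j (restrict (W j) f), ?_, ?_⟩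
    · intro i x hx
      by_cases hij : i = j
      · subst hij
        rw [Function.update_self]
        exact restrict_apply_notMem f hx
      · rw [Function.update_of_ne hij]
        exact hg i x hx
    · rw [Finset.sum_insert hj, Function.update_self,
        Finset.sum_congr rfl fun i hi => Function.update_of_ne (ne_of_mem_of_not_mem hi hj) _ _,
        ← hsum]
      abel

theorem restrict_mem_coneGroupLE (W : Submodule ℝ V) {k : ℕ} (hW : Module.finrank ℝ W ≤ k)
    (f : coneGroup V) : restrict W f ∈ coneGroupLE V k := by
  let r : (V → ℤ) →+ (V → ℤ) := AddMonoidHom.mulRight (ind (W : Set V))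
  have : coneGroup V ≤ ((coneGroupLE V k).map (coneGroup V).subtype).comap r := by
    refine coneGroup_le fun C hC => ?_
    have hCW : IsConvexCone (C ∩ (W : Set V)) := hC.inter (isConvexCone_submodule W)
    refine ⟨⟨_, hCW.isCone.ind_mem⟩, AddSubgroup.subset_closure ⟨_, hCW, ?_, rfl⟩, ?_⟩
    · refine (Submodule.finrank_mono ?_).trans hW
      exact Submodule.span_le.2 Set.inter_subset_right
    · exact ind_inter C W
  obtain ⟨y, hy, hy'⟩ := this f.2
  have : y = restrict W f := Subtype.ext hy'
  rwa [← this]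

theorem mem_coneGroupLE_of_support {ι : Type*} (s : Finset ι) (W : ι → Submodule ℝ V) {k : ℕ}
    (hW : ∀ i ∈ s, Module.finrank ℝ (W i) ≤ k) (f : coneGroup V)
    (hf : ∀ x, (∀ i ∈ s, x ∉ W i) → f.1 x = 0) : f ∈ coneGroupLE V k := by
  obtain ⟨g, hg, rfl⟩ := exists_decomposition s W f hf
  refine sum_mem fun i hi => ?_
  have : g i = restrict (W i) (g i) := by
    apply Subtype.ext
    funext x
    by_cases hx : x ∈ W i
    · rw [restrict_apply_mem _ hx]
    · rw [restrict_apply_notMem _ hx, hg i x hx]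
  rw [this]
  exact restrict_mem_coneGroupLE _ (hW i hi) _

/-- In a space of dimension `k + 1`, the element `f - (-1)^(k+1) I f` has dimension at most
`k`. -/
theorem boundary_mem {k : ℕ} (hV : Module.finrank ℝ V = k + 1) (f : coneGroup V) :
    f - (-1 : ℤ) ^ (k + 1) • interiorMap V f ∈ coneGroupLE V k := by
  classical
  suffices ((QuotientAddGroup.mk' (coneGroupLE V k)).comp
      (AddMonoidHom.id _ - (-1 : ℤ) ^ (k + 1) • interiorMap V)) = 0 from
    (QuotientAddGroup.eq_zero_iff _).1 (DFunLike.congr_fun this f)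
  refine coneGroup_hom_ext fun U hU => ?_
  refine (QuotientAddGroup.eq_zero_iff _).2 ?_
  have hval : ∀ x, ((AddMonoidHom.id (coneGroup V) - (-1 : ℤ) ^ (k + 1) • interiorMap V)
      ⟨ind U, hU.ind_mem⟩).1 x = ind U x - (-1 : ℤ) ^ (k + 1) *
        ((-1 : ℤ) ^ Module.finrank ℝ (Submodule.span ℝ U) * ind (closure U) x) := by
    intro x
    have := congrFun (interior_apply hU) x
    change ind U x - ((-1 : ℤ) ^ (k + 1) • (interiorMap V ⟨ind U, hU.ind_mem⟩)).1 x = _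
    change ind U x - (-1 : ℤ) ^ (k + 1) • (interiorMap V ⟨ind U, hU.ind_mem⟩).1 x = _
    rw [this]; rfl
  rcases (Submodule.finrank_le (Submodule.span ℝ U)).lt_or_eq with hlt | heq
  · refine mem_coneGroupLE_of_support {()} (fun _ => Submodule.span ℝ U) (by intros; omega) _ ?_
    intro x hx
    have hx' : x ∉ Submodule.span ℝ U := hx () (by simp)
    rw [hval, ind_apply, ind_apply, if_neg fun h => hx' (Submodule.subset_span h), if_neg]
    · simp
    · intro h
      have hc : IsClosed (Submodule.span ℝ U : Set V) := Submodule.closed_of_finiteDimensional _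
      exact hx' (closure_minimal Submodule.subset_span hc h)
  · rw [heq, hV] at hval
    obtain ⟨hne, A, B, rfl⟩ := hU
    refine mem_coneGroupLE_of_support (B.filter (· ≠ 0)) (fun w => (ℝ ∙ w)ᗮ) ?_ _ ?_
    · intro w hw
      have h0 : w ≠ 0 := (Finset.mem_filter.1 hw).2
      have := Submodule.finrank_add_finrank_orthogonal (ℝ ∙ w)
      rw [finrank_span_singleton h0] at this
      omega
    · intro x hx
      rw [hval, ← mul_assoc, ← mul_pow]
      have hb : ∀ w ∈ B, inner ℝ w x ≠ 0 := by
        intro w hw h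
        have hw0 : w ≠ 0 := by
          rintro rfl
          obtain ⟨p, hp⟩ := hne
          simpa using hp.2 0 hw
        exact hx w (Finset.mem_filter.2 ⟨hw, hw0⟩) (Submodule.mem_orthogonal_singleton_iff_inner_right.2 h)
      have : x ∈ closure (cell A B) ↔ x ∈ cell A B := by
        rw [closure_cell hne]
        refine and_congr_right fun _ => forall₂_congr fun w hw => ?_
        exact ⟨fun h => lt_of_le_of_ne h (hb w hw).symm, le_of_lt⟩
      simp only [ind_apply, this]
      simp

end Filtration

section Descend

variable {V : Type*} [NormedAddCommGroup V] [InnerProductSpace ℝ V]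

theorem exists_partial_isometry {n : ℕ} (φ ψ : E n →ₗᵢ[ℝ] V) :
    ∃ u : E n ≃ₗᵢ[ℝ] E n, ∀ x, φ x ∈ LinearMap.range ψ.toLinearMap → ψ (u x) = φ x := by
  let W : Submodule ℝ (E n) := (LinearMap.range ψ.toLinearMap).comap φ.toLinearMap
  have hW : ∀ x : W, ∃ y, ψ y = φ x := fun x => x.2
  choose r hr using hW
  let l : W →ₗᵢ[ℝ] E n :=
    { toFun := r
      map_add' := fun x y => ψ.injective (by rw [map_add, hr, hr, hr]; exact map_add φ _ _)
      map_smul' := fun a x => ψ.injective (by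
        rw [map_smul, hr, hr]; exact map_smul φ _ _)
      norm_map' := fun x => by
        change ‖r x‖ = _
        rw [← ψ.norm_map, hr, φ.norm_map]; rfl }
  refine ⟨l.extend.toLinearIsometryEquiv rfl, fun x hx => ?_⟩
  have : l.extend x = l ⟨x, hx⟩ := l.extend_apply ⟨x, hx⟩
  change ψ (l.extend x) = _
  rw [this]
  exact hr ⟨x, hx⟩

/-- Push forward along an isometric embedding (extension by zero): it sends `(P)` to `(φ P)`. -/
noncomputable def push {n : ℕ} (φ : E n →ₗᵢ[ℝ] V) (g : coneGroup (E n)) : V → ℤ :=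
  Function.extend φ g.1 0

theorem push_apply {n : ℕ} (φ : E n →ₗᵢ[ℝ] V) (g : coneGroup (E n)) (x : E n) :
    push φ g (φ x) = g.1 x := φ.injective.extend_apply _ _ _

theorem push_apply_of_notMem {n : ℕ} (φ : E n →ₗᵢ[ℝ] V) (g : coneGroup (E n)) {y : V}
    (hy : y ∉ LinearMap.range φ.toLinearMap) : push φ g y = 0 :=
  Function.extend_apply' _ _ _ hy

theorem push_add {n : ℕ} (φ : E n →ₗᵢ[ℝ] V) (g h : coneGroup (E n)) :
    push φ (g + h) = push φ g + push φ h := by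
  funext y
  by_cases hy : y ∈ LinearMap.range φ.toLinearMap
  · obtain ⟨x, rfl⟩ := hy
    change push φ (g + h) (φ x) = push φ g (φ x) + push φ h (φ x)
    rw [push_apply, push_apply, push_apply]; rfl
  · rw [Pi.add_apply, push_apply_of_notMem φ _ hy, push_apply_of_notMem φ _ hy,
      push_apply_of_notMem φ _ hy, add_zero]

/-- `push φ` as a homomorphism of functions. -/
noncomputable def pushHom {n : ℕ} (φ : E n →ₗᵢ[ℝ] V) : coneGroup (E n) →+ (V → ℤ) :=
  AddMonoidHom.mk' (push φ) (push_add φ)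

theorem push_relation {n : ℕ} {ι : Type*} (s : Finset ι) (φ : ι → E n →ₗᵢ[ℝ] V) :
    ∀ g : ι → coneGroup (E n), ∑ i ∈ s, push (φ i) (g i) = 0 → ∑ i ∈ s, cls n (g i) = 0 := by
  classical
  induction s using Finset.induction_on with
  | empty => intro g _; simp
  | insert j s hj ih =>
    intro g hg
    rw [Finset.sum_insert hj] at hg
    obtain ⟨h, hh, hsum⟩ := exists_decomposition s
      (fun i => (LinearMap.range (φ i).toLinearMap).comap (φ j).toLinearMap) (g j) (by
        intro x hx
        have h1 := congrFun hg (φ j x)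
        have h0 : ∑ i ∈ s, push (φ i) (g i) (φ j x) = 0 :=
          Finset.sum_eq_zero fun i hi => push_apply_of_notMem (φ i) (g i) (hx i hi)
        rw [Pi.add_apply, push_apply, Finset.sum_apply, h0, add_zero] at h1
        exact h1)
    choose u hu using fun i => exists_partial_isometry (φ j) (φ i)
    have hpush : ∀ i, push (φ i) (comap (u i).symm.toLinearMap (h i)) = push (φ j) (h i) := by
      intro i
      funext y
      by_cases hyj : y ∈ LinearMap.range (φ j).toLinearMap
      · obtain ⟨x, rfl⟩ := hyj
        change push (φ i) _ (φ j x) = push (φ j) _ (φ j x)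
        rw [push_apply]
        by_cases hx : φ j x ∈ LinearMap.range (φ i).toLinearMap
        · rw [← hu i x hx, push_apply]
          change (h i).1 ((u i).symm (u i x)) = _
          rw [LinearIsometryEquiv.symm_apply_apply]
        · rw [push_apply_of_notMem _ _ hx, hh i x hx]
      · rw [push_apply_of_notMem _ _ hyj]
        by_cases hyi : y ∈ LinearMap.range (φ i).toLinearMap
        · obtain ⟨z, rfl⟩ := hyi
          change push (φ i) _ (φ i z) = 0
          rw [push_apply]
          change (h i).1 ((u i).symm z) = 0
          refine hh i _ fun hx => hyj ⟨(u i).symm z, ?_⟩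
          have := hu i _ hx
          rw [LinearIsometryEquiv.apply_symm_apply] at this
          exact this.symm
        · rw [push_apply_of_notMem _ _ hyi]
    have key := ih (fun i => g i + comap (u i).symm.toLinearMap (h i)) (by
      simp only [push_add, hpush, Finset.sum_add_distrib]
      have : ∑ i ∈ s, push (φ j) (h i) = push (φ j) (g j) := by
        rw [hsum]; exact (map_sum (pushHom (φ j)) h s).symm
      rw [this, add_comm]; exact hg)
    simp only [map_add, cls_comap, Finset.sum_add_distrib] at key
    rw [Finset.sum_insert hj, hsum, map_sum, add_comm]
    exact key

variable [FiniteDimensional ℝ V]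

theorem image_isConvexCone {n : ℕ} (φ : E n →ₗᵢ[ℝ] V) {C : Set (E n)} (hC : IsConvexCone C) :
    IsConvexCone (φ '' C) := by
  classical
  obtain ⟨S, rfl⟩ := hC
  have h1 : IsConvexCone {y : V | ∀ w ∈ S.image φ, 0 ≤ inner ℝ w y} := ⟨_, rfl⟩
  convert (isConvexCone_submodule (LinearMap.range φ.toLinearMap)).inter h1 using 1
  ext y
  constructor
  · rintro ⟨x, hx, rfl⟩
    refine ⟨⟨x, rfl⟩, fun w hw => ?_⟩
    obtain ⟨w', hw', rfl⟩ := Finset.mem_image.1 hw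
    rw [φ.inner_map_map]; exact hx w' hw'
  · rintro ⟨⟨x, rfl⟩, hx⟩
    refine ⟨x, fun w hw => ?_, rfl⟩
    have := hx _ (Finset.mem_image_of_mem φ hw)
    rwa [← φ.inner_map_map]

theorem push_mem {n : ℕ} (φ : E n →ₗᵢ[ℝ] V) (g : coneGroup (E n)) :
    ∃ h : push φ g ∈ coneGroup V, (⟨push φ g, h⟩ : coneGroup V) ∈ coneGroupLE V n := by
  obtain ⟨g, hg⟩ := g
  let H : AddSubgroup (V → ℤ) := (coneGroupLE V n).map (coneGroup V).subtype
  let p : (E n → ℤ) →+ (V → ℤ) := AddMonoidHom.mk' (fun f => Function.extend φ f 0) (by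
    intro f f'
    rw [← Function.extend_add, add_zero])
  have : coneGroup (E n) ≤ H.comap p := by
    refine coneGroup_le fun C hC => ?_
    have hφC := image_isConvexCone φ hC
    refine ⟨⟨_, hφC.isCone.ind_mem⟩, AddSubgroup.subset_closure ⟨_, hφC, ?_, rfl⟩, ?_⟩
    · have : Submodule.span ℝ (φ '' C) ≤ LinearMap.range φ.toLinearMap :=
        Submodule.span_le.2 (by rintro _ ⟨x, _, rfl⟩; exact ⟨x, rfl⟩)
      refine (Submodule.finrank_mono this).trans ?_
      exact (LinearMap.finrank_range_le _).trans (by simp)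
    · classical
      funext y
      change ind (φ '' C) y = Function.extend φ (ind C) 0 y
      by_cases hy : ∃ x, φ x = y
      · obtain ⟨x, rfl⟩ := hy
        rw [φ.injective.extend_apply, ind_apply, ind_apply, φ.injective.mem_set_image]
      · rw [Function.extend_apply' _ _ _ hy, ind_apply, if_neg]
        · rfl
        · rintro ⟨x, _, rfl⟩; exact hy ⟨x, rfl⟩
  obtain ⟨y, hy, hy'⟩ := this hg
  have e : y.1 = push φ ⟨g, hg⟩ := hy'
  exact ⟨e ▸ y.2, by have : y = ⟨push φ ⟨g, hg⟩, e ▸ y.2⟩ := Subtype.ext e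
                     rwa [← this]⟩

theorem exists_embedding {n : ℕ} (hV : n ≤ Module.finrank ℝ V) (W : Submodule ℝ V)
    (hW : Module.finrank ℝ W ≤ n) :
    ∃ φ : E n →ₗᵢ[ℝ] V, W ≤ LinearMap.range φ.toLinearMap := by
  obtain ⟨W', hWW', hW'⟩ : ∃ W' : Submodule ℝ V, W ≤ W' ∧ Module.finrank ℝ W' = n := by
    induction n, hW using Nat.le_induction with
    | base => exact ⟨W, le_rfl, rfl⟩
    | succ n hn ih =>
      obtain ⟨W', h1, h2⟩ := ih (by omega)
      have hne : W'ᗮ ≠ ⊥ := by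
        intro h
        have := Submodule.finrank_add_finrank_orthogonal W'
        rw [h, finrank_bot] at this
        omega
      obtain ⟨v, hv, hv0⟩ := Submodule.exists_mem_ne_zero_of_ne_bot hne
      refine ⟨W' ⊔ ℝ ∙ v, h1.trans le_sup_left, ?_⟩
      have h3 := Submodule.finrank_sup_add_finrank_inf_eq W' (ℝ ∙ v)
      have h4 : W' ⊓ ℝ ∙ v = ⊥ := by
        refine Submodule.eq_bot_iff _ |>.2 ?_
        rintro x ⟨hx1, hx2⟩
        obtain ⟨a, rfl⟩ := Submodule.mem_span_singleton.1 hx2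
        have h5 : inner ℝ (a • v) (a • v) = (0 : ℝ) :=
          (Submodule.mem_orthogonal _ _).1 (Submodule.smul_mem _ a hv) _ hx1
        exact inner_self_eq_zero.1 h5
      rw [h4, finrank_bot, finrank_span_singleton hv0] at h3
      omega
  let b := stdOrthonormalBasis ℝ W'
  let e : W' ≃ₗᵢ[ℝ] E n := b.repr.trans (reindex (finCongr hW'))
  refine ⟨W'.subtypeₗᵢ.comp e.symm.toLinearIsometry, fun x hx => ⟨e ⟨x, hWW' hx⟩, ?_⟩⟩
  change ((e.symm (e ⟨x, hWW' hx⟩) : W') : V) = x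
  rw [LinearIsometryEquiv.symm_apply_apply]

theorem coneGroupLE_le {n : ℕ} (hV : n ≤ Module.finrank ℝ V) :
    coneGroupLE V n ≤ (AddSubgroup.closure (Set.range
      fun p : (E n →ₗᵢ[ℝ] V) × coneGroup (E n) => push p.1 p.2)).comap (coneGroup V).subtype := by
  classical
  refine (AddSubgroup.closure_le _).2 ?_
  rintro ⟨_, hx⟩ ⟨C, hC, hdim, rfl⟩
  obtain ⟨φ, hφ⟩ := exists_embedding hV _ hdim
  refine AddSubgroup.subset_closure
    ⟨(φ, ⟨ind (φ ⁻¹' C), (hC.preimage φ.toLinearMap).isCone.ind_mem⟩), ?_⟩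
  funext y
  change push φ _ y = ind C y
  by_cases hy : y ∈ LinearMap.range φ.toLinearMap
  · obtain ⟨x, rfl⟩ := hy
    exact push_apply φ _ x
  · rw [push_apply_of_notMem _ _ hy, ind_apply, if_neg fun h => hy (hφ (Submodule.subset_span h))]

/-- If `n ≤ dim V`, there is exactly one homomorphism to `L n` from the group of cones of dimension
at most `n` in `V` that sends `(φ P)` to `⟨P⟩ₙ` for each isometric embedding `φ : ℝⁿ → V`. -/
theorem existsUnique_descend {n : ℕ} (hV : n ≤ Module.finrank ℝ V) :
    ∃! ρ : coneGroupLE V n →+ L n, ∀ (φ : E n →ₗᵢ[ℝ] V) (g : coneGroup (E n)),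
      ρ ⟨⟨push φ g, (push_mem φ g).1⟩, (push_mem φ g).2⟩ = cls n g := by
  obtain ⟨ρ, hρ⟩ := exists_lift (fun p : (E n →ₗᵢ[ℝ] V) × coneGroup (E n) => push p.1 p.2)
    (fun p => cls n p.2) (by
      intro c hc
      have h1 : ∀ p : (E n →ₗᵢ[ℝ] V) × coneGroup (E n), c p • push p.1 p.2 = push p.1 (c p • p.2) :=
        fun p => (map_zsmul (pushHom p.1) (c p) p.2).symm
      have := push_relation c.support (fun p => p.1) (fun p => c p • p.2) (by
        simpa only [Finsupp.sum, h1] using hc)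
      simpa only [Finsupp.sum, map_zsmul] using this)
  have hle := coneGroupLE_le (V := V) hV
  let inc : coneGroupLE V n →+ AddSubgroup.closure (Set.range
      fun p : (E n →ₗᵢ[ℝ] V) × coneGroup (E n) => push p.1 p.2) :=
    AddMonoidHom.mk' (fun x => ⟨x.1.1, hle x.2⟩) fun _ _ => rfl
  refine ⟨ρ.comp inc, fun φ g => hρ (φ, g), fun ψ hψ => ?_⟩
  ext ⟨⟨x, hx⟩, hx'⟩
  have hx'' : x ∈ AddSubgroup.closure (Set.range
      fun p : (E n →ₗᵢ[ℝ] V) × coneGroup (E n) => push p.1 p.2) := hle hx'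
  have hmem : ∀ y ∈ AddSubgroup.closure (Set.range
      fun p : (E n →ₗᵢ[ℝ] V) × coneGroup (E n) => push p.1 p.2),
      ∃ h : y ∈ coneGroup V, (⟨y, h⟩ : coneGroup V) ∈ coneGroupLE V n := by
    intro y hy
    induction hy using AddSubgroup.closure_induction with
    | mem y hy => obtain ⟨p, rfl⟩ := hy; exact push_mem p.1 p.2
    | zero => exact ⟨zero_mem _, zero_mem _⟩
    | add a b _ _ ha hb => exact ⟨add_mem ha.1 hb.1, add_mem ha.2 hb.2⟩
    | neg a _ ha => exact ⟨neg_mem ha.1, neg_mem ha.2⟩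
  induction hx'' using AddSubgroup.closure_induction with
  | mem y hy => obtain ⟨p, rfl⟩ := hy; rw [hψ]; exact (hρ p).symm
  | zero => exact (map_zero ψ).trans (map_zero _).symm
  | add a b ha hb iha ihb =>
    have := congrArg₂ (· + ·) (iha (hmem a ha).1 (hmem a ha).2) (ihb (hmem b hb).1 (hmem b hb).2)
    simp only [← map_add] at this
    exact this
  | neg a ha iha =>
    have := congrArg (- ·) (iha (hmem a ha).1 (hmem a ha).2)
    simp only [← map_neg] at this
    exact this

/-- The class `⟨P⟩ₙ ∈ L n` of a cone `P` of dimension at most `n` in a Euclidean space `V` of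
dimension at least `n`, as a homomorphism. -/
noncomputable def descend {n : ℕ} (hV : n ≤ Module.finrank ℝ V) : coneGroupLE V n →+ L n :=
  (existsUnique_descend hV).choose

theorem descend_push {n : ℕ} (hV : n ≤ Module.finrank ℝ V) (φ : E n →ₗᵢ[ℝ] V)
    (g : coneGroup (E n)) :
    descend hV ⟨⟨push φ g, (push_mem φ g).1⟩, (push_mem φ g).2⟩ = cls n g :=
  (existsUnique_descend hV).choose_spec.1 φ g

theorem comap_mem_coneGroupLE (e : V ≃ₗᵢ[ℝ] V) {n : ℕ} {f : coneGroup V}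
    (hf : f ∈ coneGroupLE V n) : comap e.toLinearMap f ∈ coneGroupLE V n := by
  suffices coneGroupLE V n ≤ (coneGroupLE V n).comap (comap e.toLinearMap) from this hf
  refine (AddSubgroup.closure_le _).2 ?_
  rintro ⟨_, hx⟩ ⟨C, hC, hdim, rfl⟩
  refine AddSubgroup.subset_closure ⟨_, hC.preimage e.toLinearMap, ?_, rfl⟩
  have : (e ⁻¹' C) = e.symm.toLinearEquiv '' C := (e.toEquiv.symm.image_eq_preimage_symm C).symm
  change Module.finrank ℝ (Submodule.span ℝ (e ⁻¹' C)) ≤ n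
  rw [this, ← LinearEquiv.coe_coe, Submodule.span_image]
  exact (LinearEquiv.finrank_map_eq _ _).trans_le hdim

theorem descend_comap {n : ℕ} (hV : n ≤ Module.finrank ℝ V) (e : V ≃ₗᵢ[ℝ] V)
    (f : coneGroup V) (hf : f ∈ coneGroupLE V n) :
    descend hV ⟨comap e.toLinearMap f, comap_mem_coneGroupLE e hf⟩ = descend hV ⟨f, hf⟩ := by
  let ρ : coneGroupLE V n →+ L n := AddMonoidHom.mk'
    (fun x => descend hV ⟨comap e.toLinearMap x.1, comap_mem_coneGroupLE e x.2⟩)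
    (fun x y => (map_add (descend hV) ⟨comap e.toLinearMap x.1, comap_mem_coneGroupLE e x.2⟩
      ⟨comap e.toLinearMap y.1, comap_mem_coneGroupLE e y.2⟩))
  have : ρ = descend hV := by
    refine (existsUnique_descend hV).unique (fun φ g => ?_) (descend_push hV)
    rw [← descend_push hV (e.symm.toLinearIsometry.comp φ) g]
    change descend hV _ = descend hV _
    congr 2
    apply Subtype.ext
    funext y
    change push φ g (e y) = push (e.symm.toLinearIsometry.comp φ) g y
    by_cases hy : e y ∈ LinearMap.range φ.toLinearMap
    · obtain ⟨x, hx⟩ := hy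
      have hx' : φ x = e y := hx
      have : y = (e.symm.toLinearIsometry.comp φ) x := by
        change y = e.symm (φ x)
        rw [hx', e.symm_apply_apply]
      rw [← hx', push_apply, this, push_apply]
    · rw [push_apply_of_notMem _ _ hy, push_apply_of_notMem]
      rintro ⟨x, rfl⟩
      refine hy ⟨x, ?_⟩
      change φ x = e (e.symm (φ x))
      rw [e.apply_symm_apply]
  exact DFunLike.congr_fun this ⟨f, hf⟩

end Descend

theorem le_finrank_E (n : ℕ) : n ≤ Module.finrank ℝ (E (n + 1)) := by simp

/-- The operator `ξ ↦ ξ - (-1)^(n+1) I ξ`, with values in the cones of dimension at most `n` in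
`ℝⁿ⁺¹`. -/
noncomputable def boundary (n : ℕ) : coneGroup (E (n + 1)) →+ coneGroupLE (E (n + 1)) n :=
  AddMonoidHom.mk'
    (fun f => ⟨f - (-1 : ℤ) ^ (n + 1) • interiorMap (E (n + 1)) f, boundary_mem (by simp) f⟩)
    fun f g => Subtype.ext (by
      change f + g - (-1 : ℤ) ^ (n + 1) • interiorMap (E (n + 1)) (f + g) = _ + _
      rw [map_add, smul_add]
      exact add_sub_add_comm _ _ _ _)

/-- The boundary operator `δₙ₊₁ : L (n + 1) → L n`. -/
noncomputable def delta (n : ℕ) : L (n + 1) →+ L n :=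
  L.lift ((descend (le_finrank_E n)).comp (boundary n)) fun g f => by
    have : boundary n (comap g.toLinearMap f) =
        ⟨comap g.toLinearMap (boundary n f).1, comap_mem_coneGroupLE g (boundary n f).2⟩ := by
      apply Subtype.ext
      change comap g.toLinearMap f - (-1 : ℤ) ^ (n + 1) • interiorMap _ (comap g.toLinearMap f) =
        comap g.toLinearMap (f - (-1 : ℤ) ^ (n + 1) • interiorMap _ f)
      rw [interior_comap, map_sub, map_zsmul]
    rw [AddMonoidHom.comp_apply, this, descend_comap]
    rfl

/-- `L⁺ₙ = ker (δₙ : L n → L (n - 1))`, where `L (-1) = 0`. -/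
noncomputable def Lplus : (n : ℕ) → AddSubgroup (L n)
  | 0 => ⊤
  | n + 1 => (delta n).ker

end Boundary

section Manifolds

/-- A polytope: a finite union of convex hulls of finite sets. -/
def IsPolytope {V : Type*} [AddCommGroup V] [Module ℝ V] (P : Set V) : Prop :=
  ∃ F : Set (Finset V), F.Finite ∧ P = ⋃ S ∈ F, convexHull ℝ (S : Set V)

/-- `X` is a piecewise linear manifold of dimension `m` without boundary: each point of `X` has a
compact polyhedral neighborhood in `X` that is mapped by a piecewise linear homeomorphism onto a
neighborhood of a point of `ℝᵐ`. The homeomorphism is given by its graph `Γ`. -/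
def IsPLManifoldWithoutBoundary {V : Type*} [AddCommGroup V] [Module ℝ V] [TopologicalSpace V]
    (m : ℕ) (X : Set V) : Prop :=
  ∀ x ∈ X, ∃ Γ : Set (V × (Fin m → ℝ)), IsPolytope Γ ∧
    Set.InjOn Prod.fst Γ ∧ Set.InjOn Prod.snd Γ ∧
    Prod.fst '' Γ ⊆ X ∧ Prod.fst '' Γ ∈ nhdsWithin x X ∧
    ∃ y, (x, y) ∈ Γ ∧ Prod.snd '' Γ ∈ nhds y

/-- The relative interior of the conical simplex generated by the vectors `v i` with `i ∈ σ`. -/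
def openConicalSimplex {N n : ℕ} (v : Fin N → E n) (σ : Finset (Fin N)) : Set (E n) :=
  {x | ∃ t : Fin N → ℝ, (∀ i ∈ σ, 0 < t i) ∧ x = ∑ i ∈ σ, t i • v i}

theorem isOpenCell_openConicalSimplex {N n : ℕ} (v : Fin N → E n) (σ : Finset (Fin N))
    (h : LinearIndepOn ℝ v (σ : Set (Fin N))) : IsOpenCell (openConicalSimplex v σ) := by
  classical
  have h' : LinearIndependent ℝ fun i : σ => v i := h
  let T : (σ → ℝ) →ₗ[ℝ] E n := Fintype.linearCombination ℝ fun i : σ => v i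
  have hT : Function.Injective T := LinearMap.ker_eq_bot.1 (by
    have := Fintype.linearIndependent_iff.1 h'
    refine LinearMap.ker_eq_bot'.2 fun t ht => funext fun i => ?_
    exact this t (by simpa [T, Fintype.linearCombination_apply] using ht) i)
  obtain ⟨G, hG⟩ := LinearMap.exists_leftInverse_of_injective T (LinearMap.ker_eq_bot.2 hT)
  have hGT : ∀ t, G (T t) = t := fun t => LinearMap.congr_fun hG t
  -- linear functionals as inner products
  have hrep : ∀ l : E n →ₗ[ℝ] ℝ, ∃ w : E n, ∀ x, inner ℝ w x = l x := fun l =>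
    ⟨(InnerProductSpace.toDual ℝ (E n)).symm (LinearMap.toContinuousLinearMap l), fun x => by
      rw [InnerProductSpace.toDual_symm_apply]; rfl⟩
  choose a ha using fun k : Fin n => hrep
    ((EuclideanSpace.proj k : E n →L[ℝ] ℝ).toLinearMap ∘ₗ (T ∘ₗ G - LinearMap.id))
  choose b hb using fun i : σ => hrep (LinearMap.proj i ∘ₗ G)
  refine ⟨⟨∑ i ∈ σ, (1 : ℝ) • v i, fun _ => 1, fun _ _ => one_pos, rfl⟩,
    Finset.univ.image a, Finset.univ.image b, ?_⟩
  ext x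
  have hA : (∀ w ∈ Finset.univ.image a, inner ℝ w x = 0) ↔ T (G x) = x := by
    simp only [Finset.mem_image, Finset.mem_univ, true_and, forall_exists_index,
      forall_apply_eq_imp_iff, ha]
    constructor
    · intro h
      ext k
      exact sub_eq_zero.1 (h k)
    · intro h k
      have : (T ∘ₗ G - LinearMap.id : E n →ₗ[ℝ] E n) x = 0 := sub_eq_zero.2 h
      rw [LinearMap.comp_apply, this, map_zero]
  have hB : (∀ w ∈ Finset.univ.image b, 0 < inner ℝ w x) ↔ ∀ i : σ, 0 < G x i := by
    simp only [Finset.mem_image, Finset.mem_univ, true_and, forall_exists_index,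
      forall_apply_eq_imp_iff, hb]
    rfl
  change (∃ t : Fin N → ℝ, (∀ i ∈ σ, 0 < t i) ∧ x = ∑ i ∈ σ, t i • v i) ↔ _ ∧ _
  rw [hA, hB]
  have hTs : ∀ t : Fin N → ℝ, T (fun i : σ => t i) = ∑ i ∈ σ, t i • v i := by
    intro t
    rw [Fintype.linearCombination_apply]
    exact Finset.sum_coe_sort σ fun i => t i • v i
  constructor
  · rintro ⟨t, ht, rfl⟩
    rw [← hTs, hGT]
    exact ⟨rfl, fun i => ht i i.2⟩
  · rintro ⟨h1, h2⟩
    refine ⟨fun i => if hi : i ∈ σ then G x ⟨i, hi⟩ else 0, fun i hi => ?_, ?_⟩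
    · simpa [hi] using h2 ⟨i, hi⟩
    · rw [← hTs]
      conv_lhs => rw [← h1]
      congr 1
      ext i
      simp

/-- A nonempty abstract Euclidean cone of dimension at most `n`, with a conical triangulation:
a finite simplicial complex (containing the empty face, which corresponds to the apex), together
with a Euclidean structure. The conical simplex corresponding to a face `σ` is embedded linearly
in `ℝⁿ`, with generators `vec σ i`, and these embeddings are compatible, up to isometry, with
restriction to faces. -/
structure EuclideanCone (n : ℕ) where
  /-- the number of vertices -/
  N : ℕ
  /-- the faces -/
  faces : Finset (Finset (Fin N))
  empty_mem : ∅ ∈ faces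
  down_closed : ∀ σ ∈ faces, ∀ τ, τ ⊆ σ → τ ∈ faces
  /-- the generators of the conical simplices -/
  vec : Finset (Fin N) → Fin N → E n
  linearIndepOn : ∀ σ ∈ faces, LinearIndepOn ℝ (vec σ) (σ : Set (Fin N))
  compatible : ∀ σ ∈ faces, ∀ τ, τ ⊆ σ → ∀ i ∈ τ, ∀ j ∈ τ,
    (inner ℝ (vec τ i) (vec τ j) : ℝ) = inner ℝ (vec σ i) (vec σ j)

namespace EuclideanCone

variable {n : ℕ} (M : EuclideanCone n)

/-- The underlying piecewise linear space: the cone in `ℝᴺ` that is the union of the conical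
simplices generated by the standard basis vectors indexed by the faces. -/
def space : Set (Fin M.N → ℝ) :=
  {x | (∀ i, 0 ≤ x i) ∧ (Finset.univ.filter fun i => x i ≠ 0) ∈ M.faces}

/-- The class `⟨M⟩ₙ ∈ L n`: the sum of the classes of the interiors of the conical simplices. -/
noncomputable def toL : L n :=
  ∑ σ : M.faces, cls n ⟨ind (openConicalSimplex (M.vec σ) σ),
    (isOpenCell_openConicalSimplex _ _ (M.linearIndepOn σ σ.2)).ind_mem⟩

end EuclideanCone

/-- `L_n^ev`: the subgroup generated by the even-dimensional interior manifold cones, that is,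
by the Euclidean cones that are piecewise linear manifolds of even dimension without boundary. -/
noncomputable def Lev (n : ℕ) : AddSubgroup (L n) :=
  AddSubgroup.closure {x | ∃ (M : EuclideanCone n) (m : ℕ), Even m ∧
    IsPLManifoldWithoutBoundary m M.space ∧ x = M.toL}

/-- `L_n^od`: the subgroup generated by the odd-dimensional interior manifold cones. -/
noncomputable def Lod (n : ℕ) : AddSubgroup (L n) :=
  AddSubgroup.closure {x | ∃ (M : EuclideanCone n) (m : ℕ), Odd m ∧
    IsPLManifoldWithoutBoundary m M.space ∧ x = M.toL}

end Manifolds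

end ConeRing

/-! Write `δ` for the total boundary and `θ` for `ξ ↦ (-1)ⁿ I ξ` on `L`. The involution is
multiplicative for external products, so `ab - a'b' = (a - a')b + a'(b - b')` becomes the twisted
Leibniz rule `δ(xy) = δ(x) y + θ(x) δ(y)` (`totalDelta_mul`), and a direct computation gives `δ(d) =
1` (`totalDelta_dL`). Hence `ker δ` is a subring, and `δ(d x) = x` for `x ∈ ker δ`. This yields `L⁺
⊆ im δ` and the independence of `1, d` over `L⁺`. Once `δ ∘ δ = 0` is known, `x = (x - d δx) + d δx`
shows that `1, d` span.

The equation `δ ∘ δ = 0` and the manifold description are proved together by a cycle of inclusions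
`L⁺ ⊆ im δ ⊆ manifoldSpan ⊆ L⁺`. For `im δ ⊆ manifoldSpan` (`range_delta_le`), open conical
simplices generate the cone group (`coneGroup_le_simplexSpan`). The boundary of an open `k`-simplex
in `ℝⁿ⁺¹` is, according to the parity of `n + 1 + k`, either minus the sum of its proper open faces
or the open simplex plus the closed one. The first is a simplex boundary. The second is a simplex
doubled along its boundary, and after a stellar subdivision of one copy it too has the combinatorics
of a simplex boundary. Both are cones over spheres of the right parity. For `manifoldSpan ⊆ L⁺`
(`toL_mem_Lplus`), the coefficient of a face `τ` in `δ⟨M⟩` is governed by the alternating sum over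
the faces that contain `τ`. This sum is the compactly supported Euler characteristic of the cone of
directions at a point of `τ`. A piecewise linear chart identifies that cone with `ℝᵐ` through linear
maps injective on a common cone, so the sum is `(-1)ᵐ` (`sum_neg_one_pow_card`) and the coefficient
vanishes.

In the last statement, `im(𝕀 + (-1)ⁿ I) ⊆ L⁺` follows from `I² = 𝕀`. Conversely one shows that every
`δ(f)` has the form `ξ + (-1)ⁿ I ξ`. This holds for `f` of lower dimension by a formula, and for
`2f` because `θ` is the identity on `L⁺`. A full-dimensional simplex with unit generators is cut
repeatedly by circumcenters, with signs when a circumcenter lies outside, until each piece splits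
into two congruent halves, that is, into twice something (`openSimplex_mem_halvable_of_inner_eq`).
-/

namespace ConeRing

/-! ### Images of relatively open cones under linear maps -/

section Images

variable {V W : Type*} [NormedAddCommGroup V] [InnerProductSpace ℝ V] [FiniteDimensional ℝ V]
  [NormedAddCommGroup W] [InnerProductSpace ℝ W] [FiniteDimensional ℝ W]

theorem exists_finset_mem_submodule_iff (S : Submodule ℝ V) :
    ∃ A : Finset V, ∀ x, x ∈ S ↔ ∀ w ∈ A, inner ℝ w x = 0 := by
  obtain ⟨A, hA⟩ := IsNoetherian.noetherian Sᗮ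
  refine ⟨A, fun x => ?_⟩
  rw [← S.orthogonal_orthogonal, ← hA, Submodule.mem_orthogonal]
  constructor
  · intro h w hw
    exact h w (Submodule.subset_span hw)
  · intro h u hu
    induction hu using Submodule.span_induction with
    | mem u hu => exact h u hu
    | zero => simp
    | add a b _ _ ha hb => rw [inner_add_left, ha, hb, add_zero]
    | smul a u _ hu => rw [inner_smul_left, hu, mul_zero]

theorem preimage_cell [DecidableEq V] (T : V →ₗ[ℝ] W) (A B : Finset W) :
    T ⁻¹' cell A B = cell (A.image (LinearMap.adjoint T)) (B.image (LinearMap.adjoint T)) := by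
  ext x
  simp [cell, LinearMap.adjoint_inner_left]

-- A vector `x` of the span enters the cell after adding a large multiple `s • p` of a point `p` of
-- the cell. If `T x = 0`, then `x + s • p` and `s • p` are two points of the cell with the same
-- image.
omit [FiniteDimensional ℝ V] [FiniteDimensional ℝ W] in
theorem injOn_span_of_injOn_cell (T : V →ₗ[ℝ] W) {U : Set V} (hU : IsOpenCell U)
    (hT : Set.InjOn T U) : Set.InjOn T (Submodule.span ℝ U) := by
  obtain ⟨hne, A, B, rfl⟩ := hU
  obtain ⟨p, hp⟩ := hne
  have key : ∀ x ∈ Submodule.span ℝ (cell A B), T x = 0 → x = 0 := by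
    intro x hx hTx
    obtain ⟨t, ht, h1⟩ := exists_add_smul_mem_cell hp ((mem_span_cell ⟨p, hp⟩).1 hx)
    obtain ⟨s, hs, h2⟩ := exists_add_smul_mem_cell hp (x := 0) (by simp)
    have := hT (h1 _ (le_max_left t s)) (h2 _ (le_max_right t s)) (by simp [hTx])
    simpa using this
  intro x hx y hy h
  exact sub_eq_zero.1 (key _ (sub_mem hx hy) (by rw [map_sub, h, sub_self]))

theorem IsOpenCell.image (T : V →ₗ[ℝ] W) {U : Set V} (hU : IsOpenCell U) (hT : Set.InjOn T U) :
    IsOpenCell (T '' U) := by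
  classical
  have hinj := injOn_span_of_injOn_cell T hU hT
  obtain ⟨hne, A, B, hAB⟩ := hU
  set S := Submodule.span ℝ U
  obtain ⟨G₀, hG₀⟩ := (T ∘ₗ S.subtype).exists_leftInverse_of_injective
    (LinearMap.ker_eq_bot.2 fun x y h => Subtype.ext (hinj x.2 y.2 h))
  set G := S.subtype ∘ₗ G₀
  have hG : ∀ x ∈ S, G (T x) = x := fun x hx =>
    congrArg Subtype.val (LinearMap.congr_fun hG₀ ⟨x, hx⟩)
  obtain ⟨A', hA'⟩ := exists_finset_mem_submodule_iff (LinearMap.ker (T ∘ₗ G - LinearMap.id))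
  refine ⟨hne.image T, A' ∪ A.image (LinearMap.adjoint G), B.image (LinearMap.adjoint G), ?_⟩
  -- With `G` inverting `T` on the span of `U`, the image becomes a linear subspace cut by a
  -- preimage, and preimages of cells are cells.
  have e : T '' U = {y | y ∈ LinearMap.ker (T ∘ₗ G - LinearMap.id)} ∩ G ⁻¹' U := by
    ext y
    constructor
    · rintro ⟨x, hx, rfl⟩
      have := hG x (Submodule.subset_span hx)
      refine ⟨?_, ?_⟩
      · change T (G (T x)) - T x = 0
        rw [this, sub_self]
      · change G (T x) ∈ U
        rwa [this]
    · rintro ⟨h1, h2⟩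
      exact ⟨G y, h2, sub_eq_zero.1 h1⟩
  have e' : {y | y ∈ LinearMap.ker (T ∘ₗ G - LinearMap.id)} = cell A' ∅ := by
    ext y; simp [cell, ← hA']
  rw [e, e', hAB, preimage_cell, cell_inter, Finset.empty_union]

omit [FiniteDimensional ℝ V] [FiniteDimensional ℝ W] in
theorem finrank_span_image (T : V →ₗ[ℝ] W) {U : Set V} (hU : IsOpenCell U) (hT : Set.InjOn T U) :
    Module.finrank ℝ (Submodule.span ℝ (T '' U)) = Module.finrank ℝ (Submodule.span ℝ U) := by
  rw [Submodule.span_image]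
  have hinj := injOn_span_of_injOn_cell T hU hT
  let e := LinearEquiv.ofInjective (T ∘ₗ (Submodule.span ℝ U).subtype)
    (fun x y h => Subtype.ext (hinj x.2 y.2 h))
  rw [← LinearMap.range_domRestrict]
  exact e.finrank_eq.symm

end Images

/-! ### Open and closed conical simplices and the involution on them -/

section Simplices

variable {N n : ℕ} {v : Fin N → E n} {σ : Finset (Fin N)}

open Classical in
/-- The element of the cone group given by an open conical simplex. -/
noncomputable def openSimplex (v : Fin N → E n) (σ : Finset (Fin N)) : coneGroup (E n) :=
  if h : LinearIndepOn ℝ v (σ : Set (Fin N)) then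
    ⟨ind (openConicalSimplex v σ), (isOpenCell_openConicalSimplex v σ h).ind_mem⟩ else 0

theorem openSimplex_eq (h : LinearIndepOn ℝ v (σ : Set (Fin N))) :
    openSimplex v σ = ⟨ind (openConicalSimplex v σ),
      (isOpenCell_openConicalSimplex v σ h).ind_mem⟩ := dif_pos h

theorem openSimplex_val (h : LinearIndepOn ℝ v (σ : Set (Fin N))) :
    (openSimplex v σ).1 = ind (openConicalSimplex v σ) := by rw [openSimplex_eq h]

theorem coeff_eq (h : LinearIndepOn ℝ v (σ : Set (Fin N))) {a b : Fin N → ℝ}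
    (hab : ∑ i ∈ σ, a i • v i = ∑ i ∈ σ, b i • v i) : ∀ i ∈ σ, a i = b i := by
  intro i hi
  have := linearIndepOn_finset_iff.1 h (fun i => a i - b i) (by
    simp only [sub_smul, Finset.sum_sub_distrib, hab, sub_self]) i hi
  exact sub_eq_zero.1 this

/-- The closed conical simplex generated by the vectors `v i` with `i ∈ σ`. -/
def closedConicalSimplex (v : Fin N → E n) (σ : Finset (Fin N)) : Set (E n) :=
  {x | ∃ t : Fin N → ℝ, (∀ i ∈ σ, 0 ≤ t i) ∧ x = ∑ i ∈ σ, t i • v i}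

/-- The coordinate map of the simplex is an injective linear map in finite dimension, hence a closed
embedding, and the closure can be computed in the orthant. -/
theorem closure_openConicalSimplex (h : LinearIndepOn ℝ v (σ : Set (Fin N))) :
    closure (openConicalSimplex v σ) = closedConicalSimplex v σ := by
  classical
  let T : (σ → ℝ) →ₗ[ℝ] E n := Fintype.linearCombination ℝ fun i : σ => v i
  have hT : LinearMap.ker T = ⊥ := by
    refine LinearMap.ker_eq_bot'.2 fun t ht => funext fun i => ?_
    exact Fintype.linearIndependent_iff.1 (show LinearIndependent ℝ fun i : σ => v i from h) t (by
      simpa [T, Fintype.linearCombination_apply] using ht) i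
  have hTs : ∀ t : Fin N → ℝ, T (fun i : σ => t i) = ∑ i ∈ σ, t i • v i := by
    intro t
    rw [Fintype.linearCombination_apply]
    exact Finset.sum_coe_sort σ fun i => t i • v i
  have image : ∀ R : Set ℝ, {x | ∃ t : Fin N → ℝ, (∀ i ∈ σ, t i ∈ R) ∧ x = ∑ i ∈ σ, t i • v i} =
      T '' Set.univ.pi fun _ => R := by
    intro R
    ext x
    constructor
    · rintro ⟨t, ht, rfl⟩
      exact ⟨fun i => t i, fun i _ => ht i i.2, hTs t⟩
    · rintro ⟨t, ht, rfl⟩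
      refine ⟨fun i => if hi : i ∈ σ then t ⟨i, hi⟩ else 0, fun i hi => ?_, ?_⟩
      · simpa [hi] using ht ⟨i, hi⟩ trivial
      · rw [← hTs]
        congr 1
        ext i
        simp
  have e1 : openConicalSimplex v σ = T '' Set.univ.pi fun _ => Set.Ioi 0 := image (Set.Ioi 0)
  have e2 : closedConicalSimplex v σ = T '' Set.univ.pi fun _ => Set.Ici 0 := image (Set.Ici 0)
  rw [e1, e2, (LinearMap.isClosedEmbedding_of_injective hT).closure_image_eq, closure_pi_set]
  simp

theorem finrank_span_openConicalSimplex (h : LinearIndepOn ℝ v (σ : Set (Fin N))) :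
    Module.finrank ℝ (Submodule.span ℝ (openConicalSimplex v σ)) = σ.card := by
  classical
  have : Submodule.span ℝ (openConicalSimplex v σ) =
      Submodule.span ℝ (Set.range fun i : σ => v i) := by
    apply le_antisymm
    · refine Submodule.span_le.2 ?_
      rintro _ ⟨t, -, rfl⟩
      exact sum_mem fun i hi => Submodule.smul_mem _ _ (Submodule.subset_span ⟨⟨i, hi⟩, rfl⟩)
    · refine Submodule.span_le.2 ?_
      rintro _ ⟨⟨i, hi⟩, rfl⟩
      have h1 : ∑ j ∈ σ, (1 : ℝ) • v j ∈ openConicalSimplex v σ :=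
        ⟨fun _ => 1, fun _ _ => one_pos, rfl⟩
      -- Doubling the coefficient of `v i` keeps the point in the open simplex, and the difference
      -- of the two points is `v i`.
      have h2 : ∑ j ∈ σ, (if j = i then (2 : ℝ) else 1) • v j ∈ openConicalSimplex v σ :=
        ⟨fun j => if j = i then (2 : ℝ) else 1, fun j _ => by beta_reduce; split_ifs <;> norm_num, rfl⟩
      have := Submodule.sub_mem (Submodule.span ℝ (openConicalSimplex v σ))
        (Submodule.subset_span h2) (Submodule.subset_span h1)
      rw [← Finset.sum_sub_distrib, Finset.sum_eq_single i] at this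
      · rw [if_pos rfl, ← sub_smul] at this
        norm_num at this
        exact this
      · intro j _ hj
        rw [if_neg hj, sub_self]
      · exact fun h => absurd hi h
  have hc := finrank_span_eq_card (R := ℝ) (b := fun i : σ => v i) h
  rw [this, hc, Fintype.card_coe]

/-- A point of the closed simplex lies in exactly one open face, the one spanned by the generators
with positive coefficient. -/
theorem ind_closedConicalSimplex (h : LinearIndepOn ℝ v (σ : Set (Fin N))) :
    ind (closedConicalSimplex v σ) = ∑ τ ∈ σ.powerset, ind (openConicalSimplex v τ) := by
  classical
  ext x
  rw [Finset.sum_apply, ind_apply]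
  have ext0 : ∀ τ ⊆ σ, ∀ t : Fin N → ℝ,
      ∑ i ∈ τ, t i • v i = ∑ i ∈ σ, (if i ∈ τ then t i else 0) • v i := by
    intro τ hτ t
    rw [← Finset.sum_subset hτ]
    · exact Finset.sum_congr rfl fun i hi => by rw [if_pos hi]
    · intro i _ hi
      rw [if_neg hi, zero_smul]
  split_ifs with hx
  · obtain ⟨t, ht, hx⟩ := hx
    rw [Finset.sum_eq_single (σ.filter fun i => 0 < t i)]
    · rw [ind_apply, if_pos]
      refine ⟨t, fun i hi => (Finset.mem_filter.1 hi).2, ?_⟩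
      rw [hx, ext0 _ (Finset.filter_subset _ _)]
      refine Finset.sum_congr rfl fun i hi => ?_
      rcases (ht i hi).lt_or_eq with h0 | h0
      · simp [hi, h0]
      · simp [← h0]
    · intro τ hτ hne
      rw [ind_apply, if_neg]
      rintro ⟨s, hs, hxs⟩
      apply hne
      have hτ' := Finset.mem_powerset.1 hτ
      have := coeff_eq h (hx.symm.trans (hxs.trans (ext0 τ hτ' s)))
      ext i
      simp only [Finset.mem_filter]
      constructor
      · intro hi
        refine ⟨hτ' hi, ?_⟩
        rw [this i (hτ' hi), if_pos hi]
        exact hs i hi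
      · rintro ⟨hi, h0⟩
        by_contra hi'
        rw [this i hi, if_neg hi'] at h0
        exact lt_irrefl _ h0
    · exact fun h => absurd (Finset.mem_powerset.2 (Finset.filter_subset _ _)) h
  · refine (Finset.sum_eq_zero fun τ hτ => ?_).symm
    rw [ind_apply, if_neg]
    rintro ⟨s, hs, rfl⟩
    refine hx ⟨_, fun i _ => ?_, ext0 τ (Finset.mem_powerset.1 hτ) s⟩
    split_ifs with hi
    · exact (hs i hi).le
    · exact le_rfl

theorem interior_openSimplex (h : LinearIndepOn ℝ v (σ : Set (Fin N))) :
    interiorMap (E n) (openSimplex v σ) =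
      (-1 : ℤ) ^ σ.card • ∑ τ ∈ σ.powerset, openSimplex v τ := by
  apply Subtype.ext
  rw [openSimplex_eq h, interior_apply (isOpenCell_openConicalSimplex v σ h),
    finrank_span_openConicalSimplex h, closure_openConicalSimplex h, ind_closedConicalSimplex h,
    AddSubgroup.coe_zsmul, AddSubgroup.val_finsetSum]
  congr 1
  refine Finset.sum_congr rfl fun τ hτ => ?_
  rw [openSimplex_val (h.mono (Finset.coe_subset.2 (Finset.mem_powerset.1 hτ)))]

end Simplices

/-! ### Cones in `ℝⁿ⁺¹` as regions above, on and below graphs over `ℝⁿ` -/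

section Generation

/-- The group generated by the open conical simplices. -/
def simplexSpan (n : ℕ) : AddSubgroup (E n → ℤ) :=
  AddSubgroup.closure {f | ∃ (k : ℕ) (v : Fin k → E n), LinearIndependent ℝ v ∧
    f = ind (openConicalSimplex v Finset.univ)}

variable {n : ℕ}

theorem ind_linear_pos_mem (l : E n →ₗ[ℝ] ℝ) : ind {y | 0 < l y} ∈ coneGroup (E n) := by
  obtain ⟨w, hw⟩ : ∃ w : E n, ∀ x, inner ℝ w x = l x :=
    ⟨(InnerProductSpace.toDual ℝ (E n)).symm (LinearMap.toContinuousLinearMap l), fun x => by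
      rw [InnerProductSpace.toDual_symm_apply]; rfl⟩
  have := ind_cell_mem (∅ : Finset (E n)) {w}
  simpa [cell, hw] using this

theorem ind_linear_nonneg_mem (l : E n →ₗ[ℝ] ℝ) : ind {y | 0 ≤ l y} ∈ coneGroup (E n) := by
  have : ind {y | 0 ≤ l y} = ind Set.univ - ind {y | 0 < (-l) y} := by
    classical
    ext y
    by_cases h : 0 ≤ l y
    · simp [ind_apply, h, h.not_gt]
    · simp [ind_apply, h, lt_of_not_ge h]
  rw [this]
  exact sub_mem isConvexCone_univ.isCone.ind_mem (ind_linear_pos_mem _)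

/-- The group generated by the products of elements of the cone group of `ℝⁿ` with the parts of
`ℝⁿ⁺¹` above, on, and below the graphs of linear functions. -/
def bandSpan (n : ℕ) : AddSubgroup (E (n + 1) → ℤ) :=
  AddSubgroup.closure
    ({F | ∃ g ∈ coneGroup (E n), ∃ f : E n →ₗ[ℝ] ℝ,
        F = fun x => g (fstE n 1 x) * if f (fstE n 1 x) < x (Fin.last n) then 1 else 0} ∪
     {F | ∃ g ∈ coneGroup (E n), ∃ f : E n →ₗ[ℝ] ℝ,
        F = fun x => g (fstE n 1 x) * if x (Fin.last n) = f (fstE n 1 x) then 1 else 0} ∪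
     {F | ∃ g ∈ coneGroup (E n), ∃ f : E n →ₗ[ℝ] ℝ,
        F = fun x => g (fstE n 1 x) * if x (Fin.last n) < f (fstE n 1 x) then 1 else 0})

theorem above_mem {g : E n → ℤ} (hg : g ∈ coneGroup (E n)) (f : E n →ₗ[ℝ] ℝ) :
    (fun x : E (n + 1) => g (fstE n 1 x) * if f (fstE n 1 x) < x (Fin.last n) then 1 else 0) ∈
      bandSpan n :=
  AddSubgroup.subset_closure (Or.inl (Or.inl ⟨g, hg, f, rfl⟩))

theorem on_mem {g : E n → ℤ} (hg : g ∈ coneGroup (E n)) (f : E n →ₗ[ℝ] ℝ) :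
    (fun x : E (n + 1) => g (fstE n 1 x) * if x (Fin.last n) = f (fstE n 1 x) then 1 else 0) ∈
      bandSpan n :=
  AddSubgroup.subset_closure (Or.inl (Or.inr ⟨g, hg, f, rfl⟩))

theorem below_mem {g : E n → ℤ} (hg : g ∈ coneGroup (E n)) (f : E n →ₗ[ℝ] ℝ) :
    (fun x : E (n + 1) => g (fstE n 1 x) * if x (Fin.last n) < f (fstE n 1 x) then 1 else 0) ∈
      bandSpan n :=
  AddSubgroup.subset_closure (Or.inr ⟨g, hg, f, rfl⟩)

theorem mul_base_mem {F : E (n + 1) → ℤ} (hF : F ∈ bandSpan n) {q : E n → ℤ}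
    (hq : q ∈ coneGroup (E n)) : (fun x => F x * q (fstE n 1 x)) ∈ bandSpan n := by
  let r : (E (n + 1) → ℤ) →+ (E (n + 1) → ℤ) := AddMonoidHom.mulRight fun x => q (fstE n 1 x)
  have : bandSpan n ≤ (bandSpan n).comap r := by
    refine (AddSubgroup.closure_le _).2 ?_
    rintro F ((⟨g, hg, f, rfl⟩ | ⟨g, hg, f, rfl⟩) | ⟨g, hg, f, rfl⟩) <;>
      change r _ ∈ bandSpan n
    · convert above_mem (mul_mem_coneGroup hg hq) f using 1
      funext x
      exact mul_right_comm _ _ _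
    · convert on_mem (mul_mem_coneGroup hg hq) f using 1
      funext x
      exact mul_right_comm _ _ _
    · convert below_mem (mul_mem_coneGroup hg hq) f using 1
      funext x
      exact mul_right_comm _ _ _
  exact this hF

/-- Splitting the base by the sign of `f - f'` decides which of the two graphs bounds the
intersection. The splitting itself is absorbed by the base factor `g`. -/
theorem mul_ge_mem {F : E (n + 1) → ℤ} (hF : F ∈ bandSpan n) (f' : E n →ₗ[ℝ] ℝ) :
    (fun x => F x * if f' (fstE n 1 x) ≤ x (Fin.last n) then 1 else 0) ∈ bandSpan n := by
  classical
  let r : (E (n + 1) → ℤ) →+ (E (n + 1) → ℤ) := AddMonoidHom.mulRight fun x =>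
    if f' (fstE n 1 x) ≤ x (Fin.last n) then 1 else 0
  have : bandSpan n ≤ (bandSpan n).comap r := by
    refine (AddSubgroup.closure_le _).2 ?_
    rintro F ((⟨g, hg, f, rfl⟩ | ⟨g, hg, f, rfl⟩) | ⟨g, hg, f, rfl⟩) <;>
      change r _ ∈ bandSpan n
    · have h1 := mul_mem_coneGroup hg (ind_linear_nonneg_mem (f - f'))
      have h2 := mul_mem_coneGroup hg (ind_linear_pos_mem (f' - f))
      convert add_mem (above_mem h1 f) (add_mem (above_mem h2 f') (on_mem h2 f')) using 1
      funext x
      simp only [r, AddMonoidHom.coe_mulRight, Pi.mul_apply, Pi.add_apply, ind_apply, LinearMap.sub_apply,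
        Set.mem_ofPred_eq, sub_nonneg, sub_pos]
      split_ifs <;> first | ring1 | (exfalso; order)
    · have h1 := mul_mem_coneGroup hg (ind_linear_nonneg_mem (f - f'))
      convert on_mem h1 f using 1
      funext x
      simp only [r, AddMonoidHom.coe_mulRight, Pi.mul_apply, ind_apply, LinearMap.sub_apply,
        Set.mem_ofPred_eq, sub_nonneg]
      split_ifs <;> first | ring1 | (exfalso; order)
    · have h1 := mul_mem_coneGroup hg (ind_linear_pos_mem (f - f'))
      convert sub_mem (below_mem h1 f) (below_mem h1 f') using 1
      funext x
      simp only [r, AddMonoidHom.coe_mulRight, Pi.mul_apply, Pi.sub_apply, ind_apply, LinearMap.sub_apply,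
        Set.mem_ofPred_eq, sub_pos]
      split_ifs <;> first | ring1 | (exfalso; order)
  exact this hF

theorem mul_le_mem {F : E (n + 1) → ℤ} (hF : F ∈ bandSpan n) (f' : E n →ₗ[ℝ] ℝ) :
    (fun x => F x * if x (Fin.last n) ≤ f' (fstE n 1 x) then 1 else 0) ∈ bandSpan n := by
  classical
  let r : (E (n + 1) → ℤ) →+ (E (n + 1) → ℤ) := AddMonoidHom.mulRight fun x =>
    if x (Fin.last n) ≤ f' (fstE n 1 x) then 1 else 0
  have : bandSpan n ≤ (bandSpan n).comap r := by
    refine (AddSubgroup.closure_le _).2 ?_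
    rintro F ((⟨g, hg, f, rfl⟩ | ⟨g, hg, f, rfl⟩) | ⟨g, hg, f, rfl⟩) <;>
      change r _ ∈ bandSpan n
    · have h1 := mul_mem_coneGroup hg (ind_linear_pos_mem (f' - f))
      convert sub_mem (above_mem h1 f) (above_mem h1 f') using 1
      funext x
      simp only [r, AddMonoidHom.coe_mulRight, Pi.mul_apply, Pi.sub_apply, ind_apply, LinearMap.sub_apply,
        Set.mem_ofPred_eq, sub_pos]
      split_ifs <;> first | ring1 | (exfalso; order)
    · have h1 := mul_mem_coneGroup hg (ind_linear_nonneg_mem (f' - f))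
      convert on_mem h1 f using 1
      funext x
      simp only [r, AddMonoidHom.coe_mulRight, Pi.mul_apply, ind_apply, LinearMap.sub_apply,
        Set.mem_ofPred_eq, sub_nonneg]
      split_ifs <;> first | ring1 | (exfalso; order)
    · have h1 := mul_mem_coneGroup hg (ind_linear_nonneg_mem (f' - f))
      have h2 := mul_mem_coneGroup hg (ind_linear_pos_mem (f - f'))
      convert add_mem (below_mem h1 f) (add_mem (below_mem h2 f') (on_mem h2 f')) using 1
      funext x
      simp only [r, AddMonoidHom.coe_mulRight, Pi.mul_apply, Pi.add_apply, ind_apply, LinearMap.sub_apply,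
        Set.mem_ofPred_eq, sub_nonneg, sub_pos]
      split_ifs <;> first | ring1 | (exfalso; order)
  exact this hF

theorem inner_eq_fst_add_last (w x : E (n + 1)) :
    inner ℝ w x = inner ℝ (fstE n 1 w) (fstE n 1 x) + w (Fin.last n) * x (Fin.last n) := by
  simp only [PiLp.inner_apply, RCLike.inner_apply, conj_trivial, Fin.sum_univ_castSucc]
  rw [mul_comm (x (Fin.last n))]
  rfl

/-- According to the sign of the last coordinate of `w`, the half-space is the region weakly below a
graph, a cylinder over a half-space of `ℝⁿ`, or the region weakly above a graph. -/
theorem mul_halfspace_mem {F : E (n + 1) → ℤ} (hF : F ∈ bandSpan n) (w : E (n + 1)) :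
    F * ind {x | 0 ≤ inner ℝ w x} ∈ bandSpan n := by
  classical
  let l : E n →ₗ[ℝ] ℝ := innerₛₗ ℝ (fstE n 1 w)
  have hl : ∀ y, l y = inner ℝ (fstE n 1 w) y := fun _ => rfl
  rcases lt_trichotomy (w (Fin.last n)) 0 with h | h | h
  · convert mul_le_mem hF (-(w (Fin.last n))⁻¹ • l) using 1
    funext x
    simp only [Pi.mul_apply, ind_apply, Set.mem_ofPred_eq, inner_eq_fst_add_last w x, ← hl,
      LinearMap.smul_apply, smul_eq_mul]
    congr 2
    rw [neg_mul, ← mul_neg, ← div_eq_inv_mul, le_div_iff_of_neg h]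
    exact propext ⟨fun _ => by linarith, fun _ => by linarith⟩
  · convert mul_base_mem hF (ind_linear_nonneg_mem l) using 1
    funext x
    simp only [Pi.mul_apply, ind_apply, Set.mem_ofPred_eq, inner_eq_fst_add_last w x, ← hl, h,
      zero_mul, add_zero]
  · convert mul_ge_mem hF (-(w (Fin.last n))⁻¹ • l) using 1
    funext x
    simp only [Pi.mul_apply, ind_apply, Set.mem_ofPred_eq, inner_eq_fst_add_last w x, ← hl,
      LinearMap.smul_apply, smul_eq_mul]
    congr 2
    rw [neg_mul, ← mul_neg, ← div_eq_inv_mul, div_le_iff₀ h]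
    exact propext ⟨fun _ => by linarith, fun _ => by linarith⟩

theorem coneGroup_le_bandSpan : coneGroup (E (n + 1)) ≤ bandSpan n := by
  classical
  refine coneGroup_le ?_
  rintro C ⟨S, rfl⟩
  induction S using Finset.induction_on with
  | empty =>
    have h1 : ind Set.univ ∈ coneGroup (E n) := isConvexCone_univ.isCone.ind_mem
    convert add_mem (above_mem h1 0) (add_mem (on_mem h1 0) (below_mem h1 0)) using 1
    funext x
    simp only [Pi.add_apply, ind_apply, LinearMap.zero_apply]
    rcases lt_trichotomy (x (Fin.last n)) 0 with h | h | h
    · simp [h, h.ne, h.not_gt]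
    · simp [h]
    · simp [h, h.ne', h.not_gt]
  | insert w S hw ih =>
    convert mul_halfspace_mem ih w using 1
    rw [← ind_inter]
    congr 1
    ext x
    simp [and_comm]

end Generation

/-! ### Generation by open conical simplices, and `I² = 1` -/

section Generation

variable {n : ℕ}

/-- The point of `ℝⁿ⁺¹` with given projections to `ℝⁿ` and `ℝ`, as a linear map. -/
noncomputable def snocE (n : ℕ) : E n × ℝ →ₗ[ℝ] E (n + 1) where
  toFun p := WithLp.toLp 2 (Fin.snoc (α := fun _ => ℝ) p.1 p.2)
  map_add' p q := by
    ext k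
    refine Fin.lastCases ?_ (fun k => ?_) k <;> simp
  map_smul' a p := by
    ext k
    refine Fin.lastCases ?_ (fun k => ?_) k <;> simp

theorem fstE_snocE (p : E n × ℝ) : fstE n 1 (snocE n p) = p.1 := by
  ext k
  rw [fstE_apply]
  exact Fin.snoc_castSucc (α := fun _ => ℝ) _ _ k

theorem snocE_last (p : E n × ℝ) : snocE n p (Fin.last n) = p.2 :=
  Fin.snoc_last (α := fun _ => ℝ) _ _

theorem snocE_fstE (x : E (n + 1)) : snocE n (fstE n 1 x, x (Fin.last n)) = x := by
  ext k
  refine Fin.lastCases ?_ (fun k => ?_) k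
  · exact snocE_last _
  · exact Fin.snoc_castSucc (α := fun _ => ℝ) _ _ k

/-- The linear section of the projection `ℝⁿ⁺¹ → ℝⁿ` whose image is the graph of `f`. -/
noncomputable def graphE (f : E n →ₗ[ℝ] ℝ) : E n →ₗ[ℝ] E (n + 1) :=
  snocE n ∘ₗ LinearMap.id.prod f

theorem graphE_apply (f : E n →ₗ[ℝ] ℝ) (y : E n) : graphE f y = snocE n (y, f y) := rfl

theorem fstE_graphE (f : E n →ₗ[ℝ] ℝ) (y : E n) : fstE n 1 (graphE f y) = y := fstE_snocE _

theorem mem_openConicalSimplex_univ {k m : ℕ} {v : Fin k → E m} {x : E m} :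
    x ∈ openConicalSimplex v Finset.univ ↔ ∃ t : Fin k → ℝ, (∀ i, 0 < t i) ∧ x = ∑ i, t i • v i := by
  simp [openConicalSimplex]

/-- The part of a graph over an open simplex is again an open simplex, with the generators lifted to
the graph. -/
theorem simplex_on_mem {k : ℕ} {v : Fin k → E n} (hv : LinearIndependent ℝ v) (f : E n →ₗ[ℝ] ℝ) :
    (fun x : E (n + 1) => ind (openConicalSimplex v Finset.univ) (fstE n 1 x) *
      if x (Fin.last n) = f (fstE n 1 x) then 1 else 0) ∈ simplexSpan (n + 1) := by
  classical
  refine AddSubgroup.subset_closure ⟨k, graphE f ∘ v, ?_, ?_⟩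
  · refine hv.map' _ (LinearMap.ker_eq_bot.2 fun x y h => ?_)
    rw [← fstE_graphE f x, h, fstE_graphE]
  · funext x
    have : (fstE n 1 x ∈ openConicalSimplex v Finset.univ ∧ x (Fin.last n) = f (fstE n 1 x)) ↔
        x ∈ openConicalSimplex (graphE f ∘ v) Finset.univ := by
      simp only [mem_openConicalSimplex_univ, Function.comp_apply, ← map_smul, ← map_sum]
      constructor
      · rintro ⟨⟨t, ht, h⟩, hx⟩
        refine ⟨t, ht, ?_⟩
        rw [← h, graphE_apply, ← hx, snocE_fstE]
      · rintro ⟨t, ht, h⟩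
        have h' : fstE n 1 x = ∑ i, t i • v i := by rw [h, fstE_graphE]
        refine ⟨⟨t, ht, h'⟩, ?_⟩
        rw [h', h, graphE_apply, snocE_last]
    rw [ind_apply, ind_apply, ite_mul, zero_mul, one_mul, ← ite_and]
    exact if_congr this rfl rfl

/-- The region over an open simplex on one side of a graph is an open simplex with one more
generator, the vertical vector of height `ε`. The sign of `ε` selects the side, so one statement
serves above and below. -/
theorem simplex_off_mem {k : ℕ} {v : Fin k → E n} (hv : LinearIndependent ℝ v)
    (f : E n →ₗ[ℝ] ℝ) {ε : ℝ} (hε : ε ≠ 0) :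
    (fun x : E (n + 1) => ind (openConicalSimplex v Finset.univ) (fstE n 1 x) *
      if 0 < ε * (x (Fin.last n) - f (fstE n 1 x)) then 1 else 0) ∈ simplexSpan (n + 1) := by
  classical
  have hfst : fstE n 1 (snocE n (0, ε)) = 0 := fstE_snocE _
  refine AddSubgroup.subset_closure ⟨k + 1, Fin.cons (snocE n (0, ε)) (graphE f ∘ v), ?_, ?_⟩
  · rw [linearIndependent_finCons]
    constructor
    · refine hv.map' _ (LinearMap.ker_eq_bot.2 fun x y h => ?_)
      rw [← fstE_graphE f x, h, fstE_graphE]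
    · intro h
      have h1 : Submodule.span ℝ (Set.range (graphE f ∘ v)) ≤ LinearMap.range (graphE f) :=
        Submodule.span_le.2 (by rintro _ ⟨i, rfl⟩; exact ⟨v i, rfl⟩)
      obtain ⟨y, hy⟩ := h1 h
      have h2 : y = 0 := by rw [← hfst, ← hy, fstE_graphE]
      rw [h2, map_zero] at hy
      have h3 := snocE_last ((0, ε) : E n × ℝ)
      rw [← hy] at h3
      exact hε h3.symm
  · funext x
    have hs : ∀ s : ℝ, s • snocE n (0, ε) = snocE n (0, s * ε) := fun s => by
      rw [← map_smul]; simp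
    have : (fstE n 1 x ∈ openConicalSimplex v Finset.univ ∧
        0 < ε * (x (Fin.last n) - f (fstE n 1 x))) ↔
        x ∈ openConicalSimplex (Fin.cons (snocE n (0, ε)) (graphE f ∘ v)) Finset.univ := by
      simp only [mem_openConicalSimplex_univ, Fin.sum_univ_succ, Fin.cons_zero, Fin.cons_succ,
        Function.comp_apply, Fin.forall_fin_succ]
      constructor
      · rintro ⟨⟨t, ht, h⟩, hx⟩
        -- The coefficient of the vertical generator is the signed height over the graph, measured
        -- in units of `ε`.
        refine ⟨Fin.cons ((x (Fin.last n) - f (fstE n 1 x)) / ε) t, ⟨?_, ?_⟩, ?_⟩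
        · rw [Fin.cons_zero]
          rcases hε.lt_or_gt with h0 | h0
          · exact div_pos_of_neg_of_neg (by nlinarith) h0
          · exact div_pos (pos_of_mul_pos_right hx h0.le) h0
        · simpa using ht
        · simp only [Fin.cons_zero, Fin.cons_succ, ← map_smul (graphE f), ← map_sum, ← h]
          rw [hs, div_mul_cancel₀ _ hε, graphE_apply, ← map_add]
          conv_lhs => rw [← snocE_fstE x]
          simp
      · rintro ⟨t, ⟨ht0, ht⟩, h⟩
        simp only [← map_smul (graphE f), ← map_sum] at h
        have h' : fstE n 1 x = ∑ i : Fin k, t i.succ • v i := by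
          rw [h, map_add, map_smul, hfst, fstE_graphE, smul_zero, zero_add]
        refine ⟨⟨fun i => t i.succ, ht, h'⟩, ?_⟩
        have h2 : x (Fin.last n) = t 0 * ε + f (fstE n 1 x) := by
          rw [h', h, hs, graphE_apply, ← map_add, snocE_last]; rfl
        rw [h2, add_sub_cancel_right]
        have := mul_pos ht0 (mul_self_pos.2 hε)
        linarith
    rw [ind_apply, ind_apply, ite_mul, zero_mul, one_mul, ← ite_and]
    exact if_congr this rfl rfl

/-- The cone group of `ℝⁿ` is generated by the open conical simplices. -/
theorem coneGroup_le_simplexSpan : ∀ n, coneGroup (E n) ≤ simplexSpan n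
  | 0 => by
    refine coneGroup_le ?_
    rintro C ⟨S, rfl⟩
    refine AddSubgroup.subset_closure ⟨0, Fin.elim0, linearIndependent_empty_type, ?_⟩
    congr 1
    ext x
    simp [openConicalSimplex, Subsingleton.elim x 0]
  | n + 1 => by
    -- The restricted cylinder depends additively on `g`, so the induction hypothesis reduces each
    -- band to the case where `g` is the characteristic function of an open simplex.
    have lift : ∀ (p : E (n + 1) → Prop) [DecidablePred p],
        (∀ (k : ℕ) (v : Fin k → E n), LinearIndependent ℝ v →
          (fun x : E (n + 1) => ind (openConicalSimplex v Finset.univ) (fstE n 1 x) *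
            if p x then 1 else 0) ∈ simplexSpan (n + 1)) →
        ∀ g ∈ coneGroup (E n), (fun x : E (n + 1) => g (fstE n 1 x) * if p x then 1 else 0) ∈
          simplexSpan (n + 1) := by
      intro p _ hp g hg
      let r : (E n → ℤ) →+ (E (n + 1) → ℤ) := AddMonoidHom.mk'
        (fun g x => g (fstE n 1 x) * if p x then 1 else 0)
        (fun g g' => funext fun x => add_mul _ _ _)
      have : simplexSpan n ≤ (simplexSpan (n + 1)).comap r := by
        refine (AddSubgroup.closure_le _).2 ?_
        rintro _ ⟨k, v, hv, rfl⟩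
        exact hp k v hv
      exact this (coneGroup_le_simplexSpan n hg)
    refine coneGroup_le_bandSpan.trans ((AddSubgroup.closure_le _).2 ?_)
    rintro F ((⟨g, hg, f, rfl⟩ | ⟨g, hg, f, rfl⟩) | ⟨g, hg, f, rfl⟩)
    · refine lift _ (fun k v hv => ?_) g hg
      simpa using simplex_off_mem hv f one_ne_zero
    · exact lift _ (fun k v hv => simplex_on_mem hv f) g hg
    · refine lift _ (fun k v hv => ?_) g hg
      simpa using simplex_off_mem hv f (neg_ne_zero.2 one_ne_zero)

/-- A subgroup of the cone group that contains the open conical simplices is everything. -/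
theorem mem_of_openSimplex_mem {H : AddSubgroup (coneGroup (E n))}
    (h : ∀ (k : ℕ) (v : Fin k → E n), LinearIndependent ℝ v → openSimplex v Finset.univ ∈ H)
    (f : coneGroup (E n)) : f ∈ H := by
  have : simplexSpan n ≤ H.map (coneGroup (E n)).subtype := by
    refine (AddSubgroup.closure_le _).2 ?_
    rintro _ ⟨k, v, hv, rfl⟩
    exact ⟨_, h k v hv, openSimplex_val (by simpa [linearIndepOn_univ_iff] using hv)⟩
  obtain ⟨g, hg, hgf⟩ := this (coneGroup_le_simplexSpan n f.2)
  rwa [← Subtype.ext hgf]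

/-- Möbius inversion on the lattice of subsets: the signs of the `τ` between `ρ` and `σ` cancel
unless `ρ = σ`. Applied to faces, it is the identity `I² = 1`. -/
theorem sum_powerset_sum_powerset {N : ℕ} {A : Type*} [AddCommGroup A] (F : Finset (Fin N) → A)
    (σ : Finset (Fin N)) :
    ∑ τ ∈ σ.powerset, (-1 : ℤ) ^ τ.card • ∑ ρ ∈ τ.powerset, F ρ = (-1 : ℤ) ^ σ.card • F σ := by
  classical
  induction σ using Finset.induction_on generalizing F with
  | empty => simp
  | insert i σ hi ih =>
    rw [Finset.sum_powerset_insert hi]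
    have : ∀ τ ∈ σ.powerset, (-1 : ℤ) ^ (insert i τ).card • ∑ ρ ∈ (insert i τ).powerset, F ρ =
        -((-1 : ℤ) ^ τ.card • ∑ ρ ∈ τ.powerset, F ρ) -
          ((-1 : ℤ) ^ τ.card • ∑ ρ ∈ τ.powerset, F (insert i ρ)) := by
      intro τ hτ
      have hi' : i ∉ τ := fun h => hi (Finset.mem_powerset.1 hτ h)
      rw [Finset.sum_powerset_insert hi', Finset.card_insert_of_notMem hi', pow_succ, mul_neg_one,
        neg_smul, smul_add]
      abel
    rw [Finset.sum_congr rfl this, Finset.sum_sub_distrib, Finset.sum_neg_distrib, ih, ih,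
      Finset.card_insert_of_notMem hi, pow_succ, mul_neg_one, neg_smul]
    abel

theorem interior_interior (f : coneGroup (E n)) :
    interiorMap (E n) (interiorMap (E n) f) = f := by
  refine mem_of_openSimplex_mem (H := ((interiorMap (E n)).comp (interiorMap (E n))).eqLocus
    (AddMonoidHom.id _)) (fun k v hv => ?_) f
  have h : LinearIndepOn ℝ v ((Finset.univ : Finset (Fin k)) : Set (Fin k)) := by
    simpa [linearIndepOn_univ_iff] using hv
  change interiorMap (E n) (interiorMap (E n) (openSimplex v Finset.univ)) =
    openSimplex v Finset.univ
  rw [interior_openSimplex h, map_zsmul, map_sum, Finset.sum_congr rfl fun τ hτ =>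
    interior_openSimplex (h.mono (Finset.coe_subset.2 (Finset.mem_powerset.1 hτ))),
    sum_powerset_sum_powerset, smul_smul, ← mul_pow]
  simp

end Generation

/-! ### Push forward along isometric embeddings, and stabilization -/

section Push

variable {V : Type*} [NormedAddCommGroup V] [InnerProductSpace ℝ V] [FiniteDimensional ℝ V]

/-- Push forward along an isometric embedding, as a homomorphism of cone groups. -/
noncomputable def pushCone {n : ℕ} (φ : E n →ₗᵢ[ℝ] V) : coneGroup (E n) →+ coneGroup V :=
  AddMonoidHom.mk' (fun g => ⟨push φ g, (push_mem φ g).1⟩) fun g h => Subtype.ext (push_add φ g h)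

theorem pushCone_mem {n : ℕ} (φ : E n →ₗᵢ[ℝ] V) (g : coneGroup (E n)) :
    pushCone φ g ∈ coneGroupLE V n := (push_mem φ g).2

theorem pushCone_apply {n : ℕ} (φ : E n →ₗᵢ[ℝ] V) (g : coneGroup (E n)) (x : E n) :
    (pushCone φ g).1 (φ x) = g.1 x := push_apply φ g x

theorem pushCone_apply_of_notMem {n : ℕ} (φ : E n →ₗᵢ[ℝ] V) (g : coneGroup (E n)) {y : V}
    (hy : y ∉ LinearMap.range φ.toLinearMap) : (pushCone φ g).1 y = 0 :=
  push_apply_of_notMem φ g hy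

theorem pushCone_eq_iff {n : ℕ} (φ : E n →ₗᵢ[ℝ] V) (g : coneGroup (E n)) (f : coneGroup V) :
    pushCone φ g = f ↔ (∀ x, g.1 x = f.1 (φ x)) ∧
      ∀ y, y ∉ LinearMap.range φ.toLinearMap → f.1 y = 0 := by
  constructor
  · rintro rfl
    exact ⟨fun x => (pushCone_apply φ g x).symm, fun y => pushCone_apply_of_notMem φ g⟩
  · rintro ⟨h1, h2⟩
    apply Subtype.ext
    funext y
    by_cases hy : y ∈ LinearMap.range φ.toLinearMap
    · obtain ⟨x, rfl⟩ := hy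
      exact (pushCone_apply φ g x).trans (h1 x)
    · rw [pushCone_apply_of_notMem φ g hy, h2 y hy]

theorem descend_pushCone {n : ℕ} (hV : n ≤ Module.finrank ℝ V) (φ : E n →ₗᵢ[ℝ] V)
    (g : coneGroup (E n)) : descend hV ⟨pushCone φ g, pushCone_mem φ g⟩ = cls n g :=
  descend_push hV φ g

/-- The involution is intrinsic: an isometric embedding preserves the dimension of a cell and
commutes with its closure. -/
theorem interior_pushCone {n : ℕ} (φ : E n →ₗᵢ[ℝ] V) (g : coneGroup (E n)) :
    interiorMap V (pushCone φ g) = pushCone φ (interiorMap (E n) g) := by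
  classical
  suffices (interiorMap V).comp (pushCone φ) = (pushCone φ).comp (interiorMap (E n)) from
    DFunLike.congr_fun this g
  refine coneGroup_hom_ext fun U hU => ?_
  have hinj : Set.InjOn φ.toLinearMap U := φ.injective.injOn
  have hU' := hU.image φ.toLinearMap hinj
  have e : pushCone φ ⟨ind U, hU.ind_mem⟩ = ⟨ind (φ.toLinearMap '' U), hU'.ind_mem⟩ := by
    rw [pushCone_eq_iff]
    constructor
    · intro x
      simp only [ind_apply]
      exact if_congr (φ.injective.mem_set_image (s := U)).symm rfl rfl
    · intro y hy
      change ind _ y = 0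
      rw [ind_apply, if_neg]
      rintro ⟨x, -, rfl⟩
      exact hy ⟨x, rfl⟩
  have hcl : closure (φ.toLinearMap '' U) = φ.toLinearMap '' closure U :=
    φ.isometry.isClosedEmbedding.closure_image_eq U
  symm
  rw [AddMonoidHom.comp_apply, AddMonoidHom.comp_apply, e, pushCone_eq_iff, interior_apply hU',
    interior_apply hU, hcl, finrank_span_image _ hU hinj]
  constructor
  · intro x
    simp only [Pi.smul_apply, ind_apply]
    exact congrArg _ (if_congr (φ.injective.mem_set_image (s := closure U)).symm rfl rfl)
  · intro y hy
    rw [Pi.smul_apply, ind_apply, if_neg, smul_zero]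
    rintro ⟨x, -, rfl⟩
    exact hy ⟨x, rfl⟩

/-- The elements of dimension at most `n` are generated by push forwards from `ℝⁿ`. -/
theorem mem_of_pushCone_mem {n : ℕ} (hV : n ≤ Module.finrank ℝ V) {H : AddSubgroup (coneGroup V)}
    (h : ∀ (φ : E n →ₗᵢ[ℝ] V) g, pushCone φ g ∈ H) {f : coneGroup V} (hf : f ∈ coneGroupLE V n) :
    f ∈ H := by
  have : AddSubgroup.closure (Set.range
      fun p : (E n →ₗᵢ[ℝ] V) × coneGroup (E n) => push p.1 p.2) ≤ H.map (coneGroup V).subtype := by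
    refine (AddSubgroup.closure_le _).2 ?_
    rintro _ ⟨p, rfl⟩
    exact ⟨_, h p.1 p.2, rfl⟩
  obtain ⟨g, hg, hgf⟩ := this (coneGroupLE_le hV hf)
  rwa [← Subtype.ext hgf]

theorem coneGroupLE_hom_ext {n : ℕ} (hV : n ≤ Module.finrank ℝ V) {A : Type*} [AddCommGroup A]
    {ρ ρ' : coneGroupLE V n →+ A} (h : ∀ (φ : E n →ₗᵢ[ℝ] V) g,
      ρ ⟨pushCone φ g, pushCone_mem φ g⟩ = ρ' ⟨pushCone φ g, pushCone_mem φ g⟩) : ρ = ρ' := by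
  ext ⟨f, hf⟩
  obtain ⟨g, hg, rfl⟩ := mem_of_pushCone_mem hV
    (H := (ρ.eqLocus ρ').map (coneGroupLE V n).subtype) (fun φ g => ⟨_, h φ g, rfl⟩) hf
  exact hg

/-- The comparison is made in the direct sum because `L n` and `L m` are different types when `n =
m` is only propositional. It is needed to exchange the factors of a product. -/
theorem descend_congr_equiv {V' : Type*} [NormedAddCommGroup V'] [InnerProductSpace ℝ V']
    [FiniteDimensional ℝ V'] {n m : ℕ} (hnm : n = m) (hV : n ≤ Module.finrank ℝ V)
    (hV' : m ≤ Module.finrank ℝ V') (e : V ≃ₗᵢ[ℝ] V') {f : coneGroup V'}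
    (hf : f ∈ coneGroupLE V' m) : ∃ h : comap e.toLinearMap f ∈ coneGroupLE V n,
      DirectSum.of L n (descend hV ⟨comap e.toLinearMap f, h⟩) =
        DirectSum.of L m (descend hV' ⟨f, hf⟩) := by
  subst hnm
  have push : ∀ (φ : E n →ₗᵢ[ℝ] V') g, comap e.toLinearMap (pushCone φ g) =
      pushCone (e.symm.toLinearIsometry.comp φ) g := by
    intro φ g
    symm
    rw [pushCone_eq_iff]
    constructor
    · intro x
      change _ = (pushCone φ g).1 (e (e.symm (φ x)))
      rw [e.apply_symm_apply, pushCone_apply]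
    · intro y hy
      refine pushCone_apply_of_notMem φ g ?_
      rintro ⟨x, hx⟩
      refine hy ⟨x, ?_⟩
      change e.symm (φ x) = y
      rw [e.symm_apply_eq]
      exact hx
  have mem : coneGroupLE V' n ≤ (coneGroupLE V n).comap (comap e.toLinearMap) := fun f hf =>
    mem_of_pushCone_mem hV' (fun φ g => by
      rw [AddSubgroup.mem_comap, push]; exact pushCone_mem _ _) hf
  refine ⟨mem hf, congrArg _ ?_⟩
  let ρ : coneGroupLE V' n →+ L n := (descend hV).comp
    (((comap e.toLinearMap).comp (coneGroupLE V' n).subtype).codRestrict (coneGroupLE V n)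
      fun x => mem x.2)
  refine DFunLike.congr_fun (?_ : ρ = descend hV') ⟨f, hf⟩
  refine coneGroupLE_hom_ext hV' fun φ g => ?_
  rw [descend_pushCone, ← descend_pushCone hV (e.symm.toLinearIsometry.comp φ)]
  exact congrArg (descend hV) (Subtype.ext (push φ g))

theorem exists_extension (S : Submodule ℝ V) (l : S →ₗᵢ[ℝ] V) :
    ∃ e : V ≃ₗᵢ[ℝ] V, ∀ x : S, e x = l x :=
  ⟨l.extend.toLinearIsometryEquiv rfl, fun x => l.extend_apply x⟩

/-- The isometry from the range of `φ` to that of `ψ` extends to an isometry of the whole space, so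
the two push forwards have the same coinvariant class. -/
theorem cls_pushCone_eq {n m : ℕ} (φ ψ : E n →ₗᵢ[ℝ] E m) (g : coneGroup (E n)) :
    cls m (pushCone φ g) = cls m (pushCone ψ g) := by
  obtain ⟨e, he⟩ := exists_extension _ (ψ.comp φ.equivRange.symm.toLinearIsometry)
  have he' : ∀ x, e (φ x) = ψ x := fun x => by
    have h1 := he (φ.equivRange x)
    change _ = ψ (φ.equivRange.symm (φ.equivRange x)) at h1
    rw [LinearIsometryEquiv.symm_apply_apply] at h1
    exact h1
  rw [← cls_comap e (pushCone ψ g)]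
  congr 1
  rw [pushCone_eq_iff]
  constructor
  · intro x
    change _ = (pushCone ψ g).1 (e (φ x))
    rw [he', pushCone_apply]
  · intro y hy
    refine pushCone_apply_of_notMem ψ g ?_
    rintro ⟨x, hx⟩
    refine hy ⟨x, e.injective ?_⟩
    exact (he' x).trans hx

theorem nonempty_isometry (n : ℕ) : Nonempty (E n →ₗᵢ[ℝ] E (n + 1)) := by
  obtain ⟨φ, -⟩ := exists_embedding (le_finrank_E n) ⊥ (by simp)
  exact ⟨φ⟩

/-- An element of dimension at most `n` that represents zero in `L n` represents zero in
`L (n + 1)`. -/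
theorem cls_eq_zero_of_descend_eq_zero {n : ℕ} {f : coneGroup (E (n + 1))}
    (hf : f ∈ coneGroupLE (E (n + 1)) n) (h : descend (le_finrank_E n) ⟨f, hf⟩ = 0) :
    cls (n + 1) f = 0 := by
  obtain ⟨φ⟩ := nonempty_isometry n
  -- Stabilization `L n → L (n + 1)`, induced by any embedding. On elements of dimension at most
  -- `n`, taking the class in `L (n + 1)` factors through it.
  let stab : L n →+ L (n + 1) := L.lift ((cls (n + 1)).comp (pushCone φ)) fun g f => by
    rw [AddMonoidHom.comp_apply, AddMonoidHom.comp_apply]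
    rw [← cls_pushCone_eq (φ.comp g.symm.toLinearIsometry) φ f]
    congr 1
    rw [pushCone_eq_iff]
    constructor
    · intro x
      change f.1 (g x) = _
      have : φ x = φ.comp g.symm.toLinearIsometry (g x) := by
        change φ x = φ (g.symm (g x)); rw [g.symm_apply_apply]
      rw [this, pushCone_apply]
    · intro y hy
      refine pushCone_apply_of_notMem _ _ ?_
      rintro ⟨x, hx⟩
      exact hy ⟨g.symm x, hx⟩
  have : (cls (n + 1)).comp (coneGroupLE (E (n + 1)) n).subtype =
      stab.comp (descend (le_finrank_E n)) := by
    refine coneGroupLE_hom_ext (le_finrank_E n) fun ψ g => ?_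
    rw [AddMonoidHom.comp_apply, AddMonoidHom.comp_apply, descend_pushCone]
    exact cls_pushCone_eq ψ φ g
  have := DFunLike.congr_fun this ⟨f, hf⟩
  rw [AddMonoidHom.comp_apply, AddMonoidHom.comp_apply, h, map_zero] at this
  exact this

theorem delta_cls {n : ℕ} (f : coneGroup (E (n + 1))) :
    delta n (cls (n + 1) f) = descend (le_finrank_E n) (boundary n f) := rfl

theorem boundary_val {n : ℕ} (f : coneGroup (E (n + 1))) :
    (boundary n f).1 = f - (-1 : ℤ) ^ (n + 1) • interiorMap (E (n + 1)) f := rfl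

/-- The involution does not see the ambient dimension, whereas the sign `(-1)ⁿ⁺¹` in the boundary
does. This mismatch is the source of the operator `𝕀 + (-1)ⁿ I`. -/
theorem delta_cls_pushCone {n : ℕ} (φ : E n →ₗᵢ[ℝ] E (n + 1)) (g : coneGroup (E n)) :
    delta n (cls (n + 1) (pushCone φ g)) = cls n g + (-1 : ℤ) ^ n • cls n (interiorMap (E n) g) := by
  have : boundary n (pushCone φ g) =
      ⟨pushCone φ (g + (-1 : ℤ) ^ n • interiorMap (E n) g), pushCone_mem _ _⟩ := by
    apply Subtype.ext
    change _ = pushCone φ (g + (-1 : ℤ) ^ n • interiorMap (E n) g)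
    rw [boundary_val, interior_pushCone, map_add, map_zsmul, pow_succ, mul_neg_one, neg_smul,
      sub_neg_eq_add]
  rw [delta_cls, this, descend_pushCone, map_add, map_zsmul]

end Push

/-! ### External products, push forward and the involution -/

section Products

/-- The product of two isometric embeddings. -/
noncomputable def prodEmbedding {i i' j j' : ℕ} (g : E i →ₗᵢ[ℝ] E i') (h : E j →ₗᵢ[ℝ] E j') :
    E (i + j) →ₗᵢ[ℝ] E (i' + j') where
  toFun x := WithLp.toLp 2 (Fin.append (g (fstE i j x)) (h (sndE i j x)))
  map_add' x y := by
    ext k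
    refine Fin.addCases (fun k => ?_) (fun k => ?_) k <;> simp
  map_smul' a x := by
    ext k
    refine Fin.addCases (fun k => ?_) (fun k => ?_) k <;> simp
  norm_map' x := by
    rw [← sq_eq_sq₀ (norm_nonneg _) (norm_nonneg _), norm_sq_split x,
      ← g.norm_map (fstE i j x), ← h.norm_map (sndE i j x)]
    refine (norm_sq_split _).trans ?_
    congr 3
    · ext k; rw [fstE_apply]; simp
    · ext k; rw [sndE_apply]; simp

variable {i i' j j' : ℕ}

theorem fstE_prodEmbedding (g : E i →ₗᵢ[ℝ] E i') (h : E j →ₗᵢ[ℝ] E j') (x : E (i + j)) :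
    fstE i' j' (prodEmbedding g h x) = g (fstE i j x) := by
  ext k; rw [fstE_apply]; simp [prodEmbedding]

theorem sndE_prodEmbedding (g : E i →ₗᵢ[ℝ] E i') (h : E j →ₗᵢ[ℝ] E j') (x : E (i + j)) :
    sndE i' j' (prodEmbedding g h x) = h (sndE i j x) := by
  ext k; rw [sndE_apply]; simp [prodEmbedding]

/-- The decomposition `ℝ^(i+j) = ℝ^i × ℝ^j`. -/
noncomputable def splitE (i j : ℕ) : E (i + j) ≃ₗ[ℝ] E i × E j where
  toLinearMap := (fstE i j).prod (sndE i j)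
  invFun p := WithLp.toLp 2 (Fin.append p.1 p.2)
  left_inv x := by
    ext k
    refine Fin.addCases (fun k => ?_) (fun k => ?_) k
    · simp [fstE_apply]
    · simp [sndE_apply]
  right_inv p := by
    refine Prod.ext ?_ ?_
    · ext k; simp [fstE_apply]
    · ext k; simp [sndE_apply]

theorem splitE_apply (x : E (i + j)) : splitE i j x = (fstE i j x, sndE i j x) := rfl

theorem extProd_pushCone (f : coneGroup (E i)) (φ : E j →ₗᵢ[ℝ] E j') (g : coneGroup (E j)) :
    extProd i j' f (pushCone φ g) =
      pushCone (prodEmbedding LinearIsometry.id φ) (extProd i j f g) := by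
  symm
  rw [pushCone_eq_iff]
  constructor
  · intro x
    change f.1 _ * g.1 _ = f.1 (fstE i j' _) * (pushCone φ g).1 (sndE i j' _)
    rw [fstE_prodEmbedding, sndE_prodEmbedding, pushCone_apply]
    rfl
  · intro y hy
    change f.1 _ * (pushCone φ g).1 _ = 0
    rw [pushCone_apply_of_notMem, mul_zero]
    rintro ⟨x, hx⟩
    refine hy ⟨(splitE i j).symm (fstE i j' y, x), (splitE i j').injective ?_⟩
    have h1 := (splitE i j).apply_symm_apply (fstE i j' y, x)
    rw [splitE_apply, Prod.ext_iff] at h1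
    rw [splitE_apply, splitE_apply]
    refine Prod.ext ?_ ?_
    · refine (fstE_prodEmbedding _ _ _).trans ?_
      exact h1.1
    · refine (sndE_prodEmbedding _ _ _).trans ?_
      exact (congrArg φ h1.2).trans hx

theorem extProd_mem_coneGroupLE (f : coneGroup (E i)) {h : coneGroup (E (j + 1))}
    (hh : h ∈ coneGroupLE (E (j + 1)) j) :
    extProd i (j + 1) f h ∈ coneGroupLE (E (i + j + 1)) (i + j) :=
  mem_of_pushCone_mem (le_finrank_E j)
    (H := (coneGroupLE (E (i + j + 1)) (i + j)).comap (extProd i (j + 1) f)) (fun φ g => by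
      rw [AddSubgroup.mem_comap, extProd_pushCone]
      exact pushCone_mem _ _) hh

/-- It suffices to test push forwards `φ_* g`, and the product of `f` with `φ_* g` is the push
forward of `f × g` along `id × φ`. -/
theorem descend_extProd (f : coneGroup (E i)) {h : coneGroup (E (j + 1))}
    (hh : h ∈ coneGroupLE (E (j + 1)) j) :
    descend (le_finrank_E (i + j)) ⟨extProd i (j + 1) f h, extProd_mem_coneGroupLE f hh⟩ =
      mulHom i j (cls i f) (descend (le_finrank_E j) ⟨h, hh⟩) := by
  let ρ : coneGroupLE (E (j + 1)) j →+ L (i + j) := (descend (le_finrank_E (i + j))).comp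
    (((extProd i (j + 1) f).comp (coneGroupLE (E (j + 1)) j).subtype).codRestrict
      (coneGroupLE (E (i + j + 1)) (i + j)) fun x => extProd_mem_coneGroupLE f x.2)
  have : ρ = (mulHom i j (cls i f)).comp (descend (le_finrank_E j)) := by
    refine coneGroupLE_hom_ext (le_finrank_E j) fun φ g => ?_
    rw [AddMonoidHom.comp_apply (mulHom i j (cls i f)), descend_pushCone, mulHom_cls,
      ← descend_pushCone (le_finrank_E (i + j))
        (prodEmbedding (i' := i) (j' := j + 1) LinearIsometry.id φ)]
    exact congrArg (descend (le_finrank_E (i + j))) (Subtype.ext (extProd_pushCone f φ g))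
  exact DFunLike.congr_fun this ⟨h, hh⟩

/-- The product of two submodules is linearly equivalent to the product of the underlying
modules. -/
def prodSubmoduleEquiv {V W : Type*} [AddCommGroup V] [Module ℝ V] [AddCommGroup W] [Module ℝ W]
    (S : Submodule ℝ V) (T : Submodule ℝ W) : S.prod T ≃ₗ[ℝ] S × T where
  toFun x := (⟨x.1.1, x.2.1⟩, ⟨x.1.2, x.2.2⟩)
  map_add' _ _ := rfl
  map_smul' _ _ := rfl
  invFun x := ⟨(x.1.1, x.2.1), x.1.2, x.2.2⟩
  left_inv _ := rfl
  right_inv _ := rfl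

/-- Both sides are biadditive, so cells suffice. The product of two cells is a cell whose dimension
is the sum of the dimensions and whose closure is the product of the closures. -/
theorem interior_extProd (f : coneGroup (E i)) (g : coneGroup (E j)) :
    interiorMap (E (i + j)) (extProd i j f g) =
      extProd i j (interiorMap (E i) f) (interiorMap (E j) g) := by
  classical
  let l : coneGroup (E i) →+ coneGroup (E j) →+ coneGroup (E (i + j)) :=
    AddMonoidHom.mk' (fun f => (interiorMap (E (i + j))).comp (extProd i j f)) fun f f' => by
      ext1 g
      change interiorMap _ (extProd i j (f + f') g) = interiorMap _ (extProd i j f g) +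
        interiorMap _ (extProd i j f' g)
      rw [map_add, AddMonoidHom.add_apply, map_add]
  let r : coneGroup (E i) →+ coneGroup (E j) →+ coneGroup (E (i + j)) :=
    AddMonoidHom.mk' (fun f => (extProd i j (interiorMap _ f)).comp (interiorMap (E j)))
      fun f f' => by
        ext1 g
        change extProd i j (interiorMap _ (f + f')) (interiorMap _ g) =
          extProd i j (interiorMap _ f) (interiorMap _ g) +
          extProd i j (interiorMap _ f') (interiorMap _ g)
        rw [map_add, map_add, AddMonoidHom.add_apply]
  suffices l = r from DFunLike.congr_fun (DFunLike.congr_fun this f) g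
  refine coneGroup_hom_ext fun U hU => coneGroup_hom_ext fun U' hU' => Subtype.ext ?_
  change (interiorMap _ (extProd i j ⟨ind U, hU.ind_mem⟩ ⟨ind U', hU'.ind_mem⟩)).1 =
    (extProd i j (interiorMap _ ⟨ind U, hU.ind_mem⟩) (interiorMap _ ⟨ind U', hU'.ind_mem⟩)).1
  have hset : splitE i j ⁻¹' (U ×ˢ U') = fstE i j ⁻¹' U ∩ sndE i j ⁻¹' U' := rfl
  have hcell : IsOpenCell (splitE i j ⁻¹' (U ×ˢ U')) ∧
      Submodule.span ℝ (splitE i j ⁻¹' (U ×ˢ U')) =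
        ((Submodule.span ℝ U).prod (Submodule.span ℝ U')).comap (splitE i j).toLinearMap := by
    obtain ⟨⟨p, hp⟩, A, B, rfl⟩ := hU
    obtain ⟨⟨q, hq⟩, A', B', rfl⟩ := hU'
    have hne : (splitE i j ⁻¹' (cell A B ×ˢ cell A' B')).Nonempty :=
      ⟨(splitE i j).symm (p, q), by
        rw [Set.mem_preimage, LinearEquiv.apply_symm_apply]; exact ⟨hp, hq⟩⟩
    have hc : splitE i j ⁻¹' (cell A B ×ˢ cell A' B') =
        cell (A.image (LinearMap.adjoint (fstE i j)) ∪ A'.image (LinearMap.adjoint (sndE i j)))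
          (B.image (LinearMap.adjoint (fstE i j)) ∪ B'.image (LinearMap.adjoint (sndE i j))) := by
      rw [hset, preimage_cell, preimage_cell, cell_inter]
    refine ⟨⟨hne, _, _, hc⟩, ?_⟩
    ext x
    rw [hc, mem_span_cell (hc ▸ hne), Submodule.mem_comap]
    change _ ↔ fstE i j x ∈ Submodule.span ℝ (cell A B) ∧ sndE i j x ∈ Submodule.span ℝ (cell A' B')
    rw [mem_span_cell ⟨p, hp⟩, mem_span_cell ⟨q, hq⟩, Finset.forall_mem_union,
      Finset.forall_mem_image, Finset.forall_mem_image]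
    simp only [LinearMap.adjoint_inner_left]
  obtain ⟨hc, hspan⟩ := hcell
  have e : extProd i j ⟨ind U, hU.ind_mem⟩ ⟨ind U', hU'.ind_mem⟩ =
      ⟨ind (splitE i j ⁻¹' (U ×ˢ U')), hc.ind_mem⟩ := by
    apply Subtype.ext
    change _ = ind (splitE i j ⁻¹' (U ×ˢ U'))
    rw [hset, ind_inter]
    rfl
  have hfin : Module.finrank ℝ (Submodule.span ℝ (splitE i j ⁻¹' (U ×ˢ U'))) =
      Module.finrank ℝ (Submodule.span ℝ U) + Module.finrank ℝ (Submodule.span ℝ U') := by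
    rw [hspan, ← Module.finrank_prod,
      ← (prodSubmoduleEquiv (Submodule.span ℝ U) (Submodule.span ℝ U')).finrank_eq,
      ← LinearEquiv.finrank_map_eq (splitE i j).symm, Submodule.map_equiv_eq_comap_symm]
    rfl
  have hcl : closure (splitE i j ⁻¹' (U ×ˢ U')) =
      fstE i j ⁻¹' closure U ∩ sndE i j ⁻¹' closure U' := by
    have := (splitE i j).toContinuousLinearEquiv.toHomeomorph.preimage_closure (U ×ˢ U')
    rw [closure_prod_eq] at this
    exact this.symm
  rw [e, interior_apply hc, hfin, hcl, ind_inter]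
  funext x
  change _ = (interiorMap _ ⟨ind U, hU.ind_mem⟩).1 _ * (interiorMap _ ⟨ind U', hU'.ind_mem⟩).1 _
  rw [interior_apply hU, interior_apply hU', pow_add]
  simp only [Pi.smul_apply, Pi.mul_apply, smul_eq_mul]
  change _ * (ind (closure U) (fstE i j x) * ind (closure U') (sndE i j x)) = _
  ring

end Products

/-! ### The twisted Leibniz rule and the module structure over `L⁺` -/

section Derivation

/-- The boundary operator in degree `n`, with values in the direct sum. -/
noncomputable def deltaHom : (n : ℕ) → L n →+ ⨁ n, L n
  | 0 => 0
  | n + 1 => (DirectSum.of L n).comp (delta n)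

/-- The boundary operator on `L = ⨁ₙ Lₙ`. -/
noncomputable def totalDelta : (⨁ n, L n) →+ ⨁ n, L n := DirectSum.toAddMonoid deltaHom

/-- The operator `ξ ↦ (-1)ⁿ I ξ` on `L = ⨁ₙ Lₙ`. -/
noncomputable def twist : (⨁ n, L n) →+ ⨁ n, L n :=
  DirectSum.toAddMonoid fun n => (DirectSum.of L n).comp ((-1 : ℤ) ^ n • interiorL n)

theorem totalDelta_of_zero (x : L 0) : totalDelta (DirectSum.of L 0 x) = 0 := by
  rw [totalDelta, DirectSum.toAddMonoid_of]; rfl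

theorem totalDelta_of_succ {n : ℕ} (x : L (n + 1)) :
    totalDelta (DirectSum.of L (n + 1) x) = DirectSum.of L n (delta n x) := by
  rw [totalDelta, DirectSum.toAddMonoid_of]; rfl

theorem twist_of {n : ℕ} (x : L n) :
    twist (DirectSum.of L n x) = DirectSum.of L n ((-1 : ℤ) ^ n • interiorL n x) := by
  rw [twist, DirectSum.toAddMonoid_of]; rfl

theorem interiorL_cls {n : ℕ} (f : coneGroup (E n)) :
    interiorL n (cls n f) = cls n (interiorMap (E n) f) := rfl

theorem of_mul {i j : ℕ} (x : L i) (y : L j) :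
    DirectSum.of L i x * DirectSum.of L j y = DirectSum.of L (i + j) (mulHom i j x y) :=
  DirectSum.of_mul_of x y

theorem exists_zsmul_oneL (x : L 0) : ∃ k : ℤ, x = k • oneL := by
  obtain ⟨f, rfl⟩ := cls_surjective 0 x
  refine ⟨f.1 0, ?_⟩
  rw [oneL, ← map_zsmul]
  congr 1
  apply Subtype.ext
  funext x
  classical
  change f.1 x = f.1 0 * ind Set.univ x
  rw [Subsingleton.elim x 0, ind_apply, if_pos (Set.mem_univ _), mul_one]

theorem of_oneL : DirectSum.of L 0 oneL = 1 := rfl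

theorem interiorL_oneL : interiorL 0 oneL = oneL := by
  have hU : IsOpenCell (Set.univ : Set (E 0)) := ⟨⟨0, trivial⟩, ∅, ∅, by ext; simp [cell]⟩
  rw [oneL, interiorL_cls]
  congr 1
  apply Subtype.ext
  refine (interior_apply hU).trans ?_
  have : Module.finrank ℝ (Submodule.span ℝ (Set.univ : Set (E 0))) = 0 :=
    Nat.le_zero.1 ((Submodule.finrank_le _).trans (by simp))
  rw [this, closure_univ, pow_zero, one_smul]

/-- Degree zero is separate because `δ` is set to zero there instead of being given by the formula
`ξ - (-1)ⁿ I ξ`. Since `L 0` consists of the integer multiples of `1`, additivity is enough. -/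
theorem totalDelta_of_zero_mul (x : L 0) (y : ⨁ n, L n) :
    totalDelta (DirectSum.of L 0 x * y) = twist (DirectSum.of L 0 x) * totalDelta y := by
  obtain ⟨k, rfl⟩ := exists_zsmul_oneL x
  rw [twist_of, map_zsmul (interiorL 0), interiorL_oneL, map_zsmul, map_zsmul, map_zsmul, of_oneL,
    pow_zero, one_smul, smul_mul_assoc, smul_mul_assoc, one_mul, one_mul, map_zsmul]

/-- The case of a lower-dimensional left factor follows from `descend_extProd` by exchanging the
coordinate blocks and using commutativity of `L`. -/
theorem descend_extProd_left {i j : ℕ} (f : coneGroup (E (j + 1))) {h : coneGroup (E (i + 1))}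
    (hh : h ∈ coneGroupLE (E (i + 1)) i) :
    ∃ hm : extProd (i + 1) (j + 1) h f ∈ coneGroupLE (E (i + 1 + j + 1)) (i + 1 + j),
      DirectSum.of L (i + 1 + j) (descend (le_finrank_E (i + 1 + j)) ⟨_, hm⟩) =
        DirectSum.of L i (descend (le_finrank_E i) ⟨h, hh⟩) * DirectSum.of L (j + 1) (cls _ f) := by
  have e : extProd (i + 1) (j + 1) h f =
      comap (reindex (finAddFlip (m := i + 1) (n := j + 1))).toLinearMap
        (extProd (j + 1) (i + 1) f h) := by
    apply Subtype.ext
    funext x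
    change h.1 _ * f.1 _ = f.1 _ * h.1 _
    rw [mul_comm]
    refine congrArg₂ (· * ·) (congrArg f.1 (PiLp.ext fun l => ?_))
      (congrArg h.1 (PiLp.ext fun l => ?_))
    · exact congrArg x (finAddFlip.symm_apply_eq.2 (finAddFlip_apply_natAdd l (i + 1)).symm).symm
    · exact congrArg x (finAddFlip.symm_apply_eq.2 (finAddFlip_apply_castAdd l (j + 1)).symm).symm
  obtain ⟨h1, h2⟩ := descend_congr_equiv (show i + 1 + j = j + 1 + i by omega)
    (le_finrank_E (i + 1 + j)) (le_finrank_E (j + 1 + i))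
    (reindex (finAddFlip (m := i + 1) (n := j + 1))) (extProd_mem_coneGroupLE f hh)
  refine ⟨e ▸ h1, ?_⟩
  rw [mul_comm, of_mul, ← descend_extProd, ← h2]
  congr 3

theorem totalDelta_of_succ_mul_of_succ {i j : ℕ} (x : L (i + 1)) (y : L (j + 1)) :
    totalDelta (DirectSum.of L (i + 1) x * DirectSum.of L (j + 1) y) =
      totalDelta (DirectSum.of L (i + 1) x) * DirectSum.of L (j + 1) y +
      twist (DirectSum.of L (i + 1) x) * totalDelta (DirectSum.of L (j + 1) y) := by
  obtain ⟨f, rfl⟩ := cls_surjective _ x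
  obtain ⟨g, rfl⟩ := cls_surjective _ y
  obtain ⟨h1, h2⟩ := descend_extProd_left g (boundary i f).2
  set f' : coneGroup (E (i + 1)) := (-1 : ℤ) ^ (i + 1) • interiorMap _ f with hf'
  have h3 := extProd_mem_coneGroupLE f' (boundary j g).2
  have h4 := descend_extProd f' (boundary j g).2
  -- The Leibniz rule at the level of cones: `ab - a'b' = (a - a')b + a'(b - b')`, where the prime
  -- stands for the involution with its sign.
  have key : boundary (i + 1 + j) (extProd (i + 1) (j + 1) f g) =
      ⟨extProd (i + 1) (j + 1) (boundary i f).1 g, h1⟩ +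
      ⟨extProd (i + 1) (j + 1) f' (boundary j g).1, h3⟩ := by
    apply Subtype.ext
    change extProd (i + 1) (j + 1) f g - (-1 : ℤ) ^ (i + 1 + j + 1) •
      interiorMap (E (i + 1 + (j + 1))) (extProd (i + 1) (j + 1) f g) =
      extProd (i + 1) (j + 1) (f - f') g +
      extProd (i + 1) (j + 1) f' (g - (-1 : ℤ) ^ (j + 1) • interiorMap _ g)
    rw [interior_extProd, map_sub, map_sub, AddMonoidHom.sub_apply, hf', map_zsmul,
      AddMonoidHom.zsmul_apply, AddMonoidHom.zsmul_apply, map_zsmul, smul_smul, ← pow_add]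
    exact (sub_add_sub_cancel _ _ _).symm
  rw [of_mul, mulHom_cls]
  change totalDelta (DirectSum.of L (i + 1 + j + 1) _) = _
  rw [totalDelta_of_succ]
  change DirectSum.of L (i + 1 + j) (descend (le_finrank_E (i + 1 + j)) (boundary (i + 1 + j)
    (extProd (i + 1) (j + 1) f g))) = _
  rw [key, map_add, map_add, h2, h4, totalDelta_of_succ, totalDelta_of_succ, twist_of,
    of_mul (i := i + 1) (j := j), interiorL_cls, ← map_zsmul]
  rfl

theorem totalDelta_of_mul_of {i j : ℕ} (x : L i) (y : L j) :
    totalDelta (DirectSum.of L i x * DirectSum.of L j y) =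
      totalDelta (DirectSum.of L i x) * DirectSum.of L j y +
      twist (DirectSum.of L i x) * totalDelta (DirectSum.of L j y) := by
  rcases i with _ | i
  · rw [totalDelta_of_zero_mul, totalDelta_of_zero, zero_mul, zero_add]
  rcases j with _ | j
  · obtain ⟨k, rfl⟩ := exists_zsmul_oneL y
    rw [totalDelta_of_zero, mul_zero, add_zero, map_zsmul, of_oneL, mul_smul_comm, mul_smul_comm,
      mul_one, mul_one, map_zsmul]
  · exact totalDelta_of_succ_mul_of_succ x y

/-- The boundary operator is a twisted derivation. -/
theorem totalDelta_mul (x y : ⨁ n, L n) :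
    totalDelta (x * y) = totalDelta x * y + twist x * totalDelta y := by
  induction x using DirectSum.induction_on with
  | zero => simp
  | add x x' hx hx' => rw [add_mul, map_add, hx, hx', map_add, map_add]; ring
  | of i x =>
    induction y using DirectSum.induction_on with
    | zero => simp
    | add y y' hy hy' => rw [mul_add, map_add, hy, hy', map_add]; ring
    | of j y => exact totalDelta_of_mul_of x y

theorem totalDelta_apply (x : ⨁ n, L n) (n : ℕ) : totalDelta x n = delta n (x (n + 1)) := by
  induction x using DirectSum.induction_on with
  | zero => simp
  | add x x' hx hx' => rw [map_add, DirectSum.add_apply, DirectSum.add_apply, hx, hx', map_add]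
  | of i x =>
    rcases i with _ | i
    · rw [totalDelta_of_zero, DirectSum.of_eq_of_ne _ _ _ (by simp), map_zero, DirectSum.zero_apply]
    · rw [totalDelta_of_succ]
      by_cases h : n = i
      · subst h
        rw [DirectSum.of_eq_same, DirectSum.of_eq_same]
      · rw [DirectSum.of_eq_of_ne _ _ _ (by omega), DirectSum.of_eq_of_ne _ _ _ (by omega),
          map_zero]

theorem totalDelta_eq_zero_iff (x : ⨁ n, L n) : totalDelta x = 0 ↔ ∀ n, x n ∈ Lplus n := by
  constructor
  · rintro h (_ | n)
    · trivial
    · change delta n (x (n + 1)) = 0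
      rw [← totalDelta_apply, h, DirectSum.zero_apply]
  · intro h
    ext n
    rw [totalDelta_apply]
    exact h (n + 1)

theorem twist_apply (x : ⨁ n, L n) (n : ℕ) : twist x n = (-1 : ℤ) ^ n • interiorL n (x n) := by
  induction x using DirectSum.induction_on with
  | zero => simp
  | add x x' hx hx' =>
    rw [map_add, DirectSum.add_apply, DirectSum.add_apply, hx, hx', map_add, smul_add]
  | of i x =>
    rw [twist_of]
    by_cases h : n = i
    · subst h
      rw [DirectSum.of_eq_same, DirectSum.of_eq_same]
    · rw [DirectSum.of_eq_of_ne _ _ _ h, DirectSum.of_eq_of_ne _ _ _ h, map_zero, smul_zero]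

/-- In degree `n + 1`, `δ⟨f⟩ = 0` says that `f - (-1)ⁿ⁺¹ I f` represents zero in `L n`. By
stabilization it also represents zero in `L (n + 1)`, which is the claim. -/
theorem twist_eq_self {x : ⨁ n, L n} (h : totalDelta x = 0) : twist x = x := by
  ext n
  rw [twist_apply]
  rw [totalDelta_eq_zero_iff] at h
  rcases n with _ | n
  · obtain ⟨k, hk⟩ := exists_zsmul_oneL (x 0)
    rw [hk, map_zsmul, interiorL_oneL, pow_zero, one_smul]
  · obtain ⟨f, hf⟩ := cls_surjective (n + 1) (x (n + 1))
    have h1 : delta n (x (n + 1)) = 0 := h (n + 1)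
    rw [← hf] at h1 ⊢
    have h2 := cls_eq_zero_of_descend_eq_zero (boundary n f).2 h1
    rw [boundary_val, map_sub, map_zsmul, sub_eq_zero] at h2
    exact h2.symm

/-- The class of a half-line in `L = ⨁ₙ Lₙ`. -/
noncomputable def dL : ⨁ n, L n := DirectSum.of L 1 halfLine

/-- The standard basis of `ℝ`. -/
noncomputable def halfLineVec (_ : Fin 1) : E 1 := EuclideanSpace.single 0 1

theorem linearIndepOn_halfLineVec (s : Finset (Fin 1)) :
    LinearIndepOn ℝ halfLineVec (s : Set (Fin 1)) := by
  refine LinearIndependent.linearIndepOn ?_ (s : Set (Fin 1))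
  rw [linearIndependent_unique_iff]
  simp [halfLineVec]

/-- The closed ray is the point plus the open ray `r`. The involution fixes the point and sends `r`
to minus the closed ray, so `ξ + I ξ` leaves exactly one point. -/
theorem totalDelta_dL : totalDelta dL = 1 := by
  classical
  rw [dL, totalDelta_of_succ, ← of_oneL]
  congr 1
  have hv := linearIndepOn_halfLineVec
  have hd : (⟨ind {x : E 1 | 0 ≤ x 0}, isConvexCone_halfLine.isCone.ind_mem⟩ : coneGroup (E 1)) =
      openSimplex halfLineVec ∅ + openSimplex halfLineVec {0} := by
    apply Subtype.ext
    have h1 := ind_closedConicalSimplex (hv {0})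
    have h2 : closedConicalSimplex halfLineVec {0} = {x : E 1 | 0 ≤ x 0} := by
      ext x
      simp only [closedConicalSimplex, Finset.mem_singleton, forall_eq, Finset.sum_singleton,
        Set.mem_ofPred_eq, halfLineVec]
      constructor
      · rintro ⟨t, ht, rfl⟩
        simpa using ht
      · intro hx
        refine ⟨fun _ => x 0, hx, ?_⟩
        ext k
        simp [Subsingleton.elim k 0]
    change ind {x : E 1 | 0 ≤ x 0} = _
    rw [← h2]
    refine h1.trans ?_
    change _ = (openSimplex halfLineVec ∅).1 + (openSimplex halfLineVec {0}).1
    rw [openSimplex_val (hv _), openSimplex_val (hv _)]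
    have : ({0} : Finset (Fin 1)).powerset = {∅, {0}} := rfl
    rw [this, Finset.sum_pair (by simp)]
  obtain ⟨φ⟩ := nonempty_isometry 0
  have hp : boundary 0 (openSimplex halfLineVec ∅ + openSimplex halfLineVec {0}) =
      ⟨pushCone φ ⟨ind Set.univ, isConvexCone_univ.isCone.ind_mem⟩, pushCone_mem _ _⟩ := by
    apply Subtype.ext
    change _ = pushCone φ ⟨ind Set.univ, isConvexCone_univ.isCone.ind_mem⟩
    have h0 : pushCone φ ⟨ind Set.univ, isConvexCone_univ.isCone.ind_mem⟩ = openSimplex halfLineVec ∅ := by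
      rw [pushCone_eq_iff, openSimplex_val (hv _)]
      have : ∀ x : E 1, x ∈ openConicalSimplex halfLineVec ∅ ↔ x = 0 := by simp [openConicalSimplex]
      constructor
      · intro x
        simp [ind_apply, this, Subsingleton.elim x 0]
      · intro y hy
        rw [ind_apply, if_neg]
        rw [this]
        rintro rfl
        exact hy ⟨0, map_zero φ⟩
    rw [h0, boundary_val, map_add, interior_openSimplex (hv _), interior_openSimplex (hv _)]
    have : ({0} : Finset (Fin 1)).powerset = {∅, {0}} := rfl
    rw [this, Finset.sum_pair (by simp)]
    simp
  rw [halfLine, delta_cls, hd, hp, descend_pushCone]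
  rfl

theorem totalDelta_dL_mul {x : ⨁ n, L n} (h : totalDelta x = 0) : totalDelta (dL * x) = x := by
  rw [totalDelta_mul, totalDelta_dL, one_mul, h, mul_zero, add_zero]

/-- The kernel of the boundary operator, as a subring. -/
noncomputable def plusSubring : Subring (⨁ n, L n) where
  carrier := {x | totalDelta x = 0}
  mul_mem' {x y} hx hy := by
    change totalDelta (x * y) = 0
    rw [totalDelta_mul, hx, hy, zero_mul, mul_zero, add_zero]
  one_mem' := totalDelta_of_zero _
  add_mem' {x y} hx hy := by
    change totalDelta (x + y) = 0
    rw [map_add, hx, hy, add_zero]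
  zero_mem' := map_zero _
  neg_mem' {x} hx := by
    change totalDelta (-x) = 0
    rw [map_neg, hx, neg_zero]

theorem mem_plusSubring {x : ⨁ n, L n} : x ∈ plusSubring ↔ totalDelta x = 0 := Iff.rfl

/-- Applying `δ` to `a + d b = 0` with `a, b ∈ ker δ` gives `b = 0`, and `x = (x - d δx) + d δx`
gives spanning. The hypothesis `δ ∘ δ = 0` makes `δx` a scalar; it is supplied later by the manifold
argument. -/
theorem exists_basis (h : ∀ x, totalDelta (totalDelta x) = 0) :
    ∃ b : Module.Basis (Fin 2) plusSubring (⨁ n, L n), b 0 = 1 ∧ b 1 = dL := by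
  have hli : LinearIndependent plusSubring ![(1 : ⨁ n, L n), dL] := by
    rw [LinearIndependent.pair_iff]
    rintro ⟨a, ha⟩ ⟨b, hb⟩ hab
    have hab' : a * 1 + b * dL = 0 := hab
    rw [mul_one, mul_comm] at hab'
    have hb0 : b = 0 := by
      have := congrArg totalDelta hab'
      rwa [map_add, totalDelta_dL_mul hb, mem_plusSubring.1 ha, zero_add, map_zero] at this
    rw [hb0, mul_zero, add_zero] at hab'
    exact ⟨Subtype.ext hab', Subtype.ext hb0⟩
  have hsp : ⊤ ≤ Submodule.span plusSubring (Set.range ![(1 : ⨁ n, L n), dL]) := by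
    intro x _
    have hb : totalDelta x ∈ plusSubring := h x
    have ha : x - dL * totalDelta x ∈ plusSubring := by
      rw [mem_plusSubring, map_sub, totalDelta_dL_mul hb, sub_self]
    have : x = (⟨_, ha⟩ : plusSubring) • (1 : ⨁ n, L n) + (⟨_, hb⟩ : plusSubring) • dL := by
      change x = (x - dL * totalDelta x) * 1 + totalDelta x * dL
      ring
    rw [this]
    exact add_mem (Submodule.smul_mem _ _ (Submodule.subset_span ⟨0, rfl⟩))
      (Submodule.smul_mem _ _ (Submodule.subset_span ⟨1, rfl⟩))
  exact ⟨Module.Basis.mk hli hsp, by simp, by simp⟩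

/-- Multiplication by `d` is a right inverse of `δ` on its kernel. -/
theorem Lplus_le_range (n : ℕ) : Lplus n ≤ (delta n).range := by
  intro x hx
  have h0 : totalDelta (DirectSum.of L n x) = 0 := by
    rcases n with _ | n
    · exact totalDelta_of_zero x
    · rw [totalDelta_of_succ]
      exact (congrArg _ hx).trans (map_zero _)
  refine ⟨(dL * DirectSum.of L n x) (n + 1), ?_⟩
  rw [← totalDelta_apply, totalDelta_dL_mul h0, DirectSum.of_eq_same]

end Derivation

/-! ### The boundary of an orthant is a piecewise linear manifold -/

section BoundaryOrthant

/-- The boundary of the positive orthant. -/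
def boundaryOrthant (K : ℕ) : Set (Fin (K + 1) → ℝ) := {x | (∀ i, 0 ≤ x i) ∧ ∃ i, x i = 0}

/-- The projection of `ℝᴷ⁺¹` to `ℝᴷ` along the diagonal. -/
def diagProj (K : ℕ) : (Fin (K + 1) → ℝ) →ₗ[ℝ] (Fin K → ℝ) where
  toFun x i := x i.succ - x 0
  map_add' x y := by ext i; simp only [Pi.add_apply]; ring
  map_smul' a x := by ext i; simp only [Pi.smul_apply, smul_eq_mul, RingHom.id_apply]; ring

theorem diagProj_apply {K : ℕ} (x : Fin (K + 1) → ℝ) (i : Fin K) :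
    diagProj K x i = x i.succ - x 0 := rfl

/-- Two points with the same projection differ by a multiple of the diagonal vector. This multiple
is zero because each point has nonnegative coordinates and some coordinate equal to zero. -/
theorem diagProj_injOn (K : ℕ) : Set.InjOn (diagProj K) (boundaryOrthant K) := by
  rintro x ⟨hx, i, hi⟩ y ⟨hy, j, hj⟩ h
  have key : ∀ k, x k - x 0 = y k - y 0 := by
    intro k
    refine Fin.cases (by simp) (fun k => ?_) k
    exact congrFun h k
  have h0 : x 0 = y 0 := by
    have h1 := key i
    have h2 := key j
    have h3 := hy i
    have h4 := hx j
    linarith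
  ext k
  have := key k
  linarith

/-- The inverse of the projection of the boundary of the orthant along the diagonal. -/
noncomputable def diagLift {K : ℕ} (y : Fin K → ℝ) : Fin (K + 1) → ℝ := fun i =>
  (Fin.cons 0 y : Fin (K + 1) → ℝ) i -
    Finset.univ.inf' Finset.univ_nonempty (Fin.cons 0 y : Fin (K + 1) → ℝ)

theorem diagLift_mem {K : ℕ} (y : Fin K → ℝ) : diagLift y ∈ boundaryOrthant K := by
  constructor
  · intro i
    exact sub_nonneg.2 (Finset.inf'_le _ (Finset.mem_univ i))
  · obtain ⟨i, -, hi⟩ := Finset.exists_mem_eq_inf' Finset.univ_nonempty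
      (Fin.cons 0 y : Fin (K + 1) → ℝ)
    exact ⟨i, sub_eq_zero.2 hi.symm⟩

theorem diagProj_diagLift {K : ℕ} (y : Fin K → ℝ) : diagProj K (diagLift y) = y := by
  ext i
  simp [diagProj_apply, diagLift]

theorem continuous_diagLift (K : ℕ) : Continuous (diagLift : (Fin K → ℝ) → Fin (K + 1) → ℝ) := by
  have h : ∀ i, Continuous fun y : Fin K → ℝ => (Fin.cons 0 y : Fin (K + 1) → ℝ) i := by
    intro i
    refine Fin.cases ?_ (fun i => ?_) i
    · simpa using continuous_const
    · simpa using continuous_apply i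
  refine continuous_pi fun i => (h i).sub ?_
  have := Continuous.finset_inf'_apply (s := Finset.univ) (Finset.univ_nonempty (α := Fin (K + 1)))
    (f := fun i (y : Fin K → ℝ) => (Fin.cons 0 y : Fin (K + 1) → ℝ) i) fun i _ => h i
  exact this

/-- The projection along the diagonal is a global linear chart. Its graph is cut off by a large cube
only because charts are required to be polytopes. -/
theorem isPLManifold_boundaryOrthant (K : ℕ) :
    IsPLManifoldWithoutBoundary K (boundaryOrthant K) := by
  classical
  intro x hx
  obtain ⟨R, hR0, hR⟩ : ∃ R : ℝ, 0 < R ∧ ∀ i, x i < R := by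
    refine ⟨∑ i, x i + 1, by have := Finset.sum_nonneg fun i (_ : i ∈ Finset.univ) => hx.1 i; linarith,
      fun i => ?_⟩
    have := Finset.single_le_sum (fun i _ => hx.1 i) (Finset.mem_univ i)
    linarith
  let G : (Fin (K + 1) → ℝ) →ₗ[ℝ] (Fin (K + 1) → ℝ) × (Fin K → ℝ) :=
    LinearMap.id.prod (diagProj K)
  have hG : ∀ z, G z = (z, diagProj K z) := fun _ => rfl
  let X : Set (Fin (K + 1) → ℝ) := boundaryOrthant K ∩ {z | ∀ i, z i ≤ R}
  have hfst : Prod.fst '' (G '' X) = X := by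
    rw [Set.image_image]; exact Set.image_id X
  have hsnd : Prod.snd '' (G '' X) = diagProj K '' X := by
    rw [Set.image_image]; rfl
  have hlt : ∀ {A : Type} [TopologicalSpace A] (g : A → Fin (K + 1) → ℝ), Continuous g →
      IsOpen {a | ∀ i, g a i < R} := by
    intro A _ g hg
    rw [Set.ofPred_forall]
    exact isOpen_iInter_of_finite fun i => isOpen_lt ((continuous_apply i).comp hg) continuous_const
  refine ⟨G '' X, ?_, ?_, ?_, ?_, ?_, diagProj K x, ?_, ?_⟩
  -- `S i` is the vertex set of the face `z i = 0` of the cube with edge `R`.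
  · let S : Fin (K + 1) → Finset (Fin (K + 1) → ℝ) := fun i =>
      Fintype.piFinset fun j => if j = i then {0} else {0, R}
    have hS : ∀ i, convexHull ℝ (S i : Set (Fin (K + 1) → ℝ)) =
        {z | z i = 0 ∧ ∀ j, 0 ≤ z j ∧ z j ≤ R} := by
      intro i
      rw [Fintype.coe_piFinset, convexHull_pi]
      ext z
      simp only [Set.mem_pi, Set.mem_univ, true_imp_iff, Set.mem_ofPred_eq]
      have hseg : convexHull ℝ ({0, R} : Set ℝ) = Set.Icc 0 R := by
        rw [convexHull_pair, segment_eq_Icc hR0.le]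
      constructor
      · intro h
        have hi : z i = 0 := by simpa using h i
        refine ⟨hi, fun j => ?_⟩
        by_cases hj : j = i
        · rw [hj, hi]; exact ⟨le_rfl, hR0.le⟩
        · have := h j
          rw [if_neg hj, Finset.coe_insert, Finset.coe_singleton, hseg] at this
          exact this
      · rintro ⟨hi, h⟩ j
        by_cases hj : j = i
        · rw [hj, if_pos rfl, hi]; simp
        · rw [if_neg hj, Finset.coe_insert, Finset.coe_singleton, hseg]
          exact h j
    refine ⟨Set.range fun i => (S i).image G, Set.finite_range _, ?_⟩
    have hX : X = ⋃ i, convexHull ℝ (S i : Set (Fin (K + 1) → ℝ)) := by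
      ext z
      simp only [X, boundaryOrthant, hS, Set.mem_inter_iff, Set.mem_ofPred_eq, Set.mem_iUnion]
      constructor
      · rintro ⟨⟨h1, i, hi⟩, h2⟩
        exact ⟨i, hi, fun j => ⟨h1 j, h2 j⟩⟩
      · rintro ⟨i, hi, h⟩
        exact ⟨⟨fun j => (h j).1, i, hi⟩, fun j => (h j).2⟩
    rw [Set.biUnion_range, hX, Set.image_iUnion]
    refine Set.iUnion_congr fun i => ?_
    rw [Finset.coe_image]
    exact G.image_convexHull _
  · rintro _ ⟨z, -, rfl⟩ _ ⟨z', -, rfl⟩ h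
    exact congrArg G h
  · rintro _ ⟨z, hz, rfl⟩ _ ⟨z', hz', rfl⟩ h
    exact congrArg G (diagProj_injOn K hz.1 hz'.1 h)
  · rw [hfst]; exact Set.inter_subset_left
  · rw [hfst]
    refine Filter.mem_of_superset (Filter.inter_mem self_mem_nhdsWithin
      (mem_nhdsWithin_of_mem_nhds ((hlt id continuous_id).mem_nhds hR))) ?_
    exact fun z hz => ⟨hz.1, fun i => (hz.2 i).le⟩
  · exact ⟨x, ⟨hx, fun i => (hR i).le⟩, rfl⟩
  · rw [hsnd]
    have hxl : diagLift (diagProj K x) = x :=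
      diagProj_injOn K (diagLift_mem _) hx (diagProj_diagLift _)
    -- Continuity of the inverse `diagLift` makes the chart values whose lift lies in the open cube
    -- an open set, and the image of `X` contains them.
    refine Filter.mem_of_superset ((hlt _ (continuous_diagLift K)).mem_nhds (x := diagProj K x) ?_) ?_
    · intro i
      rw [hxl]; exact hR i
    · exact fun y hy => ⟨diagLift y, ⟨diagLift_mem y, fun i => (hy i).le⟩, diagProj_diagLift y⟩

end BoundaryOrthant

/-! ### Euclidean cones over the boundary complex of a simplex -/

section BoundaryComplex

/-- The subgroup of `L n` generated by the interior manifold cones whose dimension has the parity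
of `n`. -/
noncomputable def manifoldSpan (n : ℕ) : AddSubgroup (L n) :=
  AddSubgroup.closure {x | ∃ (M : EuclideanCone n) (m : ℕ), (Even m ↔ Even n) ∧
    IsPLManifoldWithoutBoundary m M.space ∧ x = M.toL}

theorem pushCone_openSimplex {N n m : ℕ} (φ : E n →ₗᵢ[ℝ] E m) {u : Fin N → E n} {v : Fin N → E m}
    {σ : Finset (Fin N)} (h : ∀ i ∈ σ, φ (u i) = v i)
    (hu : LinearIndepOn ℝ u (σ : Set (Fin N))) (hv : LinearIndepOn ℝ v (σ : Set (Fin N))) :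
    pushCone φ (openSimplex u σ) = openSimplex v σ := by
  classical
  have hsum : ∀ t : Fin N → ℝ, φ (∑ i ∈ σ, t i • u i) = ∑ i ∈ σ, t i • v i := by
    intro t
    rw [map_sum]
    exact Finset.sum_congr rfl fun i hi => by rw [map_smul, h i hi]
  rw [pushCone_eq_iff, openSimplex_val hu, openSimplex_val hv]
  constructor
  · intro x
    simp only [ind_apply]
    refine if_congr ⟨?_, ?_⟩ rfl rfl
    · rintro ⟨t, ht, rfl⟩
      exact ⟨t, ht, hsum t⟩
    · rintro ⟨t, ht, hx⟩
      exact ⟨t, ht, φ.injective (hx.trans (hsum t).symm)⟩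
  · intro y hy
    rw [ind_apply, if_neg]
    rintro ⟨t, ht, rfl⟩
    exact hy ⟨_, hsum t⟩

theorem linearIndepOn_of_isometry {N n m : ℕ} (φ : E n →ₗᵢ[ℝ] E m) {u : Fin N → E n}
    {v : Fin N → E m} {σ : Finset (Fin N)} (h : ∀ i ∈ σ, φ (u i) = v i)
    (hv : LinearIndepOn ℝ v (σ : Set (Fin N))) : LinearIndepOn ℝ u (σ : Set (Fin N)) := by
  rw [linearIndepOn_finset_iff] at hv ⊢
  intro g hg
  refine hv g ?_
  rw [← map_zero φ, ← hg, map_sum]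
  exact Finset.sum_congr rfl fun i hi => by rw [map_smul, h i hi]

/-- The boundary of a simplicial cone, where the generators need not be independent as long as
the proper subsets of them are, is an interior manifold cone. -/
theorem delta_cls_mem_manifoldSpan {n K : ℕ} (hK : K ≤ n) (hpar : Even K ↔ Even n)
    (v : Fin (K + 1) → E (n + 1))
    (hv : ∀ σ : Finset (Fin (K + 1)), σ ≠ Finset.univ → LinearIndepOn ℝ v (σ : Set (Fin (K + 1))))
    (f : coneGroup (E (n + 1))) (c : ℤ)
    (hf : (boundary n f).1 = c • ∑ σ ∈ Finset.univ.filter (· ≠ Finset.univ), openSimplex v σ) :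
    delta n (cls (n + 1) f) ∈ manifoldSpan n := by
  classical
  -- A proper subset has at most `K ≤ n` elements, so its vectors lie in an isometric copy of `ℝⁿ`.
  -- The full set is not a face, and its data are arbitrary.
  have hex : ∀ σ : Finset (Fin (K + 1)), ∃ (u : Fin (K + 1) → E n) (φ : E n →ₗᵢ[ℝ] E (n + 1)),
      σ ≠ Finset.univ → ∀ i ∈ σ, φ (u i) = v i := by
    intro σ
    by_cases hσ : σ = Finset.univ
    · obtain ⟨φ⟩ := nonempty_isometry n
      exact ⟨0, φ, fun h => absurd hσ h⟩
    have hcard : σ.card ≤ n := by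
      obtain ⟨i, hi⟩ : ∃ i, i ∉ σ := by
        by_contra hc
        push Not at hc
        exact hσ (Finset.eq_univ_iff_forall.2 hc)
      have := Finset.card_lt_univ_of_notMem hi
      rw [Fintype.card_fin] at this
      omega
    obtain ⟨φ, hφ⟩ := exists_embedding (le_finrank_E n)
      (Submodule.span ℝ ((σ.image v : Finset (E (n + 1))) : Set (E (n + 1))))
      ((finrank_span_finset_le_card _).trans (Finset.card_image_le.trans hcard))
    have : ∀ i, ∃ y, i ∈ σ → φ y = v i := by
      intro i
      by_cases hi : i ∈ σ
      · obtain ⟨y, hy⟩ := hφ (Submodule.subset_span (Finset.mem_coe.2 (Finset.mem_image_of_mem v hi)))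
        exact ⟨y, fun _ => hy⟩
      · exact ⟨0, fun h => absurd h hi⟩
    choose u hu using this
    exact ⟨u, φ, fun _ => hu⟩
  choose u φ hu using hex
  have hne : ∀ {σ : Finset (Fin (K + 1))}, σ ∈ Finset.univ.filter (· ≠ Finset.univ) →
      σ ≠ Finset.univ := fun h => (Finset.mem_filter.1 h).2
  have hsub : ∀ {σ τ : Finset (Fin (K + 1))}, σ ≠ Finset.univ → τ ⊆ σ → τ ≠ Finset.univ := by
    rintro σ τ h1 h2 rfl
    exact h1 (Finset.univ_subset_iff.1 h2)
  let M : EuclideanCone n :=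
    { N := K + 1
      faces := Finset.univ.filter (· ≠ Finset.univ)
      empty_mem := Finset.mem_filter.2 ⟨Finset.mem_univ _, fun h => by
        have := Finset.mem_univ (0 : Fin (K + 1))
        rw [← h] at this
        simp at this⟩
      down_closed := fun σ hσ τ hτ => Finset.mem_filter.2 ⟨Finset.mem_univ _, hsub (hne hσ) hτ⟩
      vec := u
      linearIndepOn := fun σ hσ =>
        linearIndepOn_of_isometry (φ σ) (hu σ (hne hσ)) (hv σ (hne hσ))
      compatible := fun σ hσ τ hτ i hi j hj => by
        rw [← (φ τ).inner_map_map, ← (φ σ).inner_map_map, hu τ (hsub (hne hσ) hτ) i hi,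
          hu τ (hsub (hne hσ) hτ) j hj, hu σ (hne hσ) i (hτ hi), hu σ (hne hσ) j (hτ hj)] }
  -- The support of a point is a proper subset exactly when some coordinate vanishes.
  have hspace : M.space = boundaryOrthant K := by
    ext x
    refine and_congr_right fun _ => ?_
    change (Finset.univ.filter fun i => x i ≠ 0) ∈ Finset.univ.filter (· ≠ Finset.univ) ↔ _
    rw [Finset.mem_filter, Ne, Finset.filter_eq_self]
    simp only [Finset.mem_univ, true_and, true_imp_iff, not_forall, not_not]
    rfl
  have hM : IsPLManifoldWithoutBoundary K M.space := by
    rw [hspace]; exact isPLManifold_boundaryOrthant K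
  have hL : M.toL = ∑ σ ∈ Finset.univ.filter (· ≠ Finset.univ), cls n (openSimplex (u σ) σ) := by
    rw [← Finset.sum_coe_sort]
    refine Finset.sum_congr rfl fun σ _ => ?_
    rw [openSimplex_eq (M.linearIndepOn σ σ.2)]
  have hpush : ∀ σ ∈ Finset.univ.filter (· ≠ (Finset.univ : Finset (Fin (K + 1)))),
      openSimplex v σ = pushCone (φ σ) (openSimplex (u σ) σ) := fun σ hσ =>
    (pushCone_openSimplex (φ σ) (hu σ (hne hσ)) (M.linearIndepOn σ hσ) (hv σ (hne hσ))).symm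
  have : delta n (cls (n + 1) f) = c • M.toL := by
    have hb : boundary n f = c • ∑ σ ∈ Finset.univ.filter (· ≠ Finset.univ),
        (⟨pushCone (φ σ) (openSimplex (u σ) σ), pushCone_mem _ _⟩ :
          coneGroupLE (E (n + 1)) n) := by
      apply Subtype.ext
      rw [hf, AddSubgroup.coe_zsmul, AddSubgroup.val_finsetSum]
      congr 1
      exact Finset.sum_congr rfl hpush
    rw [delta_cls, hb, map_zsmul, map_sum, hL]
    congr 1
    exact Finset.sum_congr rfl fun σ _ => descend_pushCone _ _ _
  rw [this]
  exact zsmul_mem (show M.toL ∈ manifoldSpan n from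
    AddSubgroup.subset_closure ⟨M, K, hpar, hM, rfl⟩) c

end BoundaryComplex

/-! ### The image of `δ` lies in the span of manifold cones -/

section Range

variable {k n : ℕ}

/-- The generators of a simplicial cone together with their sum. -/
noncomputable def withSum (v : Fin k → E n) : Fin (k + 1) → E n := Fin.cons (∑ i, v i) v

/-- In a relation, the coefficient of the sum vector cancels that of each `v i`. If one coefficient
is missing, hence zero, then all of them vanish. -/
theorem linearIndepOn_withSum {v : Fin k → E n} (hv : LinearIndependent ℝ v)
    (σ : Finset (Fin (k + 1))) (hσ : σ ≠ Finset.univ) :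
    LinearIndepOn ℝ (withSum v) (σ : Set (Fin (k + 1))) := by
  classical
  rw [linearIndepOn_finset_iff]
  intro g hg
  let g' : Fin (k + 1) → ℝ := fun i => if i ∈ σ then g i else 0
  have hg' : ∑ i, g' i • withSum v i = 0 := by
    rw [← hg, ← Finset.sum_subset (Finset.subset_univ σ)]
    · exact Finset.sum_congr rfl fun i hi => by simp only [g', if_pos hi]
    · intro i _ hi
      simp only [g', if_neg hi, zero_smul]
  have hcoef : ∀ i, g' 0 + g' (Fin.succ i) = 0 := by
    refine Fintype.linearIndependent_iff.1 hv _ ?_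
    rw [Fin.sum_univ_succ] at hg'
    simpa only [withSum, Fin.cons_zero, Fin.cons_succ, Finset.smul_sum, ← Finset.sum_add_distrib,
      ← add_smul] using hg'
  obtain ⟨j, hj⟩ : ∃ j, j ∉ σ := by
    by_contra hc
    push Not at hc
    exact hσ (Finset.eq_univ_iff_forall.2 hc)
  have hj' : g' j = 0 := if_neg hj
  have h0 : g' 0 = 0 := by
    revert hj'
    refine Fin.cases id (fun j hj' => ?_) j
    have := hcoef j
    rwa [hj', add_zero] at this
  intro i hi
  have : g' i = 0 := by
    refine Fin.cases h0 (fun i => ?_) i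
    have := hcoef i
    rwa [h0, zero_add] at this
  simpa only [g', if_pos hi] using this

/-- The embedding of the subsets of `Fin k` into the subsets of `Fin (k + 1)` without `0`. -/
def succSet (ρ : Finset (Fin k)) : Finset (Fin (k + 1)) := ρ.map (Fin.succEmb k)

theorem zero_notMem_succSet (ρ : Finset (Fin k)) : (0 : Fin (k + 1)) ∉ succSet ρ := by
  simp [succSet]

theorem openConicalSimplex_succSet (v : Fin k → E n) (ρ : Finset (Fin k)) :
    openConicalSimplex (withSum v) (succSet ρ) = openConicalSimplex v ρ := by
  ext x
  simp only [openConicalSimplex, succSet, Finset.sum_map, Finset.mem_map, forall_exists_index,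
    and_imp, forall_apply_eq_imp_iff₂, Set.mem_ofPred_eq, Fin.coe_succEmb, withSum, Fin.cons_succ]
  constructor
  · rintro ⟨t, ht, hx⟩
    exact ⟨fun i => t i.succ, ht, hx⟩
  · rintro ⟨t, ht, hx⟩
    exact ⟨Fin.cons 0 t, by simpa using ht, by simpa using hx⟩

theorem mem_openConicalSimplex_insert [DecidableEq (Fin (k + 1))] {v : Fin k → E n}
    {ρ : Finset (Fin k)} {x : E n} :
    x ∈ openConicalSimplex (withSum v) (insert 0 (succSet ρ)) ↔
      ∃ (m : ℝ) (s : Fin k → ℝ), 0 < m ∧ (∀ i ∈ ρ, 0 < s i) ∧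
        x = ∑ i, (m + if i ∈ ρ then s i else 0) • v i := by
  have hsum : ∀ (m : ℝ) (s : Fin k → ℝ), ∑ i, (m + if i ∈ ρ then s i else 0) • v i =
      m • ∑ i, v i + ∑ i ∈ ρ, s i • v i := by
    intro m s
    simp only [add_smul, Finset.sum_add_distrib, Finset.smul_sum, ite_smul, zero_smul,
      Finset.sum_ite_mem, Finset.univ_inter]
  simp only [hsum]
  change (∃ t : Fin (k + 1) → ℝ, _) ↔ _
  simp only [Finset.sum_insert (zero_notMem_succSet ρ), Finset.forall_mem_insert]
  simp only [succSet, Finset.sum_map, Finset.mem_map, forall_exists_index,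
    and_imp, forall_apply_eq_imp_iff₂, Fin.coe_succEmb, withSum, Fin.cons_succ, Fin.cons_zero]
  constructor
  · rintro ⟨t, ⟨h0, ht⟩, hx⟩
    exact ⟨t 0, fun i => t i.succ, h0, ht, hx⟩
  · rintro ⟨m, s, hm, hs, hx⟩
    exact ⟨Fin.cons m s, ⟨by simpa using hm, by simpa using hs⟩, by simpa using hx⟩

/-- Stellar subdivision of an open simplicial cone. -/
theorem sum_openConicalSimplex_insert [DecidableEq (Fin (k + 1))] {v : Fin k → E n}
    (hv : LinearIndependent ℝ v) (hk : 0 < k) :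
    ∑ ρ ∈ Finset.univ.filter (· ≠ (Finset.univ : Finset (Fin k))),
      ind (openConicalSimplex (withSum v) (insert 0 (succSet ρ))) =
      ind (openConicalSimplex v Finset.univ) := by
  classical
  have hlin : LinearIndepOn ℝ v ((Finset.univ : Finset (Fin k)) : Set (Fin k)) := by
    simpa [linearIndepOn_univ_iff] using hv
  have hne : (Finset.univ : Finset (Fin k)).Nonempty := ⟨⟨0, hk⟩, Finset.mem_univ _⟩
  ext x
  rw [Finset.sum_apply, ind_apply]
  split_ifs with hx
  · obtain ⟨t, ht, hx⟩ := mem_openConicalSimplex_univ.1 hx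
    obtain ⟨i₀, -, hmin⟩ := Finset.exists_min_image Finset.univ t hne
    -- Removing the minimal coefficient times the sum of the generators leaves the indices above the
    -- minimum. The minimum is attained, so this is a proper subset, and no other piece contains the
    -- point.
    rw [Finset.sum_eq_single (Finset.univ.filter fun i => t i₀ < t i)]
    · rw [ind_apply, if_pos]
      refine mem_openConicalSimplex_insert.2 ⟨t i₀, fun i => t i - t i₀, ht i₀, fun i hi =>
        sub_pos.2 (Finset.mem_filter.1 hi).2, ?_⟩
      rw [hx]
      refine Finset.sum_congr rfl fun i _ => ?_
      congr 1
      have := hmin i (Finset.mem_univ i)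
      by_cases h : t i₀ < t i
      · simp [h]
      · simp [le_antisymm this (not_lt.1 h)]
    · intro ρ hρ hne'
      rw [ind_apply, if_neg]
      intro hmem
      obtain ⟨m, s, hm, hs, hxs⟩ := mem_openConicalSimplex_insert.1 hmem
      have heq := coeff_eq hlin (hx.symm.trans hxs)
      obtain ⟨j, hj⟩ : ∃ j, j ∉ ρ := by
        by_contra hc
        push Not at hc
        exact (Finset.mem_filter.1 hρ).2 (Finset.eq_univ_iff_forall.2 hc)
      have hge : ∀ i, m ≤ t i := by
        intro i
        rw [heq i (Finset.mem_univ i)]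
        split_ifs with hi
        · exact le_add_of_nonneg_right (hs i hi).le
        · rw [add_zero]
      have hmj : t j = m := by rw [heq j (Finset.mem_univ j), if_neg hj, add_zero]
      have hm0 : t i₀ = m := le_antisymm (hmj ▸ hmin j (Finset.mem_univ j)) (hge i₀)
      apply hne'
      ext i
      simp only [Finset.mem_filter, Finset.mem_univ, true_and, hm0]
      have hi' := heq i (Finset.mem_univ i)
      constructor
      · intro hi
        rw [if_pos hi] at hi'
        have := hs i hi
        linarith
      · intro hlt
        by_contra hi
        rw [if_neg hi] at hi'
        linarith
    · intro h
      refine absurd (Finset.mem_filter.2 ⟨Finset.mem_univ _, fun h => ?_⟩) h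
      have := h ▸ Finset.mem_univ i₀
      exact lt_irrefl _ (Finset.mem_filter.1 this).2
  · refine Finset.sum_eq_zero fun ρ _ => ?_
    rw [ind_apply, if_neg]
    intro hmem
    obtain ⟨m, s, hm, hs, hxs⟩ := mem_openConicalSimplex_insert.1 hmem
    refine hx (mem_openConicalSimplex_univ.2 ⟨_, fun i => ?_, hxs⟩)
    split_ifs with hi
    · exact add_pos hm (hs i hi)
    · rwa [add_zero]

/-- The proper faces without the vertex `0` will make up the closed simplex, and those with it the
subdivided open simplex. -/
theorem filter_ne_univ_succ [DecidableEq (Fin (k + 1))] {A : Type*} [AddCommGroup A]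
    (F : Finset (Fin (k + 1)) → A) :
    ∑ σ ∈ Finset.univ.filter (· ≠ (Finset.univ : Finset (Fin (k + 1)))), F σ =
      ∑ ρ : Finset (Fin k), F (succSet ρ) +
      ∑ ρ ∈ Finset.univ.filter (· ≠ (Finset.univ : Finset (Fin k))), F (insert 0 (succSet ρ)) := by
  classical
  have hinj : Function.Injective (succSet : Finset (Fin k) → _) := Finset.map_injective _
  have hinj' : Function.Injective fun ρ : Finset (Fin k) => insert 0 (succSet ρ) := by
    intro ρ ρ' h
    apply hinj
    have h1 := congrArg (fun s => Finset.erase s 0) h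
    simpa only [Finset.erase_insert (zero_notMem_succSet _)] using h1
  have h0 : ∀ σ : Finset (Fin (k + 1)), ∃ ρ, σ = succSet ρ ∨ σ = insert 0 (succSet ρ) := by
    intro σ
    refine ⟨Finset.univ.filter fun i => i.succ ∈ σ, ?_⟩
    by_cases h : 0 ∈ σ
    · right
      ext i
      refine Fin.cases ?_ (fun i => ?_) i
      · simp [h]
      · simp [succSet]
    · left
      ext i
      refine Fin.cases ?_ (fun i => ?_) i
      · simp [h, succSet]
      · simp [succSet]
  have huniv : insert 0 (succSet (Finset.univ : Finset (Fin k))) = Finset.univ := by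
    ext i
    refine Fin.cases ?_ (fun i => ?_) i <;> simp [succSet]
  rw [← Finset.sum_image (s := Finset.univ) (g := succSet) (f := F) hinj.injOn,
    ← Finset.sum_image (g := fun ρ => insert 0 (succSet ρ)) (f := F) hinj'.injOn,
    ← Finset.sum_union]
  · refine Finset.sum_congr ?_ fun _ _ => rfl
    ext σ
    simp only [Finset.mem_filter, Finset.mem_univ, true_and, Finset.mem_union, Finset.mem_image]
    constructor
    · intro hσ
      obtain ⟨ρ, h | h⟩ := h0 σ
      · exact Or.inl ⟨ρ, h.symm⟩
      · refine Or.inr ⟨ρ, ?_, h.symm⟩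
        rintro rfl
        exact hσ (h.trans huniv)
    · rintro (⟨ρ, rfl⟩ | ⟨ρ, hρ, rfl⟩)
      · intro h
        exact zero_notMem_succSet ρ (h ▸ Finset.mem_univ _)
      · rw [← huniv]
        exact fun h => hρ (hinj' h)
  · rw [Finset.disjoint_left]
    rintro _ h1 h2
    obtain ⟨ρ, -, rfl⟩ := Finset.mem_image.1 h1
    obtain ⟨ρ', -, h⟩ := Finset.mem_image.1 h2
    exact zero_notMem_succSet ρ (h ▸ Finset.mem_insert_self _ _)

theorem boundary_openSimplex {v : Fin k → E (n + 1)} (hv : LinearIndependent ℝ v) :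
    (boundary n (openSimplex v Finset.univ)).1 = openSimplex v Finset.univ -
      (-1 : ℤ) ^ (n + 1 + k) • ∑ ρ : Finset (Fin k), openSimplex v ρ := by
  have hlin : LinearIndepOn ℝ v ((Finset.univ : Finset (Fin k)) : Set (Fin k)) := by
    simpa [linearIndepOn_univ_iff] using hv
  rw [boundary_val, interior_openSimplex hlin, smul_smul, ← pow_add, Finset.card_univ,
    Fintype.card_fin, Finset.powerset_univ]

/-- For an open `k`-simplex the boundary is the open simplex minus `(-1)^(n+1+k)` times the closed
one. In the even case this is minus the sum of the proper open faces, a manifold cone of dimension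
`k - 1`. In the odd case it is the double of the simplex, of dimension `k`; subdividing one copy at
the sum of the generators presents it as the boundary complex on `k + 1` vectors. -/
theorem range_delta_le (n : ℕ) : (delta n).range ≤ manifoldSpan n := by
  classical
  rintro _ ⟨x, rfl⟩
  obtain ⟨f, rfl⟩ := cls_surjective _ x
  refine mem_of_openSimplex_mem
    (H := (manifoldSpan n).comap ((delta n).comp (cls (n + 1)))) (fun k v hv => ?_) f
  rw [AddSubgroup.mem_comap, AddMonoidHom.comp_apply]
  have hsub : ∀ ρ : Finset (Fin k), LinearIndepOn ℝ v (ρ : Set (Fin k)) := fun ρ =>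
    LinearIndependent.linearIndepOn hv _
  have hcard : k ≤ n + 1 := by
    have := hv.fintype_card_le_finrank
    simpa using this
  have hb := boundary_openSimplex hv
  rcases Nat.even_or_odd (n + 1 + k) with hpar | hpar
  · have hsplit : ∑ ρ : Finset (Fin k), openSimplex v ρ = openSimplex v Finset.univ +
        ∑ ρ ∈ Finset.univ.filter (· ≠ (Finset.univ : Finset (Fin k))), openSimplex v ρ := by
      rw [Finset.filter_ne', Finset.add_sum_erase _ _ (Finset.mem_univ _)]
    rw [hpar.neg_one_pow, one_smul, hsplit, sub_add_cancel_left] at hb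
    rcases k with _ | K
    -- The point has no proper faces, so its boundary is zero in this parity.
    · have h0 : boundary n (openSimplex v Finset.univ) = 0 := by
        apply Subtype.ext
        rw [hb, Finset.sum_eq_zero]
        · rw [neg_zero]; rfl
        · intro ρ hρ
          exact absurd (Subsingleton.elim _ _) (Finset.mem_filter.1 hρ).2
      rw [delta_cls, h0, map_zero]
      exact zero_mem _
    · refine delta_cls_mem_manifoldSpan (K := K) (by omega) ?_ v (fun σ _ => hsub σ) _ (-1) ?_
      · rw [Nat.even_iff] at hpar ⊢
        rw [Nat.even_iff]
        omega
      · rw [hb, neg_one_smul]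
  · rw [hpar.neg_one_pow, neg_one_smul, sub_neg_eq_add] at hb
    have hkn : k ≤ n := by
      rcases hcard.lt_or_eq with h | h
      · omega
      · rw [h, Nat.odd_iff] at hpar
        omega
    have hw := linearIndepOn_withSum hv
    have hsucc : ∀ ρ : Finset (Fin k), openSimplex (withSum v) (succSet ρ) = openSimplex v ρ := by
      intro ρ
      apply Subtype.ext
      rw [openSimplex_val (hsub ρ), openSimplex_val (hw _ _), openConicalSimplex_succSet]
      exact fun h => zero_notMem_succSet ρ (h ▸ Finset.mem_univ _)
    have hins : ∀ ρ : Finset (Fin k), ρ ≠ Finset.univ →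
        insert 0 (succSet ρ) ≠ Finset.univ := by
      intro ρ hρ h
      apply hρ
      refine Finset.eq_univ_iff_forall.2 fun i => ?_
      have := h ▸ Finset.mem_univ i.succ
      simpa [succSet] using this
    -- For `k = 0` the open and the closed simplex are the same point, so the boundary is twice the
    -- only face. For `k > 0` the stellar subdivision applies.
    refine delta_cls_mem_manifoldSpan hkn ?_ (withSum v) hw _ (if k = 0 then 2 else 1) ?_
    · rw [Nat.odd_iff] at hpar
      rw [Nat.even_iff, Nat.even_iff]
      omega
    · rw [hb, filter_ne_univ_succ, Finset.sum_congr rfl fun ρ _ => hsucc ρ]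
      split_ifs with hk
      · subst hk
        rw [Finset.sum_eq_zero (s := Finset.univ.filter _) fun ρ hρ =>
          absurd (Subsingleton.elim _ _) (Finset.mem_filter.1 hρ).2, add_zero]
        have : (Finset.univ : Finset (Finset (Fin 0))) = {Finset.univ} := rfl
        rw [this, Finset.sum_singleton, two_smul]
      · have hst : ∑ ρ ∈ Finset.univ.filter (· ≠ (Finset.univ : Finset (Fin k))),
            openSimplex (withSum v) (insert 0 (succSet ρ)) = openSimplex v Finset.univ := by
          apply Subtype.ext
          rw [AddSubgroup.val_finsetSum, openSimplex_val (hsub _),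
            ← sum_openConicalSimplex_insert hv (Nat.pos_of_ne_zero hk)]
          refine Finset.sum_congr rfl fun ρ hρ => ?_
          rw [openSimplex_val (hw _ (hins ρ (Finset.mem_filter.1 hρ).2))]
        rw [hst, one_smul]
        exact add_comm _ _

end Range

/-! ### Finitely generated cones are intersections of half-spaces -/

section FinitelyGenerated

variable {V : Type*} [NormedAddCommGroup V] [InnerProductSpace ℝ V]

/-- Fourier–Motzkin elimination: the sum of a convex cone and a ray is a convex cone. -/
theorem IsConvexCone.add_ray {C : Set V} (hC : IsConvexCone C) (v : V) :
    IsConvexCone {x | ∃ t : ℝ, 0 ≤ t ∧ x - t • v ∈ C} := by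
  classical
  obtain ⟨S, rfl⟩ := hC
  -- The inequalities that survive are those nonnegative on `v`, together with the positive
  -- combinations, one for each pair of opposite signs on `v`, that vanish on `v`.
  refine ⟨S.filter (fun w => 0 ≤ inner ℝ w v) ∪
    (S.filter (fun w => 0 < inner ℝ w v) ×ˢ S.filter fun w => inner ℝ w v < 0).image
      (fun p => (inner ℝ p.1 v : ℝ) • p.2 - (inner ℝ p.2 v : ℝ) • p.1), ?_⟩
  ext x
  have hin : ∀ (w : V) (t : ℝ), inner ℝ w (x - t • v) = inner ℝ w x - t * inner ℝ w v := by
    intro w t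
    rw [inner_sub_right, inner_smul_right]
  simp only [Set.mem_ofPred_eq, hin, sub_nonneg, Finset.forall_mem_union, Finset.forall_mem_image,
    Finset.mem_product, Finset.mem_filter, and_imp, inner_sub_left, inner_smul_left, conj_trivial,
    Prod.forall]
  constructor
  · rintro ⟨t, ht, h⟩
    refine ⟨fun w hw h0 => (mul_nonneg ht h0).trans (h w hw), fun p q hp hp0 hq hq0 => ?_⟩
    have h1 := mul_le_mul_of_nonneg_left (h q hq) hp0.le
    have h2 := mul_le_mul_of_nonpos_left (h p hp) hq0.le
    linarith
  · rintro ⟨h1, h2⟩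
    -- The inequalities negative on `v` are lower bounds for `t`. The choice is the largest of these
    -- bounds and `0`.
    have hne : (insert 0 ((S.filter fun w => inner ℝ w v < 0).image
        fun w => inner ℝ w x / inner ℝ w v)).Nonempty := Finset.insert_nonempty _ _
    obtain ⟨t, ht, hmax⟩ := Finset.exists_max_image _ id hne
    simp only [id] at hmax
    have ht0 : 0 ≤ t := hmax 0 (Finset.mem_insert_self _ _)
    refine ⟨t, ht0, fun w hw => ?_⟩
    rcases lt_trichotomy (inner ℝ w v) 0 with h | h | h
    · have := hmax _ (Finset.mem_insert_of_mem
        (Finset.mem_image_of_mem _ (Finset.mem_filter.2 ⟨hw, h⟩)))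
      rwa [div_le_iff_of_neg h] at this
    · rw [h, mul_zero]
      exact h1 w hw h.ge
    · rcases Finset.mem_insert.1 ht with rfl | ht
      · rw [zero_mul]
        exact h1 w hw h.le
      · obtain ⟨q, hq, rfl⟩ := Finset.mem_image.1 ht
        obtain ⟨hq, hq0⟩ := Finset.mem_filter.1 hq
        have := h2 w q hw h hq hq0
        rw [div_mul_eq_mul_div, div_le_iff_of_neg hq0]
        linarith

/-- The cone generated by a finite set. -/
def coneHull {W : Type*} [AddCommGroup W] [Module ℝ W] (S : Finset W) : Set W :=
  {x | ∃ c : W → ℝ, (∀ s ∈ S, 0 ≤ c s) ∧ x = ∑ s ∈ S, c s • s}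

/-- Adding one generator adds one ray, so Fourier–Motzkin elimination carries the induction. -/
theorem isConvexCone_coneHull [FiniteDimensional ℝ V] (S : Finset V) :
    IsConvexCone (coneHull S) := by
  classical
  induction S using Finset.induction_on with
  | empty =>
    convert isConvexCone_submodule (⊥ : Submodule ℝ V) using 1
    ext x
    simp [coneHull]
  | insert v S hv ih =>
    convert ih.add_ray v using 1
    ext x
    constructor
    · rintro ⟨c, hc, rfl⟩
      refine ⟨c v, hc v (Finset.mem_insert_self _ _), c,
        fun s hs => hc s (Finset.mem_insert_of_mem hs), ?_⟩
      rw [Finset.sum_insert hv, add_sub_cancel_left]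
    · rintro ⟨t, ht, c, hc, hx⟩
      refine ⟨Function.update c v t, ?_, ?_⟩
      · rw [Finset.forall_mem_insert, Function.update_self]
        refine ⟨ht, fun s hs => ?_⟩
        rw [Function.update_of_ne (ne_of_mem_of_not_mem hs hv)]
        exact hc s hs
      · rw [Finset.sum_insert hv, Function.update_self, Finset.sum_congr rfl fun s hs => by
          rw [Function.update_of_ne (ne_of_mem_of_not_mem hs hv)], ← hx]
        abel

end FinitelyGenerated

/-! ### The Euler characteristic with compact supports -/

section EulerCharacteristic

variable {V W : Type*} [NormedAddCommGroup V] [InnerProductSpace ℝ V]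
  [NormedAddCommGroup W] [InnerProductSpace ℝ W]

/-- The group generated by the open cells contained in `X`. -/
def cellSpan (X : Set V) : AddSubgroup (V → ℤ) :=
  AddSubgroup.closure {f | ∃ U, IsOpenCell U ∧ U ⊆ X ∧ f = ind U}

theorem cellSpan_mono {X Y : Set V} (h : X ⊆ Y) : cellSpan X ≤ cellSpan Y :=
  AddSubgroup.closure_mono fun _ ⟨U, hU, hX, hf⟩ => ⟨U, hU, hX.trans h, hf⟩

theorem ind_empty {X : Type*} : ind (∅ : Set X) = 0 := by
  classical
  ext x; simp [ind_apply]

/-- The cells of the decomposition must stay inside `C`, because the maps to which it will be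
applied are injective only there. -/
theorem IsConvexCone.ind_mem_cellSpan {C : Set V} (hC : IsConvexCone C) : ind C ∈ cellSpan C := by
  classical
  obtain ⟨S, rfl⟩ := hC
  suffices ∀ A B : Finset V, ind (cell A B ∩ {x : V | ∀ w ∈ S, 0 ≤ inner ℝ w x}) ∈
      cellSpan (cell A B ∩ {x : V | ∀ w ∈ S, 0 ≤ inner ℝ w x}) by
    have := this ∅ ∅
    simpa [cell] using this
  induction S using Finset.induction_on with
  | empty =>
    intro A B
    have e : cell A B ∩ {x : V | ∀ w ∈ (∅ : Finset V), 0 ≤ inner ℝ w x} = cell A B := by simp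
    rw [e]
    by_cases hne : (cell A B).Nonempty
    · exact AddSubgroup.subset_closure ⟨_, ⟨hne, A, B, rfl⟩, subset_rfl, rfl⟩
    · rw [Set.not_nonempty_iff_eq_empty] at hne
      rw [hne, ind_empty]; exact zero_mem _
  | insert w S hw ih =>
    intro A B
    have e : ind (cell A B ∩ {x : V | ∀ u ∈ insert w S, 0 ≤ inner ℝ u x}) =
        ind (cell (insert w A) B ∩ {x : V | ∀ u ∈ S, 0 ≤ inner ℝ u x}) +
        ind (cell A (insert w B) ∩ {x : V | ∀ u ∈ S, 0 ≤ inner ℝ u x}) := by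
      ext x
      simp only [ind_apply, Pi.add_apply, cell, Set.mem_inter_iff, Set.mem_ofPred_eq,
        Finset.forall_mem_insert]
      rcases lt_trichotomy (inner ℝ w x) 0 with h | h | h
      · simp [h.not_ge, h.ne, h.not_gt]
      · simp [h]
      · simp [h, h.le, h.ne']
    rw [e]
    refine add_mem (cellSpan_mono ?_ (ih _ _)) (cellSpan_mono ?_ (ih _ _))
    · rintro x ⟨⟨h1, h2⟩, h3⟩
      rw [Finset.forall_mem_insert] at h1
      refine ⟨⟨h1.2, h2⟩, ?_⟩
      change ∀ u ∈ insert w S, _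
      rw [Finset.forall_mem_insert]
      exact ⟨h1.1.ge, h3⟩
    · rintro x ⟨⟨h1, h2⟩, h3⟩
      rw [Finset.forall_mem_insert] at h2
      refine ⟨⟨h1, h2.2⟩, ?_⟩
      change ∀ u ∈ insert w S, _
      rw [Finset.forall_mem_insert]
      exact ⟨h2.1.le, h3⟩

theorem IsCone.ind_mem_cellSpan {P : Set V} (hP : IsCone P) : ind P ∈ cellSpan P := by
  classical
  obtain ⟨F, hF, hF', rfl⟩ := hP
  suffices ∀ D : Set V, IsConvexCone D → ind (⋃₀ F ∩ D) ∈ cellSpan (⋃₀ F) by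
    simpa using this _ isConvexCone_univ
  induction F, hF using Set.Finite.induction_on with
  | empty =>
    intro D _
    rw [Set.sUnion_empty, Set.empty_inter, ind_empty]; exact zero_mem _
  | @insert C F hC hfin ih =>
    intro D hD
    have ih' := ih (fun E hE => hF' E (Set.mem_insert_of_mem _ hE))
    have hC' := hF' C (Set.mem_insert _ _)
    have e : ind (⋃₀ (insert C F) ∩ D) =
        ind (C ∩ D) + ind (⋃₀ F ∩ D) - ind (⋃₀ F ∩ (C ∩ D)) := by
      ext x
      simp only [ind_apply, Pi.sub_apply, Pi.add_apply, Set.sUnion_insert, Set.mem_inter_iff,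
        Set.mem_union]
      by_cases h1 : x ∈ C <;> by_cases h2 : x ∈ D <;> by_cases h3 : x ∈ ⋃₀ F <;>
        simp [h1, h2, h3]
    have hsub : ⋃₀ F ⊆ ⋃₀ (insert C F) := Set.sUnion_mono (Set.subset_insert _ _)
    rw [e]
    refine sub_mem (add_mem ?_ (cellSpan_mono hsub (ih' D hD)))
      (cellSpan_mono hsub (ih' _ (hC'.inter hD)))
    refine cellSpan_mono ?_ (hC'.inter hD).ind_mem_cellSpan
    rw [Set.sUnion_insert]
    exact Set.inter_subset_left.trans Set.subset_union_left

variable [FiniteDimensional ℝ V] [FiniteDimensional ℝ W]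

/-- The Euler characteristic with compact supports. -/
noncomputable def eulerChar (V : Type*) [NormedAddCommGroup V] [InnerProductSpace ℝ V]
    [FiniteDimensional ℝ V] : coneGroup V →+ ℤ :=
  AddMonoidHom.mk' (fun f => (interiorMap V f).1 0) fun f g => by rw [map_add]; rfl

/-- The closure of every cell contains the origin, so the value of `I (U)` at the origin is just the
sign. -/
theorem eulerChar_openCell {U : Set V} (hU : IsOpenCell U) :
    eulerChar V ⟨ind U, hU.ind_mem⟩ = (-1) ^ Module.finrank ℝ (Submodule.span ℝ U) := by
  classical
  have h0 : (0 : V) ∈ closure U := by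
    obtain ⟨hne, A, B, rfl⟩ := hU
    rw [closure_cell hne]
    simp
  change (interiorMap V ⟨ind U, hU.ind_mem⟩).1 0 = _
  rw [interior_apply hU, Pi.smul_apply, ind_apply, if_pos h0, smul_eq_mul, mul_one]

/-- The Euler characteristic of a cone is invariant under linear maps that are injective on
the cone. -/
theorem eulerChar_image (T : V →ₗ[ℝ] W) {P : Set V} (hP : IsCone P) (hT : Set.InjOn T P) :
    ∃ h : ind (T '' P) ∈ coneGroup W,
      eulerChar W ⟨ind (T '' P), h⟩ = eulerChar V ⟨ind P, hP.ind_mem⟩ := by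
  classical
  -- The push forward `g` of `f` is built cell by cell, which keeps track of the Euler
  -- characteristic. Its values on `T '' P` and off it determine it, so for the characteristic
  -- function of `P` it must be that of the image.
  have key : ∀ f ∈ cellSpan P, ∃ (hf : f ∈ coneGroup V) (g : coneGroup W),
      (∀ x ∈ P, g.1 (T x) = f x) ∧ (∀ y, y ∉ T '' P → g.1 y = 0) ∧
      eulerChar W g = eulerChar V ⟨f, hf⟩ := by
    intro f hf
    induction hf using AddSubgroup.closure_induction with
    | mem f hf =>
      obtain ⟨U, hU, hUP, rfl⟩ := hf
      have hTU := hT.mono hUP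
      have hU' := hU.image T hTU
      refine ⟨hU.ind_mem, ⟨_, hU'.ind_mem⟩, fun x hx => ?_, fun y hy => ?_, ?_⟩
      · simp only [ind_apply]
        refine if_congr ⟨?_, fun h => ⟨x, h, rfl⟩⟩ rfl rfl
        rintro ⟨x', hx', h⟩
        rwa [← hT (hUP hx') hx h]
      · change ind _ y = 0
        rw [ind_apply, if_neg]
        exact fun h => hy (Set.image_mono hUP h)
      · rw [eulerChar_openCell hU, eulerChar_openCell hU', finrank_span_image T hU hTU]
    | zero =>
      exact ⟨zero_mem _, 0, fun _ _ => rfl, fun _ _ => rfl, (map_zero _).trans (map_zero _).symm⟩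
    | add a b _ _ ha hb =>
      obtain ⟨ha, g, hg1, hg2, hg3⟩ := ha
      obtain ⟨hb, g', hg1', hg2', hg3'⟩ := hb
      refine ⟨add_mem ha hb, g + g', fun x hx => ?_, fun y hy => ?_, ?_⟩
      · exact congrArg₂ (· + ·) (hg1 x hx) (hg1' x hx)
      · change g.1 y + g'.1 y = 0
        rw [hg2 y hy, hg2' y hy, add_zero]
      · rw [map_add, hg3, hg3', ← map_add]; rfl
    | neg a _ ha =>
      obtain ⟨ha, g, hg1, hg2, hg3⟩ := ha
      refine ⟨neg_mem ha, -g, fun x hx => ?_, fun y hy => ?_, ?_⟩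
      · exact congrArg (- ·) (hg1 x hx)
      · change -g.1 y = 0
        rw [hg2 y hy, neg_zero]
      · rw [map_neg, hg3, ← map_neg]; rfl
  obtain ⟨hf, g, hg1, hg2, hg3⟩ := key _ hP.ind_mem_cellSpan
  have e : g.1 = ind (T '' P) := by
    funext y
    rw [ind_apply]
    split_ifs with hy
    · obtain ⟨x, hx, rfl⟩ := hy
      rw [hg1 x hx, ind_apply, if_pos hx]
    · exact hg2 y hy
  refine ⟨e ▸ g.2, ?_⟩
  rw [← hg3]
  exact congrArg _ (Subtype.ext e.symm)

end EulerCharacteristic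

/-! ### Cones of directions of polytopes and of piecewise linear manifolds -/

section DirectionCone

variable {A B : Type*} [NormedAddCommGroup A] [NormedSpace ℝ A]
  [NormedAddCommGroup B] [NormedSpace ℝ B]

/-- The cone of directions in which one can leave the point `z` while staying in `X`. -/
def dirCone (X : Set A) (z : A) : Set A :=
  {v | ∀ᶠ t in nhdsWithin (0 : ℝ) (Set.Ioi 0), z + t • v ∈ X}

theorem mem_dirCone {X : Set A} {z v : A} :
    v ∈ dirCone X z ↔ ∀ᶠ t in nhdsWithin (0 : ℝ) (Set.Ioi 0), z + t • v ∈ X := Iff.rfl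

theorem tendsto_add_smul (z v : A) :
    Filter.Tendsto (fun t : ℝ => z + t • v) (nhdsWithin (0 : ℝ) (Set.Ioi 0)) (nhds z) := by
  have h : Filter.Tendsto (fun t : ℝ => z + t • v) (nhds 0) (nhds (z + (0 : ℝ) • v)) :=
    Continuous.tendsto (by fun_prop) 0
  rw [zero_smul, add_zero] at h
  exact h.mono_left nhdsWithin_le_nhds

theorem dirCone_eq_of_mem_nhdsWithin {X Y : Set A} {z : A} (h : Y ⊆ X)
    (hY : Y ∈ nhdsWithin z X) : dirCone Y z = dirCone X z := by
  refine Set.Subset.antisymm (fun v hv => (mem_dirCone.1 hv).mono fun t ht => h ht)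
    fun v hv => ?_
  exact (tendsto_nhdsWithin_iff.2 ⟨tendsto_add_smul z v, hv⟩).eventually hY

theorem dirCone_eq_univ {Y : Set A} {z : A} (hY : Y ∈ nhds z) : dirCone Y z = Set.univ :=
  Set.eq_univ_of_forall fun v => (tendsto_add_smul z v).eventually hY

/-- By finiteness, the image of a single hull contains the points `π z + t • v` for arbitrarily
small `t`. It is compact, so it contains the limit `π z`, and injectivity puts `z` itself in that
hull. -/
theorem exists_segment_of_mem_dirCone {F : Set (Finset A)} (hF : F.Finite) (π : A →L[ℝ] B)
    (hπ : Set.InjOn π (⋃ S ∈ F, convexHull ℝ (S : Set A))) {z : A}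
    (hz : z ∈ ⋃ S ∈ F, convexHull ℝ (S : Set A)) {v : B}
    (hv : v ∈ dirCone (π '' ⋃ S ∈ F, convexHull ℝ (S : Set A)) (π z)) :
    ∃ S ∈ F, z ∈ convexHull ℝ (S : Set A) ∧
      ∃ t : ℝ, 0 < t ∧ ∃ p ∈ convexHull ℝ (S : Set A), π p = π z + t • v := by
  obtain ⟨S, hS, hfreq⟩ : ∃ S ∈ F, ∃ᶠ t in nhdsWithin (0 : ℝ) (Set.Ioi 0),
      π z + t • v ∈ π '' convexHull ℝ (S : Set A) := by
    by_contra hc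
    push Not at hc
    have hall := (Filter.eventually_all_finite hF).2 fun S hS => hc S hS
    obtain ⟨t, ht1, ht2⟩ := ((mem_dirCone.1 hv).and hall).exists
    obtain ⟨p, hp, hpt⟩ := ht1
    obtain ⟨S, hS, hpS⟩ := Set.mem_iUnion₂.1 hp
    exact ht2 S hS ⟨p, hpS, hpt⟩
  have hcl : π z ∈ π '' convexHull ℝ (S : Set A) :=
    ((S.finite_toSet.isCompact_convexHull ℝ).image π.continuous).isClosed.mem_of_frequently_of_tendsto
      hfreq (tendsto_add_smul _ _)
  obtain ⟨q, hq, hqz⟩ := hcl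
  have hqz' : q = z := hπ (Set.mem_biUnion hS hq) hz hqz
  obtain ⟨t, ⟨p, hp, hpt⟩, ht⟩ := (hfreq.and_eventually self_mem_nhdsWithin).exists
  exact ⟨S, hS, hqz' ▸ hq, t, ht, p, hp, hpt⟩

theorem mem_dirCone_of_segment {F : Set (Finset A)} {S : Finset A} (hS : S ∈ F) {z p : A}
    (hz : z ∈ convexHull ℝ (S : Set A)) (hp : p ∈ convexHull ℝ (S : Set A)) {t : ℝ} (ht : 0 < t) :
    t⁻¹ • (p - z) ∈ dirCone (⋃ S ∈ F, convexHull ℝ (S : Set A)) z := by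
  filter_upwards [Ioc_mem_nhdsGT ht] with s hs
  refine Set.mem_biUnion hS ?_
  rw [smul_smul]
  exact (convex_convexHull ℝ _).add_smul_sub_mem hz hp
    ⟨by have := hs.1; positivity, by rw [← div_eq_mul_inv]; exact (div_le_one ht).2 hs.2⟩

/-- A direction in the image is realized by a segment starting at `z` inside one convex hull.
Convexity keeps all shorter steps in the polytope, so the direction lifts. -/
theorem image_dirCone {F : Set (Finset A)} (hF : F.Finite) (π : A →L[ℝ] B)
    (hπ : Set.InjOn π (⋃ S ∈ F, convexHull ℝ (S : Set A))) {z : A}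
    (hz : z ∈ ⋃ S ∈ F, convexHull ℝ (S : Set A)) :
    π '' dirCone (⋃ S ∈ F, convexHull ℝ (S : Set A)) z =
      dirCone (π '' ⋃ S ∈ F, convexHull ℝ (S : Set A)) (π z) := by
  refine Set.Subset.antisymm ?_ fun v hv => ?_
  · rintro _ ⟨u, hu, rfl⟩
    -- Linearity sends a small step along `u` to the same step along its image.
    exact (mem_dirCone.1 hu).mono fun t ht => ⟨_, ht, by rw [map_add, map_smul]⟩
  · obtain ⟨S, hS, hzS, t, ht, p, hp, hpt⟩ := exists_segment_of_mem_dirCone hF π hπ hz hv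
    refine ⟨_, mem_dirCone_of_segment hS hzS hp ht, ?_⟩
    rw [map_smul, map_sub, hpt, add_sub_cancel_left, smul_smul, inv_mul_cancel₀ ht.ne', one_smul]

theorem injOn_dirCone {X : Set A} (π : A →L[ℝ] B) (hπ : Set.InjOn π X) (z : A) :
    Set.InjOn π (dirCone X z) := by
  intro u hu v hv huv
  obtain ⟨t, ⟨h1, h2⟩, ht⟩ := (((mem_dirCone.1 hu).and (mem_dirCone.1 hv)).and self_mem_nhdsWithin).exists
  have := hπ h1 h2 (by rw [map_add, map_add, map_smul, map_smul, huv])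
  exact smul_right_injective A (ne_of_gt ht) (add_left_cancel this)

theorem dirCone_polytope [DecidableEq A] {F : Set (Finset A)} (hF : F.Finite) {z : A}
    (hz : z ∈ ⋃ S ∈ F, convexHull ℝ (S : Set A)) :
    dirCone (⋃ S ∈ F, convexHull ℝ (S : Set A)) z =
      ⋃ S ∈ {S ∈ F | z ∈ convexHull ℝ (S : Set A)}, coneHull (S.image (· - z)) := by
  have hinj : Function.Injective (· - z : A → A) := sub_left_injective
  refine Set.Subset.antisymm (fun v hv => ?_) fun v hv => ?_
  · obtain ⟨S, hS, hzS, t, ht, p, hp, hpt⟩ := exists_segment_of_mem_dirCone hF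
      (ContinuousLinearMap.id ℝ A) (fun x _ y _ h => h) hz (v := v) (by
        rw [ContinuousLinearMap.coe_id', Set.image_id]; exact hv)
    refine Set.mem_biUnion (x := S) ⟨hS, hzS⟩ ?_
    obtain ⟨w, hw0, hw1, rfl⟩ := Finset.mem_convexHull'.1 hp
    refine ⟨fun s => t⁻¹ * w (s + z), ?_, ?_⟩
    · rw [Finset.forall_mem_image]
      intro s hs
      beta_reduce
      rw [sub_add_cancel]
      exact mul_nonneg (inv_nonneg.2 ht.le) (hw0 s hs)
    · rw [Finset.sum_image hinj.injOn]
      simp only [sub_add_cancel, smul_sub, mul_smul, Finset.sum_sub_distrib, ← Finset.smul_sum,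
        ← Finset.sum_smul, hw1, one_smul]
      have h2 : ∑ y ∈ S, w y • y = z + t • v := hpt
      rw [h2, smul_add, smul_smul, inv_mul_cancel₀ ht.ne', one_smul, add_sub_cancel_left]
  · obtain ⟨S, ⟨hS, hzS⟩, c, hc, rfl⟩ := Set.mem_iUnion₂.1 hv
    rw [Finset.forall_mem_image] at hc
    obtain ⟨w, hw0, hw1, hw⟩ := Finset.mem_convexHull'.1 hzS
    have hC0 : 0 ≤ ∑ s ∈ S, c (s - z) := Finset.sum_nonneg fun s hs => hc hs
    set C := ∑ s ∈ S, c (s - z) with hC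
    have hpos : 0 < (C + 1)⁻¹ := by positivity
    filter_upwards [Ioc_mem_nhdsGT hpos] with t ht
    have htC : t * C ≤ 1 := by
      have h1 : t * (C + 1) ≤ 1 := by
        have := mul_le_mul_of_nonneg_right ht.2 (by linarith : 0 ≤ C + 1)
        rwa [inv_mul_cancel₀ (by linarith)] at this
      have := ht.1
      linarith
    -- The step `z + t • v` is rewritten with the barycentric weights of `z` scaled by `1 - t C`.
    -- The bound `t ≤ (C + 1)⁻¹` keeps them nonnegative.
    refine Set.mem_biUnion hS (Finset.mem_convexHull'.2
      ⟨fun s => (1 - t * C) * w s + t * c (s - z), fun s hs => ?_, ?_, ?_⟩)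
    · have h1 := mul_nonneg (by linarith : 0 ≤ 1 - t * C) (hw0 s hs)
      have h2 := mul_nonneg ht.1.le (hc hs)
      exact add_nonneg h1 h2
    · rw [Finset.sum_add_distrib, ← Finset.mul_sum, ← Finset.mul_sum, hw1, ← hC]
      ring
    · rw [Finset.sum_image hinj.injOn]
      simp only [add_smul, mul_smul, Finset.sum_add_distrib, ← Finset.smul_sum, hw, smul_sub,
        Finset.sum_sub_distrib, ← Finset.sum_smul, ← hC]
      module

theorem image_coneHull {A B : Type*} [AddCommGroup A] [Module ℝ A] [AddCommGroup B] [Module ℝ B]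
    [DecidableEq B] (T : A →ₗ[ℝ] B) (hT : Function.Injective T) (S : Finset A) :
    T '' coneHull S = coneHull (S.image T) := by
  ext y
  constructor
  · rintro ⟨_, ⟨c, hc, rfl⟩, rfl⟩
    refine ⟨fun b => c (Function.invFun T b), ?_, ?_⟩
    · rw [Finset.forall_mem_image]
      intro s hs
      beta_reduce
      rw [Function.leftInverse_invFun hT]
      exact hc s hs
    · rw [Finset.sum_image hT.injOn, map_sum]
      exact Finset.sum_congr rfl fun s _ => by
        beta_reduce
        rw [map_smul, Function.leftInverse_invFun hT]
  · rintro ⟨c, hc, rfl⟩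
    rw [Finset.forall_mem_image] at hc
    refine ⟨_, ⟨fun s => c (T s), fun s hs => hc hs, rfl⟩, ?_⟩
    rw [Finset.sum_image hT.injOn, map_sum]
    exact Finset.sum_congr rfl fun s _ => by rw [map_smul]

theorem isCone_image_dirCone {V : Type*} [NormedAddCommGroup V] [InnerProductSpace ℝ V]
    [FiniteDimensional ℝ V] {F : Set (Finset A)} (hF : F.Finite) {z : A}
    (hz : z ∈ ⋃ S ∈ F, convexHull ℝ (S : Set A)) (T : A →ₗ[ℝ] V) (hT : Function.Injective T) :
    IsCone (T '' dirCone (⋃ S ∈ F, convexHull ℝ (S : Set A)) z) := by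
  classical
  refine ⟨(fun S : Finset A => T '' coneHull (S.image (· - z))) ''
    {S ∈ F | z ∈ convexHull ℝ (S : Set A)}, (hF.subset fun S hS => hS.1).image _, ?_, ?_⟩
  · rintro _ ⟨S, -, rfl⟩
    simp only [image_coneHull T hT]
    exact isConvexCone_coneHull _
  · rw [dirCone_polytope hF hz, Set.sUnion_image, Set.image_iUnion₂]

/-- The cone of directions at a point of a piecewise linear manifold of dimension `m` has the Euler
characteristic of `ℝᵐ`. -/
theorem eulerChar_dirCone {N m : ℕ} {X : Set (Fin N → ℝ)}
    (hX : IsPLManifoldWithoutBoundary m X) {x : Fin N → ℝ} (hx : x ∈ X) :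
    ∃ h : ind ((WithLp.linearEquiv 2 ℝ (Fin N → ℝ)).symm '' dirCone X x) ∈ coneGroup (E N),
      eulerChar (E N) ⟨_, h⟩ = (-1) ^ m := by
  obtain ⟨Γ, ⟨F, hF, rfl⟩, h1, h2, hsub, hnhds, y, hxy, hy⟩ := hX x hx
  let Γ := ⋃ S ∈ F, convexHull ℝ (S : Set ((Fin N → ℝ) × (Fin m → ℝ)))
  -- Cone groups need an inner product, so the ambient space of the graph is transported to a
  -- Euclidean space. Only the linear structure matters, since Euler characteristics are compared
  -- through injective linear maps.
  let e := (toEuclidean (E := (Fin N → ℝ) × (Fin m → ℝ))).toLinearEquiv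
  let D := dirCone Γ (x, y)
  have hD : IsCone (e '' D) := isCone_image_dirCone hF hxy e.toLinearMap e.injective
  -- The cone of directions of the graph projects bijectively to that of `X` on one side and to all
  -- of `ℝᵐ` on the other.
  have hD1 : Prod.fst '' D = dirCone X x :=
    (image_dirCone hF (ContinuousLinearMap.fst ℝ _ _) h1 hxy).trans
      (dirCone_eq_of_mem_nhdsWithin hsub hnhds)
  have hD2 : Prod.snd '' D = Set.univ :=
    (image_dirCone hF (ContinuousLinearMap.snd ℝ _ _) h2 hxy).trans (dirCone_eq_univ hy)
  have hi1 : Set.InjOn Prod.fst D := injOn_dirCone (X := Γ) (ContinuousLinearMap.fst ℝ _ _) h1 _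
  have hi2 : Set.InjOn Prod.snd D := injOn_dirCone (X := Γ) (ContinuousLinearMap.snd ℝ _ _) h2 _
  let T1 := (WithLp.linearEquiv 2 ℝ (Fin N → ℝ)).symm.toLinearMap ∘ₗ
    LinearMap.fst ℝ _ (Fin m → ℝ) ∘ₗ e.symm.toLinearMap
  let T2 := (WithLp.linearEquiv 2 ℝ (Fin m → ℝ)).symm.toLinearMap ∘ₗ
    LinearMap.snd ℝ (Fin N → ℝ) _ ∘ₗ e.symm.toLinearMap
  have hT1 : ∀ d, T1 (e d) = (WithLp.linearEquiv 2 ℝ (Fin N → ℝ)).symm d.1 := fun d => by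
    change (WithLp.linearEquiv 2 ℝ (Fin N → ℝ)).symm (e.symm (e d)).1 = _
    rw [e.symm_apply_apply]
  have hT2 : ∀ d, T2 (e d) = (WithLp.linearEquiv 2 ℝ (Fin m → ℝ)).symm d.2 := fun d => by
    change (WithLp.linearEquiv 2 ℝ (Fin m → ℝ)).symm (e.symm (e d)).2 = _
    rw [e.symm_apply_apply]
  have hI1 : T1 '' (e '' D) = (WithLp.linearEquiv 2 ℝ (Fin N → ℝ)).symm '' dirCone X x := by
    rw [← hD1, Set.image_image, Set.image_image]
    exact Set.image_congr fun d _ => hT1 d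
  have hI2 : T2 '' (e '' D) = Set.univ := by
    rw [Set.image_image, Set.image_congr fun d _ => hT2 d, ← Set.image_image
      (fun y => (WithLp.linearEquiv 2 ℝ (Fin m → ℝ)).symm y) Prod.snd, hD2, Set.image_univ]
    exact (WithLp.linearEquiv 2 ℝ (Fin m → ℝ)).symm.surjective.range_eq
  have hJ1 : Set.InjOn T1 (e '' D) := by
    rintro _ ⟨d, hd, rfl⟩ _ ⟨d', hd', rfl⟩ h
    rw [hT1, hT1] at h
    rw [hi1 hd hd' ((WithLp.linearEquiv 2 ℝ (Fin N → ℝ)).symm.injective h)]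
  have hJ2 : Set.InjOn T2 (e '' D) := by
    rintro _ ⟨d, hd, rfl⟩ _ ⟨d', hd', rfl⟩ h
    rw [hT2, hT2] at h
    rw [hi2 hd hd' ((WithLp.linearEquiv 2 ℝ (Fin m → ℝ)).symm.injective h)]
  obtain ⟨m1, e1⟩ := eulerChar_image T1 hD hJ1
  obtain ⟨m2, e2⟩ := eulerChar_image T2 hD hJ2
  have huniv : IsOpenCell (Set.univ : Set (E m)) := ⟨Set.univ_nonempty, ∅, ∅, by simp [cell]⟩
  refine ⟨hI1 ▸ m1, ?_⟩
  refine (congrArg (eulerChar (E N)) (Subtype.ext (congrArg ind hI1.symm))).trans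
    (e1.trans (e2.symm.trans ((congrArg (eulerChar (E m)) (Subtype.ext (congrArg ind hI2))).trans
      ((eulerChar_openCell huniv).trans ?_))))
  rw [Submodule.span_univ, finrank_top, finrank_euclideanSpace_fin]

end DirectionCone

/-! ### The Euler condition for triangulated manifold cones -/

section EulerCondition

/-- The tangent cone along the open simplex with vertices `τ` of a simplex with vertices `σ`. -/
def starCell {N : ℕ} (τ σ : Finset (Fin N)) : Set (E N) :=
  {v | (∀ i, i ∉ σ → v i = 0) ∧ ∀ i ∈ σ, i ∉ τ → 0 < v i}

theorem starCell_eq_cell {N : ℕ} (τ σ : Finset (Fin N)) : starCell τ σ =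
    cell (σᶜ.image fun i => EuclideanSpace.single i (1 : ℝ))
      ((σ \ τ).image fun i => EuclideanSpace.single i (1 : ℝ)) := by
  ext v
  simp only [starCell, cell, Set.mem_ofPred_eq, Finset.forall_mem_image, Finset.mem_compl,
    Finset.mem_sdiff, EuclideanSpace.inner_single_left, map_one, one_mul, and_imp]

theorem starCell_nonempty {N : ℕ} (τ σ : Finset (Fin N)) : (starCell τ σ).Nonempty := by
  refine ⟨WithLp.toLp 2 fun i => if i ∈ σ then 1 else 0, fun i hi => ?_, fun i hi _ => ?_⟩
  · exact if_neg hi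
  · change (0 : ℝ) < if i ∈ σ then 1 else 0
    rw [if_pos hi]; exact one_pos

theorem isOpenCell_starCell {N : ℕ} (τ σ : Finset (Fin N)) : IsOpenCell (starCell τ σ) :=
  ⟨starCell_nonempty τ σ, _, _, starCell_eq_cell τ σ⟩

/-- The span does not depend on `τ`, and for `τ = ∅` the cell is the open simplex on the standard
basis vectors indexed by `σ`. -/
theorem finrank_span_starCell {N : ℕ} (τ σ : Finset (Fin N)) :
    Module.finrank ℝ (Submodule.span ℝ (starCell τ σ)) = σ.card := by
  have hli : LinearIndependent ℝ fun i : Fin N => (EuclideanSpace.single i (1 : ℝ) : E N) :=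
    (EuclideanSpace.orthonormal_single (𝕜 := ℝ) (ι := Fin N)).linearIndependent
  rw [← finrank_span_openConicalSimplex (LinearIndependent.linearIndepOn hli (σ : Set (Fin N)))]
  have hspan : ∀ ρ : Finset (Fin N), ∀ x, x ∈ Submodule.span ℝ (starCell ρ σ) ↔
      ∀ i, i ∉ σ → x i = 0 := by
    intro ρ x
    have hne := starCell_nonempty ρ σ
    rw [starCell_eq_cell] at hne ⊢
    rw [mem_span_cell hne]
    simp only [Finset.forall_mem_image, Finset.mem_compl, EuclideanSpace.inner_single_left,
      map_one, one_mul]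
  have h1 : Submodule.span ℝ (starCell τ σ) = Submodule.span ℝ (starCell ∅ σ) := by
    ext x; rw [hspan, hspan]
  have hsum : ∀ (t : Fin N → ℝ) (i : Fin N),
      (∑ j ∈ σ, t j • (EuclideanSpace.single j (1 : ℝ) : E N)) i = if i ∈ σ then t i else 0 := by
    intro t i
    simp [Finset.sum_apply, Pi.single_apply]
  have h2 : starCell ∅ σ = openConicalSimplex (fun i => EuclideanSpace.single i (1 : ℝ)) σ := by
    ext v
    constructor
    · rintro ⟨h1, h2⟩
      refine ⟨v, fun i hi => h2 i hi (by simp), ?_⟩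
      ext i
      rw [hsum]
      split_ifs with hi
      · rfl
      · exact h1 i hi
    · rintro ⟨t, ht, rfl⟩
      refine ⟨fun i hi => by rw [hsum, if_neg hi], fun i hi _ => ?_⟩
      rw [hsum, if_pos hi]
      exact ht i hi
  rw [h1, h2]

namespace EuclideanCone

variable {n : ℕ} (M : EuclideanCone n)

/-- For small `t > 0` the coordinates in `τ` stay positive, and the others have the sign of `v`.
Membership of the moved point is therefore eventually independent of `t`. -/
theorem mem_dirCone_space {τ : Finset (Fin M.N)} {v : Fin M.N → ℝ} :
    v ∈ dirCone M.space (fun i => if i ∈ τ then 1 else 0) ↔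
      (∀ i, i ∉ τ → 0 ≤ v i) ∧ τ ∪ Finset.univ.filter (fun i => v i ≠ 0) ∈ M.faces := by
  refine mem_dirCone.trans (Iff.trans (Filter.eventually_congr ?_)
    (Filter.eventually_const (f := nhdsWithin (0 : ℝ) (Set.Ioi 0))))
  have hpos : ∀ᶠ t in nhdsWithin (0 : ℝ) (Set.Ioi 0), ∀ i, 0 < 1 + t * v i := by
    refine Filter.eventually_all.2 fun i => ?_
    have := (tendsto_add_smul (1 : ℝ) (v i)).eventually (lt_mem_nhds one_pos)
    exact this
  filter_upwards [hpos, self_mem_nhdsWithin] with t ht ht0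
  have ht0 : 0 < t := ht0
  refine and_congr ?_ ?_
  · refine forall_congr' fun i => ?_
    change 0 ≤ (if i ∈ τ then 1 else 0) + t * v i ↔ _
    by_cases hi : i ∈ τ
    · rw [if_pos hi]
      exact iff_of_true (ht i).le fun h => absurd hi h
    · rw [if_neg hi, zero_add, mul_nonneg_iff_of_pos_left ht0]
      exact ⟨fun h _ => h, fun h => h hi⟩
  · refine iff_of_eq (congrArg (· ∈ M.faces) ?_)
    ext i
    rw [Finset.mem_union, Finset.mem_filter, Finset.mem_filter]
    change _ ∧ (if i ∈ τ then (1 : ℝ) else 0) + t * v i ≠ 0 ↔ _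
    by_cases hi : i ∈ τ
    · simp only [hi, true_or, iff_true, Finset.mem_univ, true_and]
      exact (ht i).ne'
    · simp [hi, ht0.ne']

/-- The Euler condition for the triangulation of an interior manifold cone. -/
theorem sum_neg_one_pow_card {m : ℕ} (hM : IsPLManifoldWithoutBoundary m M.space)
    {τ : Finset (Fin M.N)} (hτ : τ ∈ M.faces) :
    ∑ σ ∈ M.faces.filter (τ ⊆ ·), (-1 : ℤ) ^ σ.card = (-1) ^ m := by
  classical
  -- The base point is the sum of the vertices of `τ`, which lies in the open face `τ`.
  have hx : (fun i => if i ∈ τ then (1 : ℝ) else 0) ∈ M.space := by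
    refine ⟨fun i => by positivity, ?_⟩
    convert hτ using 1
    ext i
    simp
  obtain ⟨h, he⟩ := eulerChar_dirCone hM hx
  -- The cone of directions is the disjoint union of the star cells of the faces containing `τ`,
  -- since `τ` together with the support of a direction determines the face.
  have hsum : (⟨_, h⟩ : coneGroup (E M.N)) =
      ∑ σ ∈ M.faces.filter (τ ⊆ ·), ⟨ind (starCell τ σ), (isOpenCell_starCell τ σ).ind_mem⟩ := by
    apply Subtype.ext
    rw [AddSubgroup.val_finsetSum]
    funext w
    obtain ⟨v, rfl⟩ := (WithLp.linearEquiv 2 ℝ (Fin M.N → ℝ)).symm.surjective w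
    rw [Finset.sum_apply]
    change ind _ _ = ∑ σ ∈ M.faces.filter (τ ⊆ ·), ind (starCell τ σ) _
    simp only [ind_apply]
    have hmem : (WithLp.linearEquiv 2 ℝ (Fin M.N → ℝ)).symm v ∈
        (WithLp.linearEquiv 2 ℝ (Fin M.N → ℝ)).symm ''
          dirCone M.space (fun i => if i ∈ τ then 1 else 0) ↔
        (∀ i, i ∉ τ → 0 ≤ v i) ∧ τ ∪ Finset.univ.filter (fun i => v i ≠ 0) ∈ M.faces := by
      rw [← mem_dirCone_space]
      exact (WithLp.linearEquiv 2 ℝ (Fin M.N → ℝ)).symm.injective.mem_set_image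
    have hcell : ∀ σ, τ ⊆ σ → ((WithLp.linearEquiv 2 ℝ (Fin M.N → ℝ)).symm v ∈ starCell τ σ ↔
        (∀ i, i ∉ τ → 0 ≤ v i) ∧ τ ∪ Finset.univ.filter (fun i => v i ≠ 0) = σ) := by
      intro σ hσ
      change ((∀ i, i ∉ σ → v i = 0) ∧ ∀ i ∈ σ, i ∉ τ → 0 < v i) ↔ _
      constructor
      · rintro ⟨h1, h2⟩
        refine ⟨fun i hi => ?_, ?_⟩
        · by_cases hiσ : i ∈ σ
          · exact (h2 i hiσ hi).le
          · exact (h1 i hiσ).ge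
        · ext i
          simp only [Finset.mem_union, Finset.mem_filter, Finset.mem_univ, true_and]
          constructor
          · rintro (hi | hi)
            · exact hσ hi
            · by_contra hiσ
              exact hi (h1 i hiσ)
          · intro hi
            by_cases hiτ : i ∈ τ
            · exact Or.inl hiτ
            · exact Or.inr (h2 i hi hiτ).ne'
      · rintro ⟨h1, rfl⟩
        simp only [Finset.mem_union, Finset.mem_filter, Finset.mem_univ, true_and, not_or, not_not]
        refine ⟨fun i hi => hi.2, fun i hi hiτ => lt_of_le_of_ne (h1 i hiτ) ?_⟩
        exact (hi.resolve_left hiτ).symm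
    rw [Finset.sum_congr rfl fun σ hσ => if_congr (hcell σ (Finset.mem_filter.1 hσ).2) rfl rfl]
    by_cases hv : (∀ i, i ∉ τ → 0 ≤ v i) ∧
        τ ∪ Finset.univ.filter (fun i => v i ≠ 0) ∈ M.faces
    · rw [if_pos (hmem.2 hv), Finset.sum_eq_single_of_mem _ (Finset.mem_filter.2
        ⟨hv.2, Finset.subset_union_left⟩), if_pos ⟨hv.1, rfl⟩]
      exact fun σ _ hne => if_neg fun h => hne h.2.symm
    · rw [if_neg fun h => hv (hmem.1 h), Finset.sum_eq_zero]
      intro σ hσ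
      refine if_neg ?_
      rintro ⟨h1, rfl⟩
      exact hv ⟨h1, (Finset.mem_filter.1 hσ).1⟩
  rw [← he, hsum, map_sum]
  refine Finset.sum_congr rfl fun σ _ => ?_
  rw [eulerChar_openCell (isOpenCell_starCell τ σ), finrank_span_starCell]

end EuclideanCone

end EulerCondition

/-! ### Classes of simplices and their dependence on the Gram matrix -/

section Gram

variable {N n : ℕ}

/-- Two systems of vectors with the same Gram matrix are related by an isometry. -/
theorem exists_isometry_of_inner_eq {u w : Fin N → E n} {τ : Finset (Fin N)}
    (hu : LinearIndepOn ℝ u (τ : Set (Fin N)))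
    (h : ∀ i ∈ τ, ∀ j ∈ τ, (inner ℝ (u i) (u j) : ℝ) = inner ℝ (w i) (w j)) :
    ∃ e : E n ≃ₗᵢ[ℝ] E n, ∀ i ∈ τ, e (u i) = w i := by
  classical
  let T (v : Fin N → E n) : (τ → ℝ) →ₗ[ℝ] E n := Fintype.linearCombination ℝ fun i : τ => v i
  have hsingle : ∀ (v : Fin N → E n) (i : τ), T v (Pi.single i 1) = v i := fun v i => by
    rw [Fintype.linearCombination_apply_single, one_smul]
  have hinj : Function.Injective (T u) := linearIndependent_iff_injective_fintypeLinearCombination.1 hu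
  have hinner : ∀ t s, (inner ℝ (T w t) (T w s) : ℝ) = inner ℝ (T u t) (T u s) := by
    intro t s
    simp only [T, Fintype.linearCombination_apply, sum_inner, inner_sum, inner_smul_left,
      inner_smul_right]
    refine Finset.sum_congr rfl fun i _ => congrArg (s i * ·) (Finset.sum_congr rfl fun j _ => ?_)
    rw [h j j.2 i i.2]
  let g := LinearEquiv.ofInjective (T u) hinj
  have hg : ∀ x, T u (g.symm x) = x := fun x => congrArg Subtype.val (g.apply_symm_apply x)
  obtain ⟨e, he⟩ := exists_extension _
    ((T w ∘ₗ g.symm.toLinearMap).isometryOfInner fun x y => by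
      change (inner ℝ (T w (g.symm x)) (T w (g.symm y)) : ℝ) = _
      rw [hinner, hg, hg]; rfl)
  refine ⟨e, fun i hi => ?_⟩
  have h1 := he (g (Pi.single ⟨i, hi⟩ 1))
  have h2 : ((g (Pi.single ⟨i, hi⟩ 1) : LinearMap.range (T u)) : E n) = u i := hsingle u ⟨i, hi⟩
  rw [h2] at h1
  rw [h1]
  change T w (g.symm (g _)) = _
  rw [g.symm_apply_apply, hsingle]

theorem comap_openSimplex {u w : Fin N → E n} {τ : Finset (Fin N)} (e : E n ≃ₗᵢ[ℝ] E n)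
    (he : ∀ i ∈ τ, e (u i) = w i) (hu : LinearIndepOn ℝ u (τ : Set (Fin N)))
    (hw : LinearIndepOn ℝ w (τ : Set (Fin N))) :
    comap e.toLinearMap (openSimplex w τ) = openSimplex u τ := by
  have := ((pushCone_eq_iff _ _ _).1 (pushCone_openSimplex e.toLinearIsometry he hu hw)).1
  exact Subtype.ext (funext fun x => (this x).symm)

theorem openSimplex_mem_coneGroupLE {v : Fin N → E n} {τ : Finset (Fin N)} {k : ℕ}
    (hτ : τ.card ≤ k) : openSimplex v τ ∈ coneGroupLE (E n) k := by
  by_cases h : LinearIndepOn ℝ v (τ : Set (Fin N))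
  · refine mem_coneGroupLE_of_support {()}
      (fun _ => Submodule.span ℝ (openConicalSimplex v τ)) (fun _ _ => ?_) _ fun x hx => ?_
    · rwa [finrank_span_openConicalSimplex h]
    · classical
      rw [openSimplex_val h, ind_apply, if_neg]
      exact fun hx' => hx () (Finset.mem_singleton_self _) (Submodule.subset_span hx')
  · rw [openSimplex, dif_neg h]
    exact zero_mem _

/-- The class in `L n` of an open conical simplex of dimension at most `n` in `ℝⁿ⁺¹`; simplices of
dimension `n + 1` are sent to zero. -/
noncomputable def simplexClass (v : Fin N → E (n + 1)) (τ : Finset (Fin N)) : L n :=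
  if h : τ.card ≤ n then
    descend (le_finrank_E n) ⟨openSimplex v τ, openSimplex_mem_coneGroupLE h⟩ else 0

/-- This makes a common face of several simplices of an abstract Euclidean cone contribute a single
class, although each simplex is embedded separately. -/
theorem simplexClass_congr {u w : Fin N → E (n + 1)} {τ : Finset (Fin N)}
    (hu : LinearIndepOn ℝ u (τ : Set (Fin N))) (hw : LinearIndepOn ℝ w (τ : Set (Fin N)))
    (h : ∀ i ∈ τ, ∀ j ∈ τ, (inner ℝ (u i) (u j) : ℝ) = inner ℝ (w i) (w j)) :
    simplexClass u τ = simplexClass w τ := by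
  obtain ⟨e, he⟩ := exists_isometry_of_inner_eq hu h
  unfold simplexClass
  split_ifs with hτ
  · rw [← descend_comap (le_finrank_E n) e (openSimplex w τ) (openSimplex_mem_coneGroupLE hτ)]
    exact congrArg (descend (le_finrank_E n)) (Subtype.ext (comap_openSimplex e he hu hw).symm)
  · rfl

theorem delta_openSimplex {v : Fin N → E (n + 1)} {σ : Finset (Fin N)}
    (hv : LinearIndepOn ℝ v (σ : Set (Fin N))) :
    delta n (cls (n + 1) (openSimplex v σ)) =
      ∑ τ ∈ σ.powerset, ((if τ = σ then 1 else 0) - (-1 : ℤ) ^ (n + 1 + σ.card)) •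
        simplexClass v τ := by
  classical
  have hcard : σ.card ≤ n + 1 := by
    rw [← finrank_span_openConicalSimplex hv]
    exact (Submodule.finrank_le _).trans (by simp)
  have hb : boundary n (openSimplex v σ) =
      ∑ τ ∈ σ.powerset, ((if τ = σ then 1 else 0) - (-1 : ℤ) ^ (n + 1 + σ.card)) •
        (if h : τ.card ≤ n then ⟨openSimplex v τ, openSimplex_mem_coneGroupLE h⟩ else 0 :
          coneGroupLE (E (n + 1)) n) := by
    apply Subtype.ext
    rw [AddSubgroup.val_finsetSum, boundary_val, interior_openSimplex hv, smul_smul, ← pow_add,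
      Finset.smul_sum]
    have h1 : openSimplex v σ =
        ∑ τ ∈ σ.powerset, (if τ = σ then (1 : ℤ) else 0) • openSimplex v τ := by
      simp [ite_smul]
    nth_rewrite 1 [h1]
    rw [← Finset.sum_sub_distrib]
    refine Finset.sum_congr rfl fun τ hτ => ?_
    rw [← sub_smul, AddSubgroup.coe_zsmul]
    split_ifs with h2 h3 h3
    · rfl
    -- Only the top face can have dimension `n + 1`, and there the coefficient `1 - (-1)^(2n+2)`
    -- vanishes. Setting its class to zero therefore loses nothing.
    · have : σ.card = n + 1 := by rw [h2] at h3; omega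
      rw [this, Even.neg_one_pow ⟨n + 1, rfl⟩, sub_self, zero_smul, zero_smul]
    · rfl
    · have h4 := Finset.card_lt_card (Finset.ssubset_iff_subset_ne.2
        ⟨Finset.mem_powerset.1 hτ, h2⟩)
      omega
  rw [delta_cls, hb, map_sum]
  refine Finset.sum_congr rfl fun τ _ => ?_
  rw [map_zsmul]
  congr 1
  unfold simplexClass
  split_ifs
  · rfl
  · exact map_zero _

end Gram

/-! ### Manifold cones are cycles, and `δ ∘ δ = 0` -/

section Manifolds

/-- Exchanging the order of summation, a face `τ` has coefficient `1 - (-1)ⁿ ∑ (-1)^|σ|` for `n >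
0`, summed over the faces `σ` containing `τ`. The Euler condition turns it into `1 - (-1)^(n+m)`,
which is zero by parity. -/
theorem toL_mem_Lplus {n m : ℕ} (M : EuclideanCone n) (hpar : Even m ↔ Even n)
    (hM : IsPLManifoldWithoutBoundary m M.space) : M.toL ∈ Lplus n := by
  classical
  rcases n with _ | n
  · trivial
  change delta n M.toL = 0
  have htoL : M.toL = ∑ σ ∈ M.faces, cls (n + 1) (openSimplex (M.vec σ) σ) := by
    rw [← Finset.sum_coe_sort]
    exact Finset.sum_congr rfl fun σ _ => by rw [openSimplex_eq (M.linearIndepOn σ σ.2)]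
  have h1 : ∀ σ ∈ M.faces, delta n (cls (n + 1) (openSimplex (M.vec σ) σ)) =
      ∑ τ ∈ M.faces, if τ ⊆ σ then ((if τ = σ then 1 else 0) - (-1 : ℤ) ^ (n + 1 + σ.card)) •
        simplexClass (M.vec τ) τ else 0 := by
    intro σ hσ
    rw [delta_openSimplex (M.linearIndepOn σ hσ), ← Finset.sum_filter]
    have : σ.powerset = M.faces.filter (· ⊆ σ) := by
      ext τ
      rw [Finset.mem_powerset, Finset.mem_filter]
      exact ⟨fun h => ⟨M.down_closed σ hσ τ h, h⟩, fun h => h.2⟩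
    rw [← this]
    refine Finset.sum_congr rfl fun τ hτ => ?_
    have hτσ := Finset.mem_powerset.1 hτ
    congr 1
    refine (simplexClass_congr (M.linearIndepOn τ (M.down_closed σ hσ τ hτσ))
      ((M.linearIndepOn σ hσ).mono hτσ) (M.compatible σ hσ τ hτσ)).symm
  rw [htoL, map_sum, Finset.sum_congr rfl h1, Finset.sum_comm]
  refine Finset.sum_eq_zero fun τ hτ => ?_
  rw [← Finset.sum_filter, ← Finset.sum_smul, Finset.sum_sub_distrib]
  have h2 : ∑ σ ∈ M.faces.filter (τ ⊆ ·), (if τ = σ then (1 : ℤ) else 0) = 1 := by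
    rw [Finset.sum_ite_eq, if_pos (Finset.mem_filter.2 ⟨hτ, subset_rfl⟩)]
  simp only [h2, pow_add _ (n + 1), ← Finset.mul_sum, M.sum_neg_one_pow_card hM hτ]
  rw [← pow_add, Even.neg_one_pow, sub_self, zero_smul]
  rw [Nat.even_add, hpar]

theorem manifoldSpan_le_Lplus (n : ℕ) : manifoldSpan n ≤ Lplus n := by
  refine (AddSubgroup.closure_le _).2 ?_
  rintro _ ⟨M, m, hpar, hM, rfl⟩
  exact toL_mem_Lplus M hpar hM

/-- Closing the cycle of inclusions through manifold cones also proves `δ ∘ δ = 0`, without a direct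
computation. -/
theorem Lplus_eq_range (n : ℕ) : Lplus n = (delta n).range :=
  le_antisymm (Lplus_le_range n) ((range_delta_le n).trans (manifoldSpan_le_Lplus n))

theorem Lplus_eq_manifoldSpan (n : ℕ) : Lplus n = manifoldSpan n :=
  le_antisymm ((Lplus_le_range n).trans (range_delta_le n)) (manifoldSpan_le_Lplus n)

theorem Lplus_eq_Lev {n : ℕ} (hn : Even n) : Lplus n = Lev n := by
  simp only [Lplus_eq_manifoldSpan, manifoldSpan, Lev, hn, iff_true]

theorem Lplus_eq_Lod {n : ℕ} (hn : Odd n) : Lplus n = Lod n := by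
  simp only [Lplus_eq_manifoldSpan, manifoldSpan, Lod, Nat.not_even_iff_odd.2 hn, iff_false,
    Nat.not_even_iff_odd]

theorem totalDelta_totalDelta (x : ⨁ n, L n) : totalDelta (totalDelta x) = 0 := by
  rw [totalDelta_eq_zero_iff]
  intro n
  rw [totalDelta_apply, Lplus_eq_range]
  exact ⟨_, rfl⟩

end Manifolds

/-! ### Signed subdivision of a simplicial cone by a vector -/

section HalvingRelation

/-- The parameters `s` for which `x - s a` has positive coordinates form an open interval, whose
possible endpoints are the `t i = x i / a i`. Only the least `t p` over positive `a p` and the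
greatest `t q` over negative `a q` can satisfy their conditions. The identity says that `0` lies in
`(t q, t p)` exactly when this interval is nonempty with `0 < t p`, but not with `0 < t q`. Without
negative `a i` the term of `q` is absent. -/
theorem sign_relation {ι : Type*} [Fintype ι] [DecidableEq ι] (a x : ι → ℝ) (ha : ∃ i, 0 < a i)
    (hx : ∀ i, x i ≠ 0) (hne : ∀ i j, i ≠ j → a i ≠ 0 → a j ≠ 0 → a j * x i ≠ a i * x j) :
    (if ∀ i, 0 < x i then (1 : ℤ) else 0) = ∑ i, (SignType.sign (a i) : ℤ) *
      if 0 < x i / a i ∧ ∀ j, j ≠ i → x i / a i * a j < x j then 1 else 0 := by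
  set t : ι → ℝ := fun i => x i / a i with ht
  set C : ι → Prop := fun i => 0 < t i ∧ ∀ j, j ≠ i → t i * a j < x j with hC
  change _ = ∑ i, (SignType.sign (a i) : ℤ) * if C i then 1 else 0
  have htne : ∀ i j, i ≠ j → a i ≠ 0 → a j ≠ 0 → t i ≠ t j := by
    intro i j hij hi hj h
    rw [ht, div_eq_div_iff hi hj] at h
    exact hne i j hij hi hj (by linarith)
  have ht0 : ∀ i, a i ≠ 0 → t i ≠ 0 := fun i hi => div_ne_zero (hx i) hi
  have hpos : ∀ s i, 0 < a i → (s * a i < x i ↔ s < t i) := fun s i h => (lt_div_iff₀ h).symm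
  have hneg : ∀ s i, a i < 0 → (s * a i < x i ↔ t i < s) := fun s i h => (div_lt_iff_of_neg h).symm
  obtain ⟨p, hp, hpmin⟩ : ∃ p, 0 < a p ∧ ∀ i, 0 < a i → t p ≤ t i := by
    obtain ⟨i, hi⟩ := ha
    obtain ⟨p, hp, hmin⟩ := Finset.exists_min_image (Finset.univ.filter (0 < a ·)) t
      ⟨i, Finset.mem_filter.2 ⟨Finset.mem_univ _, hi⟩⟩
    exact ⟨p, (Finset.mem_filter.1 hp).2, fun i hi =>
      hmin i (Finset.mem_filter.2 ⟨Finset.mem_univ _, hi⟩)⟩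
  have hCpos : ∀ i, 0 < a i → i ≠ p → ¬ C i := fun i hi hip h =>
    absurd ((hpos _ _ hp).1 (h.2 p hip.symm)) (hpmin i hi).not_gt
  by_cases hQ : ∃ i, a i < 0
  · obtain ⟨q, hq, hqmax⟩ : ∃ q, a q < 0 ∧ ∀ i, a i < 0 → t i ≤ t q := by
      obtain ⟨i, hi⟩ := hQ
      obtain ⟨q, hq, hmax⟩ := Finset.exists_max_image (Finset.univ.filter (a · < 0)) t
        ⟨i, Finset.mem_filter.2 ⟨Finset.mem_univ _, hi⟩⟩
      exact ⟨q, (Finset.mem_filter.1 hq).2, fun i hi =>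
        hmax i (Finset.mem_filter.2 ⟨Finset.mem_univ _, hi⟩)⟩
    have hpq : p ≠ q := by rintro rfl; linarith
    have hCneg : ∀ i, a i < 0 → i ≠ q → ¬ C i := fun i hi hiq h =>
      absurd ((hneg _ _ hq).1 (h.2 q hiq.symm)) (hqmax i hi).not_gt
    rw [← Finset.sum_subset (Finset.subset_univ {p, q}), Finset.sum_pair hpq, sign_pos hp,
      sign_neg hq]
    · have hCp : C p ↔ 0 < t p ∧ t q < t p ∧ ∀ j, a j = 0 → 0 < x j := by
        constructor
        · rintro ⟨h1, h2⟩
          refine ⟨h1, (hneg _ _ hq).1 (h2 q hpq.symm), fun j hj => ?_⟩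
          have := h2 j (by rintro rfl; linarith)
          rwa [hj, mul_zero] at this
        · rintro ⟨h1, h2, h3⟩
          refine ⟨h1, fun j hj => ?_⟩
          rcases lt_trichotomy (a j) 0 with h | h | h
          · exact (hneg _ _ h).2 ((hqmax j h).trans_lt h2)
          · rw [h, mul_zero]; exact h3 j h
          · exact (hpos _ _ h).2 (lt_of_le_of_ne (hpmin j h) (htne p j hj.symm hp.ne' h.ne'))
      have hCq : C q ↔ 0 < t q ∧ t q < t p ∧ ∀ j, a j = 0 → 0 < x j := by
        constructor
        · rintro ⟨h1, h2⟩
          refine ⟨h1, (hpos _ _ hp).1 (h2 p hpq), fun j hj => ?_⟩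
          have := h2 j (by rintro rfl; linarith)
          rwa [hj, mul_zero] at this
        · rintro ⟨h1, h2, h3⟩
          refine ⟨h1, fun j hj => ?_⟩
          rcases lt_trichotomy (a j) 0 with h | h | h
          · exact (hneg _ _ h).2 (lt_of_le_of_ne (hqmax j h) (htne j q hj h.ne hq.ne))
          · rw [h, mul_zero]; exact h3 j h
          · exact (hpos _ _ h).2 (h2.trans_le (hpmin j h))
      have hall : (∀ i, 0 < x i) ↔ 0 < t p ∧ t q < 0 ∧ ∀ j, a j = 0 → 0 < x j := by
        constructor
        · intro h
          exact ⟨div_pos (h p) hp, div_neg_of_pos_of_neg (h q) hq, fun j _ => h j⟩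
        · rintro ⟨h1, h2, h3⟩ j
          rcases lt_trichotomy (a j) 0 with h | h | h
          · have := (hneg 0 j h).2 ((hqmax j h).trans_lt h2)
            rwa [zero_mul] at this
          · exact h3 j h
          · have := (hpos 0 j h).2 (h1.trans_le (hpmin j h))
            rwa [zero_mul] at this
      have hp0 := ht0 p hp.ne'
      have hq0 := ht0 q hq.ne
      have hpq' := htne p q hpq hp.ne' hq.ne
      simp only [hCp, hCq, hall]
      by_cases hZ : ∀ j, a j = 0 → 0 < x j
      · have hZ' := iff_true_intro hZ
        simp only [hZ', and_true]
        rcases hp0.lt_or_gt with h1 | h1 <;> rcases hq0.lt_or_gt with h2 | h2 <;>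
          rcases hpq'.lt_or_gt with h3 | h3 <;>
          simp [h1, h2, h3, h1.not_gt, h2.not_gt, h3.not_gt] <;> linarith
      · simp [hZ]
    · intro i _ hi
      simp only [Finset.mem_insert, Finset.mem_singleton, not_or] at hi
      rcases lt_trichotomy (a i) 0 with h | h | h
      · rw [if_neg (hCneg i h hi.2), mul_zero]
      · rw [h, sign_zero]; exact zero_mul _
      · rw [if_neg (hCpos i h hi.1), mul_zero]
  · push Not at hQ
    rw [Finset.sum_eq_single p]
    · have hCp : C p ↔ ∀ i, 0 < x i := by
        constructor
        · rintro ⟨h1, h2⟩ j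
          rcases (hQ j).eq_or_lt with h | h
          · have := h2 j (by rintro rfl; linarith)
            rwa [← h, mul_zero] at this
          · have := (hpos 0 j h).2 (h1.trans_le (hpmin j h))
            rwa [zero_mul] at this
        · intro hall
          refine ⟨div_pos (hall p) hp, fun j hj => ?_⟩
          rcases (hQ j).eq_or_lt with h | h
          · rw [← h, mul_zero]; exact hall j
          · exact (hpos _ _ h).2 (lt_of_le_of_ne (hpmin j h) (htne p j hj.symm hp.ne' h.ne'))
      rw [sign_pos hp]
      simp only [hCp, SignType.coe_one, one_mul]
    · intro i _ hi
      rcases (hQ i).eq_or_lt with h | h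
      · rw [← h, sign_zero]; exact zero_mul _
      · rw [if_neg (hCpos i h hi), mul_zero]
    · exact fun h => absurd (Finset.mem_univ _) h

variable {N n : ℕ}

theorem sum_smul_update (v : Fin N → E n) (a s : Fin N → ℝ) (i : Fin N) :
    ∑ j, s j • Function.update v i (∑ k, a k • v k) j =
      ∑ j, (s i * a j + if j = i then 0 else s j) • v j := by
  have h : ∀ j, s j • Function.update v i (∑ k, a k • v k) j =
      (if j = i then s i • ∑ k, a k • v k else 0) + (if j = i then 0 else s j) • v j := by
    intro j
    by_cases hj : j = i
    · subst hj
      simp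
    · simp [hj]
  simp only [h, Finset.sum_add_distrib, add_smul, Finset.sum_ite_eq', Finset.mem_univ, if_true,
    Finset.smul_sum, smul_smul]

theorem linearIndependent_update {v : Fin N → E n} (hv : LinearIndependent ℝ v) (a : Fin N → ℝ)
    {i : Fin N} (hi : a i ≠ 0) :
    LinearIndependent ℝ (Function.update v i (∑ k, a k • v k)) := by
  rw [Fintype.linearIndependent_iff] at hv ⊢
  intro s hs
  rw [sum_smul_update] at hs
  have h := hv _ hs
  have hsi : s i = 0 := by
    have := h i
    rw [if_pos rfl, add_zero] at this
    exact (mul_eq_zero.1 this).resolve_right hi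
  intro j
  by_cases hj : j = i
  · rw [hj, hsi]
  · have := h j
    rwa [hsi, zero_mul, zero_add, if_neg hj] at this

theorem openSimplex_apply {v : Fin N → E n} (hv : LinearIndependent ℝ v) (x : E n)
    [Decidable (x ∈ openConicalSimplex v Finset.univ)] :
    (openSimplex v Finset.univ).1 x =
      if x ∈ openConicalSimplex v Finset.univ then 1 else 0 := by
  rw [openSimplex_val (LinearIndependent.linearIndepOn hv _), ind_apply]

/-- The subdivision of a simplicial cone by a vector `∑ aᵢ vᵢ`, up to elements of lower dimension.
When the vector is outside of the cone, some terms are subtracted. -/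
theorem openSimplex_sub_sum_mem {v : Fin (n + 1) → E (n + 1)} (hv : LinearIndependent ℝ v)
    (a : Fin (n + 1) → ℝ) (ha : ∃ i, 0 < a i) :
    openSimplex v Finset.univ - ∑ i, (SignType.sign (a i) : ℤ) •
      openSimplex (Function.update v i (∑ k, a k • v k)) Finset.univ ∈
        coneGroupLE (E (n + 1)) n := by
  classical
  let b := basisOfLinearIndependentOfCardEqFinrank hv (by simp)
  have hb : ∀ i, b i = v i := fun i => by
    rw [coe_basisOfLinearIndependentOfCardEqFinrank]
  have hrepr : ∀ t : Fin (n + 1) → ℝ, ∀ i, b.repr (∑ j, t j • v j) i = t i := by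
    intro t i
    simp only [← hb, b.repr_sum_self]
  have hsum : ∀ x, ∑ j, b.repr x j • v j = x := by
    intro x
    simp only [← hb, b.sum_repr]
  -- These forms cut out the walls: the coordinate hyperplanes and those where two of the ratios `x
  -- i / a i` agree. Off the walls `sign_relation` applies. Identically zero forms arise from `a i =
  -- a j = 0` and are discarded.
  let l (p : Fin (n + 1) × Fin (n + 1)) : E (n + 1) →ₗ[ℝ] ℝ :=
    if p.1 = p.2 then b.coord p.1 else a p.2 • b.coord p.1 - a p.1 • b.coord p.2
  refine mem_coneGroupLE_of_support (Finset.univ.filter (l · ≠ 0)) (fun p => LinearMap.ker (l p))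
    (fun p hp => ?_) _ fun x hx => ?_
  · have := Module.Dual.finrank_ker_add_one_of_ne_zero (f := l p) (Finset.mem_filter.1 hp).2
    rw [finrank_euclideanSpace_fin] at this
    omega
  have hx' : ∀ p, l p ≠ 0 → l p x ≠ 0 := fun p hp =>
    hx p (Finset.mem_filter.2 ⟨Finset.mem_univ _, hp⟩)
  have hcoord : ∀ i j, b.coord i (v j) = if i = j then 1 else 0 := by
    intro i j
    rw [← hb, b.coord_apply, b.repr_self, Finsupp.single_apply]
    exact if_congr eq_comm rfl rfl
  have h0 : ∀ i, b.repr x i ≠ 0 := by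
    intro i
    have := hx' (i, i) fun h => by
      have := LinearMap.congr_fun h (v i)
      simp [l, hcoord] at this
    simpa [l] using this
  have hne : ∀ i j, i ≠ j → a i ≠ 0 → a j ≠ 0 →
      a j * b.repr x i ≠ a i * b.repr x j := by
    intro i j hij hi hj h
    refine hx' (i, j) (fun h' => ?_) ?_
    · have := LinearMap.congr_fun h' (v i)
      simp [l, hcoord, hij, hij.symm, hj] at this
    · simp [l, hij, h]
  have hmem : x ∈ openConicalSimplex v Finset.univ ↔ ∀ i, 0 < b.repr x i := by
    rw [mem_openConicalSimplex_univ]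
    constructor
    · rintro ⟨t, ht, rfl⟩ i
      rw [hrepr]; exact ht i
    · exact fun h => ⟨_, h, (hsum x).symm⟩
  have hmem' : ∀ i, a i ≠ 0 →
      (x ∈ openConicalSimplex (Function.update v i (∑ k, a k • v k)) Finset.univ ↔
        0 < b.repr x i / a i ∧ ∀ j, j ≠ i → b.repr x i / a i * a j < b.repr x j) := by
    intro i hi
    rw [mem_openConicalSimplex_univ]
    constructor
    · rintro ⟨s, hs, rfl⟩
      rw [sum_smul_update]
      simp only [hrepr, if_true, add_zero, mul_div_cancel_right₀ _ hi]
      refine ⟨hs i, fun j hj => ?_⟩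
      rw [if_neg hj]
      linarith [hs j]
    · rintro ⟨h1, h2⟩
      -- The new generator takes the coefficient `x i / a i`, which uses up the `v i` component, and
      -- is then subtracted from the other coordinates.
      refine ⟨fun j => if j = i then b.repr x i / a i else b.repr x j - b.repr x i / a i * a j,
        fun j => ?_, ?_⟩
      · beta_reduce
        split_ifs with hj
        · exact h1
        · exact sub_pos.2 (h2 j hj)
      · rw [sum_smul_update]
        conv_lhs => rw [← hsum x]
        refine Finset.sum_congr rfl fun j _ => ?_
        congr 1
        by_cases hj : j = i
        · subst hj
          simp [div_mul_cancel₀ _ hi]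
        · simp [hj]
  have key : (if ∀ i, 0 < b.repr x i then (1 : ℤ) else 0) = ∑ i, (SignType.sign (a i) : ℤ) *
      if 0 < b.repr x i / a i ∧ ∀ j, j ≠ i → b.repr x i / a i * a j < b.repr x j then 1 else 0 := by
    convert sign_relation a (b.repr x) ha h0 hne
  change (openSimplex v Finset.univ).1 x - (∑ i, (SignType.sign (a i) : ℤ) •
      openSimplex (Function.update v i (∑ k, a k • v k)) Finset.univ :
        coneGroup (E (n + 1))).1 x = 0
  rw [sub_eq_zero, openSimplex_apply hv, AddSubgroup.val_finsetSum, Finset.sum_apply]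
  refine (if_congr hmem rfl rfl).trans (key.trans ?_)
  refine Finset.sum_congr rfl fun i _ => ?_
  rw [AddSubgroup.coe_zsmul, Pi.smul_apply, smul_eq_mul]
  by_cases hi : a i = 0
  · rw [hi, sign_zero]; exact (zero_mul _).trans (zero_mul _).symm
  · rw [openSimplex_apply (linearIndependent_update hv a hi)]
    exact congrArg _ (if_congr (hmem' i hi).symm rfl rfl)

theorem openSimplex_comp_perm {v : Fin N → E n} (hv : LinearIndependent ℝ v)
    (π : Equiv.Perm (Fin N)) :
    openSimplex (v ∘ π) Finset.univ = openSimplex v Finset.univ := by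
  classical
  apply Subtype.ext
  funext x
  rw [openSimplex_apply hv, openSimplex_apply (hv.comp π π.injective)]
  refine if_congr ?_ rfl rfl
  rw [mem_openConicalSimplex_univ, mem_openConicalSimplex_univ]
  constructor
  · rintro ⟨t, ht, rfl⟩
    refine ⟨t ∘ π.symm, fun i => ht _, ?_⟩
    rw [← Equiv.sum_comp π fun i => (t ∘ π.symm) i • v i]
    simp
  · rintro ⟨t, ht, rfl⟩
    refine ⟨t ∘ π, fun i => ht _, ?_⟩
    rw [← Equiv.sum_comp π fun i => t i • v i]
    simp

theorem openSimplex_smul {v : Fin N → E n} (hv : LinearIndependent ℝ v) {r : Fin N → ℝ}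
    (hr : ∀ i, 0 < r i) :
    LinearIndependent ℝ (fun i => r i • v i) ∧
      openSimplex (fun i => r i • v i) Finset.univ = openSimplex v Finset.univ := by
  classical
  have hv' : LinearIndependent ℝ (fun i => r i • v i) := by
    rw [Fintype.linearIndependent_iff] at hv ⊢
    intro s hs i
    simp only [smul_smul] at hs
    exact (mul_eq_zero.1 (hv _ hs i)).resolve_right (hr i).ne'
  refine ⟨hv', Subtype.ext (funext fun x => ?_)⟩
  rw [openSimplex_apply hv, openSimplex_apply hv']
  refine if_congr ?_ rfl rfl
  rw [mem_openConicalSimplex_univ, mem_openConicalSimplex_univ]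
  constructor
  · rintro ⟨t, ht, rfl⟩
    exact ⟨fun i => t i * r i, fun i => mul_pos (ht i) (hr i), by simp only [smul_smul]⟩
  · rintro ⟨t, ht, rfl⟩
    refine ⟨fun i => t i / r i, fun i => div_pos (ht i) (hr i), ?_⟩
    simp only [smul_smul, div_mul_cancel₀ _ (hr _).ne']

end HalvingRelation

/-! ### Halving simplices by circumcenters -/

section Halving

variable {n : ℕ}

/-- The elements of the cone group of `ℝⁿ⁺¹` whose boundary has the form `ξ + (-1)ⁿ I ξ`. -/
noncomputable def halvable (n : ℕ) : AddSubgroup (coneGroup (E (n + 1))) :=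
  ((AddMonoidHom.id (L n) + (-1 : ℤ) ^ n • interiorL n).range).comap
    ((delta n).comp (cls (n + 1)))

theorem mem_halvable {f : coneGroup (E (n + 1))} : f ∈ halvable n ↔
    ∃ ξ : L n, ξ + (-1 : ℤ) ^ n • interiorL n ξ = delta n (cls (n + 1) f) := Iff.rfl

theorem coneGroupLE_le_halvable : coneGroupLE (E (n + 1)) n ≤ halvable n := fun _ hf =>
  mem_of_pushCone_mem (le_finrank_E n) (fun φ g => mem_halvable.2
    ⟨cls n g, (delta_cls_pushCone φ g).symm⟩) hf

theorem smul_interiorL_of_mem_Lplus {x : L n} (hx : x ∈ Lplus n) :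
    (-1 : ℤ) ^ n • interiorL n x = x := by
  have h0 : totalDelta (DirectSum.of L n x) = 0 := by
    rcases n with _ | n
    · exact totalDelta_of_zero x
    · rw [totalDelta_of_succ]
      exact (congrArg _ hx).trans (map_zero _)
  have := twist_eq_self h0
  rw [twist_of] at this
  exact DirectSum.of_injective n this

/-- The witness is `δ⟨f⟩`. It lies in `L⁺`, where `(-1)ⁿ I` is the identity, so the operator doubles
it. -/
theorem two_smul_mem_halvable (f : coneGroup (E (n + 1))) : (2 : ℤ) • f ∈ halvable n := by
  refine mem_halvable.2 ⟨delta n (cls (n + 1) f), ?_⟩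
  rw [smul_interiorL_of_mem_Lplus (by rw [Lplus_eq_range]; exact ⟨_, rfl⟩), map_zsmul, map_zsmul,
    two_smul]

/-- A vector in the span of the vectors `v i` with `i ∈ A` that has the same inner product with
all of them. -/
theorem exists_circumcenter {N : ℕ} {v : Fin N → E N} (hv : LinearIndependent ℝ v)
    {A : Finset (Fin N)} (hA : A.Nonempty) :
    ∃ a : Fin N → ℝ, (∀ i, i ∉ A → a i = 0) ∧
      (∀ i ∈ A, (inner ℝ (∑ k, a k • v k) (v i) : ℝ) = 1) ∧ ∃ i, 0 < a i := by
  classical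
  let b := basisOfLinearIndependentOfCardEqFinrank' v hv (by simp)
  -- `d` has inner product `1` with every generator. Its orthogonal projection to the span of the
  -- vectors indexed by `A` keeps this for those vectors.
  let d : E N := (InnerProductSpace.toDual ℝ (E N)).symm
    (LinearMap.toContinuousLinearMap (b.constr ℝ fun _ => (1 : ℝ)))
  have hd : ∀ i, (inner ℝ d (v i) : ℝ) = 1 := by
    intro i
    rw [InnerProductSpace.toDual_symm_apply]
    have h := b.constr_basis ℝ (fun _ => (1 : ℝ)) i
    rwa [coe_basisOfLinearIndependentOfCardEqFinrank'] at h
  let W := Submodule.span ℝ (v '' (A : Set (Fin N)))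
  obtain ⟨a, ha⟩ : ∃ a : Fin N → ℝ, ∑ i ∈ A, a i • v i = W.starProjection d := by
    obtain ⟨a, ha⟩ := (Submodule.mem_span_image_finset_iff_exists_fun ℝ).1
      (W.starProjection_apply_mem d)
    refine ⟨fun k => if h : k ∈ A then a ⟨k, h⟩ else 0, ?_⟩
    rw [← ha, ← Finset.sum_coe_sort]
    simp
  have hsum : ∑ k, (if k ∈ A then a k else 0) • v k = W.starProjection d := by
    rw [← ha, ← Finset.sum_subset (Finset.subset_univ A)]
    · exact Finset.sum_congr rfl fun i hi => by rw [if_pos hi]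
    · intro i _ hi
      rw [if_neg hi, zero_smul]
  have hinner : ∀ i ∈ A, (inner ℝ (W.starProjection d) (v i) : ℝ) = 1 := by
    intro i hi
    rw [W.inner_starProjection_left_eq_right,
      Submodule.starProjection_eq_self_iff.2 (show v i ∈ W from Submodule.subset_span ⟨i, hi, rfl⟩),
      hd]
  refine ⟨fun k => if k ∈ A then a k else 0, fun i hi => if_neg hi, fun i hi => ?_, ?_⟩
  · rw [hsum, hinner i hi]
  -- The squared length of the projection equals the sum of its coefficients. If none were positive,
  -- the projection would vanish, contradicting the inner products `1`.
  · by_contra hc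
    push Not at hc
    obtain ⟨i, hi⟩ := hA
    have h1 : (inner ℝ (W.starProjection d) (W.starProjection d) : ℝ) ≤ 0 := by
      nth_rewrite 2 [← hsum]
      rw [inner_sum]
      refine Finset.sum_nonpos fun k _ => ?_
      rw [inner_smul_right]
      by_cases hk : k ∈ A
      · rw [hinner k hk, mul_one]; exact hc k
      · simp only [if_neg hk, zero_mul, le_refl]
    have h2 := real_inner_self_nonpos.1 h1
    have := hinner i hi
    rw [h2, inner_zero_left] at this
    exact zero_ne_one this

/-- The set `A` indexes vectors of equal length that the other generators do not distinguish.
Cutting at their circumcenter replaces one of them by a vector with the same property relative to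
the rest, so `A` shrinks. At two vectors, the cut produces two pieces exchanged by a reflection. -/
theorem openSimplex_mem_halvable_of_inner_eq (A : Finset (Fin (n + 1))) :
    ∀ v : Fin (n + 1) → E (n + 1), 2 ≤ A.card → LinearIndependent ℝ v →
      (∀ i ∈ A, ∀ j ∈ A, (inner ℝ (v i) (v i) : ℝ) = inner ℝ (v j) (v j)) →
      (∀ k, k ∉ A → ∀ i ∈ A, ∀ j ∈ A, (inner ℝ (v k) (v i) : ℝ) = inner ℝ (v k) (v j)) →
      openSimplex v Finset.univ ∈ halvable n := by
  classical
  induction A using Finset.strongInduction with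
  | H A ih =>
  intro v hA hv hnorm hin
  obtain ⟨a, ha0, ha1, hapos⟩ := exists_circumcenter hv (A := A) (Finset.card_pos.1 (by omega))
  set c := ∑ k, a k • v k with hc
  have hrel := coneGroupLE_le_halvable (openSimplex_sub_sum_mem hv a hapos)
  rw [← hc] at hrel
  suffices h : ∑ i, (SignType.sign (a i) : ℤ) • openSimplex (Function.update v i c) Finset.univ ∈
      halvable n by
    have := add_mem hrel h
    rwa [sub_add_cancel] at this
  rcases hA.lt_or_eq with hA | hA
  · refine sum_mem fun i _ => ?_
    by_cases hai : a i = 0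
    · rw [hai, sign_zero]
      exact (zero_smul ℤ (openSimplex (Function.update v i c) Finset.univ)).symm ▸ zero_mem _
    have hiA : i ∈ A := by
      by_contra h
      exact hai (ha0 i h)
    -- The circumcenter now occupies position `i` outside the smaller set, and its inner product
    -- with each remaining vector of that set is `1`.
    refine zsmul_mem (ih (A.erase i) (Finset.erase_ssubset hiA) _ ?_
      (linearIndependent_update hv a hai) ?_ ?_) _
    · rw [Finset.card_erase_of_mem hiA]; omega
    · intro j hj k hk
      obtain ⟨hj1, hj2⟩ := Finset.mem_erase.1 hj
      obtain ⟨hk1, hk2⟩ := Finset.mem_erase.1 hk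
      rw [Function.update_of_ne hj1, Function.update_of_ne hk1]
      exact hnorm j hj2 k hk2
    · intro l hl j hj k hk
      obtain ⟨hj1, hj2⟩ := Finset.mem_erase.1 hj
      obtain ⟨hk1, hk2⟩ := Finset.mem_erase.1 hk
      rw [Function.update_of_ne hj1, Function.update_of_ne hk1]
      by_cases hli : l = i
      · rw [hli, Function.update_self, ha1 j hj2, ha1 k hk2]
      · rw [Function.update_of_ne hli]
        exact hin l (fun h => hl (Finset.mem_erase.2 ⟨hli, h⟩)) j hj2 k hk2
  · obtain ⟨p, q, hpq, rfl⟩ := Finset.card_eq_two.1 hA.symm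
    have hpA : p ∈ ({p, q} : Finset (Fin (n + 1))) := by simp
    have hqA : q ∈ ({p, q} : Finset (Fin (n + 1))) := by simp
    have hcpq : c = a p • v p + a q • v q := by
      rw [hc, ← Finset.sum_subset (Finset.subset_univ {p, q}), Finset.sum_pair hpq]
      intro i _ hi
      rw [ha0 i hi, zero_smul]
    have hpp := hnorm p hpA q hqA
    -- By symmetry the circumcenter is a multiple of `v p + v q`, and some positive coefficient
    -- makes the multiple positive.
    have haa : a p = a q := by
      have h1 := (ha1 p hpA).trans (ha1 q hqA).symm
      rw [hcpq] at h1
      simp only [inner_add_left, inner_smul_left, conj_trivial] at h1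
      rw [real_inner_comm (v p) (v q), hpp] at h1
      have h2 : (a p - a q) * ((inner ℝ (v q) (v q) : ℝ) - inner ℝ (v p) (v q)) = 0 := by linarith
      rcases mul_eq_zero.1 h2 with h | h
      · linarith
      · have h3 : (inner ℝ (v p - v q) (v p - v q) : ℝ) = 0 := by
          simp only [inner_sub_left, inner_sub_right]
          rw [real_inner_comm (v p) (v q), hpp]
          linarith
        exact absurd (hv.injective (sub_eq_zero.1 (inner_self_eq_zero.1 h3))) hpq
    have hap : 0 < a p := by
      obtain ⟨i, hi⟩ := hapos
      by_cases hiA : i ∈ ({p, q} : Finset (Fin (n + 1)))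
      · rcases Finset.mem_insert.1 hiA with rfl | h
        · exact hi
        · rw [Finset.mem_singleton] at h
          rwa [haa, ← h]
      · rw [ha0 i hiA] at hi
        exact absurd hi (lt_irrefl _)
    have hindep : ∀ i, a i ≠ 0 → LinearIndependent ℝ (Function.update v i c) := fun i hi =>
      linearIndependent_update hv a hi
    have hup := hindep p hap.ne'
    have huq := hindep q (haa ▸ hap.ne')
    have hw : LinearIndependent ℝ (Function.update v q c ∘ Equiv.swap p q) :=
      huq.comp _ (Equiv.swap p q).injective
    have hwp : (Function.update v q c ∘ Equiv.swap p q) p = c := by simp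
    have hwq : (Function.update v q c ∘ Equiv.swap p q) q = v p := by
      simp [Function.update_of_ne hpq]
    have hwk : ∀ k, k ≠ p → k ≠ q → (Function.update v q c ∘ Equiv.swap p q) k = v k := by
      intro k h1 h2
      simp [Equiv.swap_apply_of_ne_of_ne h1 h2, Function.update_of_ne h2]
    have hdiff : ∀ k, k ≠ p → k ≠ q → (inner ℝ (v q) (v k) : ℝ) = inner ℝ (v p) (v k) := by
      intro k h1 h2
      rw [real_inner_comm, real_inner_comm (v k) (v p)]
      exact hin k (by simp [h1, h2]) q hqA p hpA
    have hcc := (ha1 q hqA).trans (ha1 p hpA).symm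
    -- One half has generators `c, v q` at `p, q`, the other `v p, c`. After exchanging the two
    -- positions of the latter, the Gram matrices coincide, so the halves are congruent.
    obtain ⟨e, he⟩ := exists_isometry_of_inner_eq (u := Function.update v p c)
      (w := Function.update v q c ∘ Equiv.swap p q)
      (LinearIndependent.linearIndepOn hup ((Finset.univ : Finset (Fin (n + 1))) : Set _)) (by
        have hsymm : ∀ i j, (i = p ∨ (i = q ∧ j ≠ p) ∨ (i ≠ p ∧ i ≠ q ∧ j ≠ p ∧ j ≠ q)) →
            (inner ℝ (Function.update v p c i) (Function.update v p c j) : ℝ) =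
              inner ℝ ((Function.update v q c ∘ Equiv.swap p q) i)
                ((Function.update v q c ∘ Equiv.swap p q) j) := by
          rintro i j (rfl | ⟨rfl, hj⟩ | ⟨h1, h2, h3, h4⟩)
          · rw [Function.update_self, hwp]
            by_cases hj : j = i
            · rw [hj, Function.update_self, hwp]
            rw [Function.update_of_ne hj]
            by_cases hj' : j = q
            · rw [hj', hwq, hcc]
            · rw [hwk j hj hj']
          · rw [Function.update_of_ne hpq.symm, Function.update_of_ne hj, hwq]
            by_cases hj' : j = i
            · rw [hj', hwq, hpp]
            · rw [hwk j hj hj', hdiff j hj hj']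
          · rw [Function.update_of_ne h1, Function.update_of_ne h3, hwk i h1 h2, hwk j h3 h4]
        intro i _ j _
        by_cases h : i = p ∨ (i = q ∧ j ≠ p) ∨ (i ≠ p ∧ i ≠ q ∧ j ≠ p ∧ j ≠ q)
        · exact hsymm i j h
        · rw [real_inner_comm, hsymm j i (by tauto), real_inner_comm])
    have hcomap := comap_openSimplex e he
      (LinearIndependent.linearIndepOn hup _) (LinearIndependent.linearIndepOn hw _)
    rw [openSimplex_comp_perm huq] at hcomap
    have hcl : openSimplex (Function.update v p c) Finset.univ +
        openSimplex (Function.update v q c) Finset.univ ∈ halvable n := by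
      -- The congruent halves have the same class in `L (n + 1)`, so their sum has the class of
      -- twice one of them.
      refine mem_halvable.2 ?_
      have h2 := mem_halvable.1
        (two_smul_mem_halvable (openSimplex (Function.update v q c) Finset.univ))
      rw [two_smul, map_add] at h2
      rw [← hcomap, map_add, cls_comap]
      exact h2
    rw [← Finset.sum_subset (Finset.subset_univ {p, q}), Finset.sum_pair hpq, ← haa, sign_pos hap]
    · simpa using hcl
    · intro i _ hi
      rw [ha0 i hi, sign_zero]
      exact zero_smul ℤ (openSimplex (Function.update v i c) Finset.univ)

/-- Generators of a simplicial cone can be rescaled to unit length, so all of them may be taken for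
the set `A` at the start. Positivity of `n` provides the two vectors that the halving requires. -/
theorem mem_halvable_of_pos (hn : 0 < n) (f : coneGroup (E (n + 1))) : f ∈ halvable n := by
  refine mem_of_openSimplex_mem (fun k v hv => ?_) f
  have hk : k ≤ n + 1 := by
    have := hv.fintype_card_le_finrank
    simpa using this
  rcases hk.lt_or_eq with hk | rfl
  · exact coneGroupLE_le_halvable (openSimplex_mem_coneGroupLE (by simp; omega))
  have hpos : ∀ i, 0 < ‖v i‖ := fun i => norm_pos_iff.2 (hv.ne_zero i)
  obtain ⟨h1, h2⟩ := openSimplex_smul hv fun i => inv_pos.2 (hpos i)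
  rw [← h2]
  refine openSimplex_mem_halvable_of_inner_eq Finset.univ _ (by simp; omega) h1
    (fun i _ j _ => ?_) fun k hk => absurd (Finset.mem_univ k) hk
  have : ∀ i, (inner ℝ (‖v i‖⁻¹ • v i) (‖v i‖⁻¹ • v i) : ℝ) = 1 := by
    intro i
    rw [real_inner_self_eq_norm_sq, norm_smul, norm_inv, norm_norm, inv_mul_cancel₀ (hpos i).ne',
      one_pow]
  rw [this, this]

theorem Lplus_eq_range_add (hn : 0 < n) :
    Lplus n = (AddMonoidHom.id (L n) + (-1 : ℤ) ^ n • interiorL n).range := by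
  apply le_antisymm
  · rw [Lplus_eq_range]
    rintro _ ⟨x, rfl⟩
    obtain ⟨f, rfl⟩ := cls_surjective _ x
    exact mem_halvable_of_pos hn f
  · rintro _ ⟨x, rfl⟩
    obtain ⟨n, rfl⟩ := Nat.exists_eq_succ_of_ne_zero hn.ne'
    obtain ⟨f, rfl⟩ := cls_surjective _ x
    change delta n (cls (n + 1) f + (-1 : ℤ) ^ (n + 1) • interiorL (n + 1) (cls (n + 1) f)) = 0
    rw [interiorL_cls, ← map_zsmul, ← map_add, delta_cls]
    convert map_zero (descend (le_finrank_E n))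
    apply Subtype.ext
    -- As the involution squares to the identity, the signed involution fixes `f + (-1)ⁿ⁺¹ I f`, so
    -- its boundary is zero already as an element of the cone group.
    rw [boundary_val, map_add, map_zsmul, interior_interior, smul_add, smul_smul, ← mul_pow]
    simp [add_comm]

end Halving
end ConeRing

theorem mainTheorem6 :
    (∀ n, ConeRing.Lplus n = (ConeRing.delta n).range) ∧
    (∃ S : Subring (⨁ n, ConeRing.L n),
      (∀ x, x ∈ S ↔ ∀ n, x n ∈ ConeRing.Lplus n) ∧
      ∃ b : Module.Basis (Fin 2) S (⨁ n, ConeRing.L n),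
        b 0 = 1 ∧ b 1 = DirectSum.of ConeRing.L 1 ConeRing.halfLine) ∧
    (∀ n, Even n → ConeRing.Lplus n = ConeRing.Lev n) ∧
    (∀ n, Odd n → ConeRing.Lplus n = ConeRing.Lod n) ∧
    (∀ n, 0 < n → ConeRing.Lplus n =
      (AddMonoidHom.id (ConeRing.L n) + (-1 : ℤ) ^ n • ConeRing.interiorL n).range) :=
  ⟨ConeRing.Lplus_eq_range,
    ⟨ConeRing.plusSubring, fun x => ConeRing.totalDelta_eq_zero_iff x,
      ConeRing.exists_basis ConeRing.totalDelta_totalDelta⟩,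
    fun _ => ConeRing.Lplus_eq_Lev, fun _ => ConeRing.Lplus_eq_Lod,
    fun _ => ConeRing.Lplus_eq_range_add⟩
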